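/- Let $k$ be a finite field of characteristic $p$, let $C$ be a smooth, complete, geometrically connected curve over $k$ with function field $K$, and let $n\ge 1$ be an integer with $p>4n$. Let $U$ be the split quadratic space of dimension $2n+2$ whose Gram matrix has ones on the antidiagonal and zeros elsewhere, let $G=\mathrm{PSO}(U)=\mathrm{GSO}(U)/\mathbb G_m$, and let $V$ be the space of self-adjoint operators of trace $0$ on $U$, with $G$ acting by conjugation. Let $V^{\mathrm{reg}}\subset V$ be the open subset of the operators whose stabiliser in $G$ is finite (on geometric points). The coefficients of the characteristic polynomial $x^{2n+2}+c_2x^{2n}+\dots+c_{2n+1}x+c_{2n+2}$ define $\pi:V\to S=\mathrm{Spec}\,k[c_2,\dots,c_{2n+2}]$. The Kostant section $\kappa_1:S\to V^{\mathrm{reg}}$ of $\pi$ is $\kappa_1(c)=A+B$, where $A_{i+1,i}=1$ for $1\le i\le 2n+1$ and the other entries of $A$ are $0$, and the only nonzero entries of $B$ are, with rows $i\le n+1$ and columns $j\ge n+2$, $B_{ij}=-c_{j-i+1}$ if $i+j=2n+3$ and $B_{ij}=-\tfrac12c_{j-i+1}$ if $i+j\in\{2n+2,2n+4\}$. A $G$-bundle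 $\mathcal E$ on $C$ is given by a $\mathrm{GSO}(U)$-bundle, i.e. a vector bundle $E$ of rank $2n+2$ with a perfect symmetric pairing $E\otimes E\to\mathcal L$ into a line bundle and an orientation $\det E\cong\mathcal L^{\otimes(n+1)}$ compatible with the discriminant; it is unique up to twist by a line bundle. A reduction to the Borel subgroup $B\subset\mathrm{GSO}(U)$ is an isotropic flag $0\subset E_1\subset\dots\subset E_{n+1}\subset E$ of subbundles of ranks $1,\dots,n+1$, with $E_{n+1}$ in the family of Lagrangian subbundles determined by the orientation. Put $X_i=E_i/E_{i-1}$, $\mu_i=\deg X_i$, $d=\deg\mathcal L$. The reduction is canonical if $\mu_1>\dots>\mu_{n+1}$ and $\mu_n+\mu_{n+1}>d$. For a line bundle $\mathcal F$ on $C$ with $f=\deg\mathcal F$, let $\mathrm{St}_{\mathcal F}$ be the set of $G$-bundles that have a canonical reduction to $B$ with $\mu_i=\mu_{i+1}+f$ for $1\le i\le n$ and $2\mu_{n+1}-d=f$. Let $\mathcal A_{\mathcal F}(k)=\prod_{m=2}^{2n+2}H^0(C,\mathcal F^{\otimes m})$, and for $c\in\mathcal A_{\mathcal F}(k)$ let $\Delta(c)$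 be the discriminant of $x^{2n+2}+c_2x^{2n}+\dots+c_{2n+2}$. Let $\mathcal E_{\mathcal F}$ be the $G$-bundle given by $\bigoplus_{i=1}^{2n+2}\mathcal F^{\otimes(n+1-i)}$ with the antidiagonal pairing into $\mathcal F^{-1}$ and the standard orientation; for $c\in\mathcal A_{\mathcal F}(k)$ the matrix $\kappa_1(c)$ is a section of $(\mathcal E_{\mathcal F}\times^GV^{\mathrm{reg}})\otimes\mathcal F$. Then: 1. Let $\mathcal E\in\mathrm{St}_{\mathcal F}$ and let $s$ be a section of $(\mathcal E\times^GV^{\mathrm{reg}})\otimes\mathcal F$ whose generic fibre has nonzero discriminant. Then $s$ factors through $\kappa_1$: if $c=\pi(s)\in\mathcal A_{\mathcal F}(k)$, there is an isomorphism of $G$-bundles $\mathcal E_{\mathcal F}\cong\mathcal E$ that carries $\kappa_1(c)$ to $s$. 2. Consequently the contribution of these bundles to the average is $1$. Precisely, let $M_{\mathcal F}$ be the set of isomorphism classes of pairs $(\mathcal E,s)$ with $\mathcal E\in\mathrm{St}_{\mathcal F}$ and $s$ as in 1. These pairs have only the trivial automorphism; if $f>0$, then $M_{\mathcal F}$ is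 finite and $|M_{\mathcal F}|=|\{c\in\mathcal A_{\mathcal F}(k):\Delta(c)\neq0\}|$; and $$\lim_{\deg\mathcal F\to\infty}\frac{|M_{\mathcal F}|}{|\mathcal A_{\mathcal F}(k)|}=1,$$ where $\mathcal F$ runs over all line bundles on $C$. -/

import Mathlib

open Module Filter Topology Polynomial

universe u w w' w''

noncomputable section

namespace CurveBundle

/-! ## The curve

A smooth, complete, geometrically connected curve `C` over a finite (hence perfect) field `k` is
given by its function field `K = k(C)`: the closed points of `C` are the places of `K / k`, and the
local ring of `C` at such a point is the corresponding valuation ring. -/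

/-- `K / k` is the function field of a geometrically connected curve over the (perfect) field `k`:
it is finite over some `k(t)` with `t` transcendental, and `k` is algebraically closed in `K`. -/
structure IsCurveFunctionField (k K : Type u) [Field k] [Field K] [Algebra k K] : Prop where
  finite_over_rational : ∃ t : K, Transcendental k t ∧
    FiniteDimensional (IntermediateField.adjoin k ({t} : Set K)) K
  algebraically_closed : ∀ x : K, IsAlgebraic k x → ∃ a : k, algebraMap k K a = x

/-- A place of `K / k`, i.e. a closed point of `C`, with its local ring `ring` inside `K`. -/
structure Place (k K : Type u) [Field k] [Field K] [Algebra k K] where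
  ring : ValuationSubring K
  const_mem : ∀ a : k, algebraMap k K a ∈ ring
  ne_top : ring ≠ ⊤

section Basic

variable {k K : Type u} [Field k] [Field K] [Algebra k K]

instance Place.algebra (v : Place k K) : Algebra k v.ring :=
  ((algebraMap k K).codRestrict v.ring v.const_mem).toAlgebra

/-- The degree `[κ(v) : k]` of a closed point. -/
def Place.degree (v : Place k K) : ℕ := finrank k (IsLocalRing.ResidueField v.ring)

end Basic

/-! ## Vector bundles

A vector bundle on `C` with generic fibre the `K`-vector space `W` is the family of its stalks at
the closed points, which are lattices in `W`, almost all of them spanned by one and the same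
`K`-basis of `W`. -/

/-- Vector bundles on `C` with generic fibre `W`. -/
structure VecBundle (k K : Type u) [Field k] [Field K] [Algebra k K]
    (W : Type w) [AddCommGroup W] [Module K W] where
  stalk : ∀ v : Place k K, Submodule v.ring W
  fg : ∀ v, (stalk v).FG
  span_eq_top : ∀ v, Submodule.span K (stalk v : Set W) = ⊤
  coherent : ∃ (r : ℕ) (b : Basis (Fin r) K W),
    {v | stalk v ≠ Submodule.span v.ring (Set.range b)}.Finite

/-- Line bundles, embedded in the constant sheaf `K` (every line bundle on `C` is isomorphic to
such a one). -/
abbrev LineBundle (k K : Type u) [Field k] [Field K] [Algebra k K] := VecBundle k K K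

section Bundles

variable {k K : Type u} [Field k] [Field K] [Algebra k K]
  {W : Type w} [AddCommGroup W] [Module K W]

/-- The relative length `[S : T] = length (S / S ∩ T) - length (T / S ∩ T)` of two lattices. -/
def relLength {R : Type u} [CommRing R] [Module R W] (S T : Submodule R W) : ℤ :=
  ((Module.length R (S ⧸ (S ⊓ T).submoduleOf S)).toNat : ℤ)
    - ((Module.length R (T ⧸ (S ⊓ T).submoduleOf T)).toNat : ℤ)

/-- The degree of the bundle with stalks `S v`: the relative lengths of its stalks to the lattices
spanned by a `K`-basis of the generic fibre, weighted by the degrees of the closed points.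
(The product formula makes this independent of the basis.) -/
def degree [Module.Finite K W] (S : ∀ v : Place k K, Submodule v.ring W) : ℤ :=
  ∑ᶠ v : Place k K, (v.degree : ℤ) *
    relLength (S v) (Submodule.span v.ring (Set.range (finBasis K W)))

/-- The stalk at `v` of the `m`-th tensor power of a line bundle, for an integer `m`. -/
def VecBundle.powStalk (F : LineBundle k K) (m : ℤ) (v : Place k K) : Submodule v.ring K :=
  Submodule.span v.ring {x | ∃ a : K, F.stalk v = Submodule.span v.ring {a} ∧ x = a ^ m}

/-- The space `H⁰(C, F^m)` of global sections. -/
def VecBundle.sectionsPow (F : LineBundle k K) (m : ℤ) : Set K :=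
  {x | ∀ v : Place k K, x ∈ F.powStalk m v}

/-- The stalk at `v` of the tensor product of the line bundle `F` with the bundle `E`. -/
def VecBundle.twistStalk (E : VecBundle k K W) (F : LineBundle k K) (v : Place k K) :
    Submodule v.ring W :=
  Submodule.span v.ring {x | ∃ a ∈ F.stalk v, ∃ y ∈ E.stalk v, x = a • y}

end Bundles

/-! ## `GSO`-bundles and `PSO`-bundles -/

/-- A `GSO(2n+2)`-bundle on `C` with generic fibre `W`: a vector bundle `E` of rank `2n+2`, a line
bundle `L`, a perfect symmetric pairing `q : E × E → L`, and an orientation `η`, i.e. a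
trivialisation `det E ≅ L^(n+1)` whose square is the isomorphism given by the discriminant
`(-1)^(n+1) det q`. -/
structure GSOBundle (k K : Type u) [Field k] [Field K] [Algebra k K] (n : ℕ)
    (W : Type w) [AddCommGroup W] [Module K W] where
  E : VecBundle k K W
  finrank_eq : finrank K W = 2 * n + 2
  L : LineBundle k K
  q : LinearMap.BilinForm K W
  symm : ∀ x y, q x y = q y x
  perfect : ∀ (v : Place k K) (y : W),
    y ∈ E.stalk v ↔ ∀ x ∈ E.stalk v, q x y ∈ L.stalk v
  η : W [⋀^Fin (2 * n + 2)]→ₗ[K] K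
  η_sq : ∀ b : Fin (2 * n + 2) → W,
    η b ^ 2 = (-1) ^ (n + 1) * (Matrix.of fun i j => q (b i) (b j)).det

section GBundles

variable {k K : Type u} [Field k] [Field K] [Algebra k K] {n : ℕ}
  {W : Type w} [AddCommGroup W] [Module K W]
  {W' : Type w'} [AddCommGroup W'] [Module K W']
  {W'' : Type w''} [AddCommGroup W''] [Module K W'']

/-- A `PSO(2n+2) = GSO(2n+2)/𝔾ₘ`-bundle is a `GSO(2n+2)`-bundle up to twist by line bundles.
An isomorphism of the `PSO(2n+2)`-bundles defined by `A` and `A'` is given, up to scalars, by a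
similitude `φ` of the generic fibres which respects the orientations and which is, for some line
bundle `N`, an isomorphism `A.E ≅ N ⊗ A'.E`; the stalk of `N` at `v` is generated by `a⁻¹`. -/
structure IsGIso (A : GSOBundle k K n W) (A' : GSOBundle k K n W') (φ : W ≃ₗ[K] W') : Prop where
  similitude : ∃ c : K, c ≠ 0 ∧ (∀ x y, A'.q (φ x) (φ y) = c * A.q x y) ∧
    ∀ b, A'.η (fun i => φ (b i)) = c ^ (n + 1) * A.η b
  stalk : ∀ v, ∃ a : K, a ≠ 0 ∧ ∀ x, x ∈ A.E.stalk v ↔ a • φ x ∈ A'.E.stalk v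

theorem IsGIso.refl (A : GSOBundle k K n W) : IsGIso A A (LinearEquiv.refl K W) :=
  ⟨⟨1, one_ne_zero, by simp, by simp⟩, fun v => ⟨1, one_ne_zero, by simp⟩⟩

theorem IsGIso.symm {A : GSOBundle k K n W} {A' : GSOBundle k K n W'} {φ : W ≃ₗ[K] W'}
    (h : IsGIso A A' φ) : IsGIso A' A φ.symm := by
  obtain ⟨⟨c, hc, h1, h2⟩, h3⟩ := h
  refine ⟨⟨c⁻¹, inv_ne_zero hc, fun x y => ?_, fun b => ?_⟩, fun v => ?_⟩
  · have := h1 (φ.symm x) (φ.symm y)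
    simp only [LinearEquiv.apply_symm_apply] at this
    rw [this]; field_simp
  · have := h2 (fun i => φ.symm (b i))
    simp only [LinearEquiv.apply_symm_apply] at this
    rw [this, inv_pow, inv_mul_cancel_left₀ (pow_ne_zero _ hc)]
  · obtain ⟨a, ha, h⟩ := h3 v
    refine ⟨a⁻¹, inv_ne_zero ha, fun x => ?_⟩
    rw [h, map_smul, LinearEquiv.apply_symm_apply, smul_inv_smul₀ ha]

theorem IsGIso.trans {A : GSOBundle k K n W} {A' : GSOBundle k K n W'} {A'' : GSOBundle k K n W''}
    {φ : W ≃ₗ[K] W'} {ψ : W' ≃ₗ[K] W''}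
    (h : IsGIso A A' φ) (h' : IsGIso A' A'' ψ) : IsGIso A A'' (φ.trans ψ) := by
  obtain ⟨⟨c, hc, h1, h2⟩, h3⟩ := h
  obtain ⟨⟨d, hd, h1', h2'⟩, h3'⟩ := h'
  refine ⟨⟨d * c, mul_ne_zero hd hc, fun x y => ?_, fun b => ?_⟩, fun v => ?_⟩
  · simp [h1, h1', mul_assoc]
  · simp only [LinearEquiv.trans_apply]
    rw [h2' (fun i => φ (b i)), h2, mul_pow, mul_assoc]
  · obtain ⟨a, ha, h⟩ := h3 v
    obtain ⟨a', ha', h'⟩ := h3' v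
    refine ⟨a' * a, mul_ne_zero ha' ha, fun x => ?_⟩
    rw [h, h', map_smul, smul_smul, LinearEquiv.trans_apply]

/-! ## Borel reductions -/

/-- A reduction of `A` to the Borel subgroup: a full flag `0 = W₀ ⊂ W₁ ⊂ ⋯ ⊂ W_{n+1}` of isotropic
subspaces of the generic fibre (the subbundles of the filtration have the stalks `E_v ∩ W_i`),
whose Lagrangian member `W_{n+1}` belongs to the family singled out by the orientation: `η` takes
the value `1` on every hyperbolic basis whose first half lies in `W_{n+1}`. -/
structure BorelReduction (A : GSOBundle k K n W) where
  flag : Fin (n + 2) → Submodule K W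
  mono : Monotone flag
  finrank_flag : ∀ i, finrank K (flag i) = (i : ℕ)
  isotropic : ∀ x ∈ flag (Fin.last (n + 1)), ∀ y ∈ flag (Fin.last (n + 1)), A.q x y = 0
  oriented : ∀ b : Fin (2 * n + 2) → W,
    (∀ i : Fin (2 * n + 2), (i : ℕ) < n + 1 → b i ∈ flag (Fin.last (n + 1))) →
    (∀ i j, A.q (b i) (b j) = if j = Fin.rev i then 1 else 0) → A.η b = 1

variable [Module.Finite K W]

/-- The stalks of the line bundle `X_{i+1} = E_{i+1} / E_i` of the filtration of `E`
(`i = 0, …, n`); its generic fibre is `W_{i+1} / W_i`. -/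
def BorelReduction.grStalk {A : GSOBundle k K n W} (B : BorelReduction A) (i : Fin (n + 1))
    (v : Place k K) : Submodule v.ring
      (B.flag i.succ ⧸ (B.flag i.castSucc).submoduleOf (B.flag i.succ)) :=
  Submodule.map
    (((B.flag i.castSucc).submoduleOf (B.flag i.succ)).mkQ.restrictScalars v.ring)
    (Submodule.comap ((B.flag i.succ).subtype.restrictScalars v.ring) (A.E.stalk v))

/-- The degree `μ_{i+1}` of the line bundle `X_{i+1}` (`i = 0, …, n`). -/
def BorelReduction.slope {A : GSOBundle k K n W} (B : BorelReduction A) (i : Fin (n + 1)) : ℤ :=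
  degree (B.grStalk i)

/-- The Borel reduction is the canonical reduction: the line bundles attached to the simple roots
have positive degree, i.e. `μ₁ > ⋯ > μ_{n+1}` and `μ_n + μ_{n+1} > deg L` (semistability of the
bundle for the Levi quotient is automatic, that quotient being a torus). -/
def BorelReduction.IsCanonical {A : GSOBundle k K n W} (B : BorelReduction A) : Prop :=
  (∀ i : Fin n, B.slope i.succ < B.slope i.castSucc) ∧
  ∀ i : Fin n, (i : ℕ) + 1 = n →
    degree A.L.stalk < B.slope i.castSucc + B.slope i.succ

/-- The stratum attached to `F`: the bundle has a canonical reduction to the Borel subgroup, with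
`μ_i = μ_{i+1} + f` for `1 ≤ i ≤ n` and `2 μ_{n+1} - d = f`, where `f = deg F`, `d = deg L`. -/
def InStratum (A : GSOBundle k K n W) (F : LineBundle k K) : Prop :=
  ∃ B : BorelReduction A, B.IsCanonical ∧
    (∀ i : Fin n, B.slope i.castSucc = B.slope i.succ + degree F.stalk) ∧
    2 * B.slope (Fin.last n) - degree A.L.stalk = degree F.stalk

/-! ## Sections -/

/-- `s` is a global section of `(E ×^G V) ⊗ F`, where `V` is the space of self-adjoint operators
of trace zero. -/
structure IsSection (A : GSOBundle k K n W) (F : LineBundle k K) (s : W →ₗ[K] W) : Prop where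
  selfAdjoint : ∀ x y, A.q (s x) y = A.q x (s y)
  trace_eq_zero : LinearMap.trace K W s = 0
  stalk : ∀ v, ∀ x ∈ A.E.stalk v, s x ∈ A.E.twistStalk F v

/-- The operator with matrix `T`, self-adjoint for the form with Gram matrix `J` over an
algebraically closed field, is regular: its stabiliser in `PSO(J) = SO(J)/{±1}` is finite
(equivalently, its stabiliser in `SO(J)` is finite). -/
def IsRegularMatrix {ι Ω : Type*} [Fintype ι] [DecidableEq ι] [Field Ω] (J T : Matrix ι ι Ω) :
    Prop :=
  {g : Matrix ι ι Ω | g.transpose * J * g = J ∧ g.det = 1 ∧ g * T = T * g}.Finite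

/-- The value of the section `s` at the closed point `v` lies in the regular locus. In a local
trivialisation `b`, `l`, `a` of `E`, `L`, `F` at `v`, the section is given by a matrix `T` and the
pairing by a Gram matrix `J`; these are reduced to the residue field of `v` and then considered over
an algebraic closure. -/
def IsRegularAt (A : GSOBundle k K n W) (F : LineBundle k K) (s : W →ₗ[K] W) (v : Place k K) :
    Prop :=
  ∃ (b : Basis (Fin (2 * n + 2)) v.ring (A.E.stalk v)) (l a : K)
    (J T : Matrix (Fin (2 * n + 2)) (Fin (2 * n + 2)) v.ring),
    A.L.stalk v = Submodule.span v.ring {l} ∧ F.stalk v = Submodule.span v.ring {a} ∧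
    (∀ i j, A.q (b i : W) (b j : W) = l * (J i j : K)) ∧
    (∀ j, s (b j : W) = ∑ i, (a * (T i j : K)) • (b i : W)) ∧
    IsRegularMatrix
      (J.map (algebraMap v.ring (AlgebraicClosure (IsLocalRing.ResidueField v.ring))))
      (T.map (algebraMap v.ring (AlgebraicClosure (IsLocalRing.ResidueField v.ring))))

/-- `s` is a global section of `(E ×^G V^reg) ⊗ F` whose discriminant (that of its characteristic
polynomial) is generically nonzero. -/
structure IsGoodSection (A : GSOBundle k K n W) (F : LineBundle k K) (s : W →ₗ[K] W) : Prop where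
  isSection : IsSection A F s
  regular : ∀ v, IsRegularAt A F s v
  discr_ne_zero : s.charpoly.discr ≠ 0

end GBundles

/-! ## Invariants and the Kostant section -/

section Kostant

variable {k K : Type u} [Field k] [Field K] [Algebra k K]

/-- The set `𝒜_F(k)` of tuples `(c₂, …, c_{2n+2})` with `c_m ∈ H⁰(C, F^m)`; the entry `c_m` has
index `m - 2`. -/
def Invariants (n : ℕ) (F : LineBundle k K) : Type u :=
  {c : Fin (2 * n + 1) → K // ∀ j : Fin (2 * n + 1), c j ∈ F.sectionsPow (((j : ℕ) : ℤ) + 2)}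

/-- The polynomial `x^(2n+2) + c₂ x^(2n) + ⋯ + c_{2n+1} x + c_{2n+2}`. -/
def invPoly {n : ℕ} (c : Fin (2 * n + 1) → K) : K[X] :=
  X ^ (2 * n + 2) + ∑ j : Fin (2 * n + 1), C (c j) * X ^ (2 * n - (j : ℕ))

/-- The coefficient `c_m`, for `2 ≤ m ≤ 2n+2` (and `0` for other `m`). -/
def coef {n : ℕ} (c : Fin (2 * n + 1) → K) (m : ℕ) : K :=
  if h : 2 ≤ m ∧ m ≤ 2 * n + 2 then c ⟨m - 2, by omega⟩ else 0

/-- The Kostant section `κ₁(c) = A + B`: `A` is the lower nilpotent matrix with ones below the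
diagonal, and the only nonzero entries of `B` are in the upper right block, where the entries on
the antidiagonal are `-c_{2n+2}, -c_{2n}, …, -c₂` and those on the two adjacent parallels are
`-c_{2n+1}/2, -c_{2n-1}/2, …, -c₃/2`. (Row and column indices start from `0`.) -/
def kostant {n : ℕ} (c : Fin (2 * n + 1) → K) :
    Matrix (Fin (2 * n + 2)) (Fin (2 * n + 2)) K :=
  Matrix.of fun i j =>
    if (i : ℕ) = j + 1 then 1
    else if (i : ℕ) ≤ n ∧ n + 1 ≤ (j : ℕ) then
      if (i : ℕ) + j = 2 * n + 1 then - coef c (j - i + 1)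
      else if (i : ℕ) + j = 2 * n ∨ (i : ℕ) + j = 2 * n + 2 then - coef c (j - i + 1) / 2
      else 0
    else 0

/-- The Gram matrix of the split quadratic space `U`: ones on the antidiagonal. -/
def antidiag (K : Type u) [Field K] (m : ℕ) : Matrix (Fin m) (Fin m) K :=
  Matrix.of fun i j => if j = Fin.rev i then 1 else 0

theorem det_antidiag_succ (m : ℕ) :
    (antidiag K (m + 1)).det = (-1) ^ m * (antidiag K m).det := by
  rw [Matrix.det_succ_row_zero, Finset.sum_eq_single (Fin.last m)]
  · have : (antidiag K (m + 1)).submatrix Fin.succ (Fin.last m).succAbove = antidiag K m := by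
      ext i j
      simp only [antidiag, Matrix.submatrix_apply, Matrix.of_apply, Fin.succAbove_last]
      congr 1
      simp only [Fin.ext_iff, Fin.val_rev, Fin.val_succ, Fin.val_castSucc, eq_iff_iff]
      omega
    rw [this]
    simp [antidiag]
  · intro j _ hj
    have : antidiag K (m + 1) 0 j = 0 := by
      simp only [antidiag, Matrix.of_apply, Fin.rev_zero]
      exact if_neg hj
    simp [this]
  · simp

theorem det_antidiag (n : ℕ) : (antidiag K (2 * n + 2)).det = (-1) ^ (n + 1) := by
  induction n with
  | zero => rw [det_antidiag_succ, det_antidiag_succ]; simp [antidiag]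
  | succ n ih =>
    rw [show 2 * (n + 1) + 2 = (2 * n + 2) + 1 + 1 by ring, det_antidiag_succ, det_antidiag_succ,
      ih]
    have h1 : ((-1 : K)) ^ (2 * n + 2) = 1 := Even.neg_one_pow ⟨n + 1, by ring⟩
    rw [pow_succ, h1]; ring

/-- Finitely generated modules over a valuation ring inside its fraction field are principal. -/
theorem exists_generator (O : ValuationSubring K) (S : Submodule O K) (h : S.FG) :
    ∃ a : K, S = Submodule.span O {a} := by
  refine Submodule.fg_induction (motive := fun S _ => ∃ a : K, S = Submodule.span O {a})
    (fun x => ⟨x, rfl⟩) ?_ S h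
  rintro _ _ _ _ ⟨a, rfl⟩ ⟨b, rfl⟩
  have key : ∀ a b : K, b ≠ 0 → a / b ∈ O → Submodule.span O {a} ≤ Submodule.span O {b} := by
    intro a b hb hab
    rw [Submodule.span_singleton_le_iff_mem, Submodule.mem_span_singleton]
    exact ⟨⟨a / b, hab⟩, div_mul_cancel₀ a hb⟩
  by_cases hb : b = 0
  · exact ⟨a, by simp [hb]⟩
  by_cases ha : a = 0
  · exact ⟨b, by simp [ha]⟩
  rcases O.mem_or_inv_mem (a / b) with h | h
  · exact ⟨b, sup_eq_right.2 (key a b hb h)⟩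
  · rw [inv_div] at h
    exact ⟨a, sup_eq_left.2 (key b a ha h)⟩

theorem VecBundle.exists_generator (F : LineBundle k K) (v : Place k K) :
    ∃ a : K, a ≠ 0 ∧ F.stalk v = Submodule.span v.ring {a} := by
  obtain ⟨a, ha⟩ := CurveBundle.exists_generator v.ring (F.stalk v) (F.fg v)
  refine ⟨a, ?_, ha⟩
  rintro rfl
  have := F.span_eq_top v
  rw [ha] at this
  simp at this

theorem mem_span_singleton_iff (O : ValuationSubring K) {a x : K} (ha : a ≠ 0) :
    x ∈ Submodule.span O {a} ↔ x * a⁻¹ ∈ O := by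
  rw [Submodule.mem_span_singleton]
  constructor
  · rintro ⟨r, rfl⟩
    have : (r • a) * a⁻¹ = (r : K) := by
      rw [show r • a = (r : K) * a from rfl, mul_inv_cancel_right₀ ha]
    rw [this]; exact r.2
  · intro h
    exact ⟨⟨_, h⟩, inv_mul_cancel_right₀ ha x⟩

theorem powStalk_eq (F : LineBundle k K) (m : ℤ) (v : Place k K) {a : K} (ha : a ≠ 0)
    (h : F.stalk v = Submodule.span v.ring {a}) :
    F.powStalk m v = Submodule.span v.ring {a ^ m} := by
  refine le_antisymm (Submodule.span_le.2 ?_) (Submodule.span_mono ?_)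
  · rintro _ ⟨b, hb, rfl⟩
    have hb0 : b ≠ 0 := by
      rintro rfl
      have : a ∈ Submodule.span v.ring {(0 : K)} := by
        rw [← hb, h]; exact Submodule.mem_span_singleton_self a
      simp at this
      exact ha this
    have h1 : b * a⁻¹ ∈ v.ring := by
      rw [← mem_span_singleton_iff v.ring ha, ← h, hb]
      exact Submodule.mem_span_singleton_self b
    have h2 : a * b⁻¹ ∈ v.ring := by
      rw [← mem_span_singleton_iff v.ring hb0, ← hb, h]
      exact Submodule.mem_span_singleton_self a
    rw [SetLike.mem_coe, mem_span_singleton_iff v.ring (zpow_ne_zero m ha), ← inv_zpow, ← mul_zpow]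
    obtain ⟨r, rfl | rfl⟩ := m.eq_nat_or_neg
    · rw [zpow_natCast]; exact pow_mem h1 r
    · rw [zpow_neg, ← inv_zpow, mul_inv, inv_inv, mul_comm, zpow_natCast]
      exact pow_mem h2 r
  · rintro _ rfl
    exact ⟨a, h, rfl⟩

theorem mem_powStalk_iff (F : LineBundle k K) (m : ℤ) (v : Place k K) {a x : K} (ha : a ≠ 0)
    (h : F.stalk v = Submodule.span v.ring {a}) :
    x ∈ F.powStalk m v ↔ x * (a ^ m)⁻¹ ∈ v.ring := by
  rw [powStalk_eq F m v ha h, mem_span_singleton_iff v.ring (zpow_ne_zero m ha)]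

theorem exists_coherent_generator (F : LineBundle k K) :
    ∃ a : K, a ≠ 0 ∧ {v | F.stalk v ≠ Submodule.span v.ring {a}}.Finite := by
  obtain ⟨r, b, hb⟩ := F.coherent
  obtain rfl : r = 1 := by
    have := finrank_eq_card_basis b
    simpa using this.symm
  have : Set.range b = {b 0} := by
    ext x
    simp only [Set.mem_range, Set.mem_singleton_iff]
    constructor
    · rintro ⟨i, rfl⟩; rw [Subsingleton.elim i 0]
    · rintro rfl; exact ⟨0, rfl⟩
  rw [this] at hb
  exact ⟨b 0, b.ne_zero 0, hb⟩

theorem mem_pi_span_iff {m : ℕ} (O : ValuationSubring K) (g : Fin m → K) (hg : ∀ i, g i ≠ 0)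
    (x : Fin m → K) :
    x ∈ Submodule.span O (Set.range fun i => Pi.single (M := fun _ => K) i (g i)) ↔
      ∀ i, x i * (g i)⁻¹ ∈ O := by
  constructor
  · intro h
    induction h using Submodule.span_induction with
    | mem y hy =>
      obtain ⟨j, rfl⟩ := hy
      intro i
      by_cases hij : i = j
      · subst hij
        simp [hg, O.one_mem]
      · simp [Pi.single_eq_of_ne hij, O.zero_mem]
    | zero => intro i; simp [O.zero_mem]
    | add y z _ _ hy hz =>
      intro i
      rw [Pi.add_apply, add_mul]
      exact O.add_mem _ _ (hy i) (hz i)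
    | smul r y _ hy =>
      intro i
      have : (r • y) i * (g i)⁻¹ = (r : K) * (y i * (g i)⁻¹) := by
        rw [← mul_assoc]; rfl
      rw [this]
      exact O.mul_mem _ _ r.2 (hy i)
  · intro h
    have : x = ∑ i, (⟨x i * (g i)⁻¹, h i⟩ : O) • Pi.single (M := fun _ => K) i (g i) := by
      ext j
      rw [Finset.sum_apply, Finset.sum_eq_single j]
      · change x j = (x j * (g j)⁻¹) * (Pi.single (M := fun _ => K) j (g j) j)
        rw [Pi.single_eq_same, inv_mul_cancel_right₀ (hg j)]
      · intro i _ hij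
        change (x i * (g i)⁻¹) * (Pi.single (M := fun _ => K) i (g i) j) = 0
        rw [Pi.single_eq_of_ne hij.symm, mul_zero]
      · simp
    rw [this]
    exact Submodule.sum_mem _ fun i _ => Submodule.smul_mem _ _
      (Submodule.subset_span ⟨i, rfl⟩)

/-- The line bundle `F^m`. -/
def linePow (F : LineBundle k K) (m : ℤ) : LineBundle k K where
  stalk := F.powStalk m
  fg v := by
    obtain ⟨a, ha, h⟩ := F.exists_generator v
    rw [powStalk_eq F m v ha h]
    exact Submodule.fg_span_singleton _
  span_eq_top v := by
    obtain ⟨a, ha, h⟩ := F.exists_generator v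
    rw [powStalk_eq F m v ha h, eq_top_iff, ← (Ideal.span_singleton_eq_top
      (α := K)).2 (isUnit_iff_ne_zero.2 (zpow_ne_zero m ha))]
    exact Submodule.span_mono Submodule.subset_span
  coherent := by
    obtain ⟨a, ha, h⟩ := exists_coherent_generator F
    refine ⟨1, (Basis.singleton (Fin 1) K).isUnitSMul
      (fun _ => isUnit_iff_ne_zero.2 (zpow_ne_zero m ha)), h.subset fun v hv h' => hv ?_⟩
    rw [powStalk_eq F m v ha h']
    congr 1
    ext x
    simp [Basis.isUnitSMul_apply, eq_comm]

/-- The vector bundle `F^n ⊕ F^(n-1) ⊕ ⋯ ⊕ F^(-n-1)` of rank `2n+2`. -/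
def kostantVec (n : ℕ) (F : LineBundle k K) : VecBundle k K (Fin (2 * n + 2) → K) where
  stalk v :=
    { carrier := {x | ∀ i : Fin (2 * n + 2), x i ∈ F.powStalk ((n : ℤ) - (i : ℕ)) v}
      add_mem' := fun hx hy i => Submodule.add_mem _ (hx i) (hy i)
      zero_mem' := fun i => Submodule.zero_mem _
      smul_mem' := fun r x hx i => Submodule.smul_mem _ r (hx i) }
  fg v := by
    obtain ⟨a, ha, h⟩ := F.exists_generator v
    refine (Submodule.fg_def.2 ⟨_, Set.finite_range
      (fun i : Fin (2 * n + 2) => Pi.single (M := fun _ => K) i (a ^ ((n : ℤ) - (i : ℕ)))), ?_⟩)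
    ext x
    rw [mem_pi_span_iff v.ring _ (fun i => zpow_ne_zero _ ha)]
    exact forall_congr' fun i => (mem_powStalk_iff F _ v ha h).symm
  span_eq_top v := by
    obtain ⟨a, ha, h⟩ := F.exists_generator v
    rw [eq_top_iff, ← (Pi.basisFun K (Fin (2 * n + 2))).span_eq, Submodule.span_le]
    rintro _ ⟨i, rfl⟩
    have : Pi.basisFun K (Fin (2 * n + 2)) i = (a ^ ((n : ℤ) - (i : ℕ)))⁻¹ •
        Pi.single (M := fun _ => K) i (a ^ ((n : ℤ) - (i : ℕ))) := by
      rw [← Pi.single_smul, Pi.basisFun_apply, smul_eq_mul, inv_mul_cancel₀ (zpow_ne_zero _ ha)]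
    rw [this]
    refine Submodule.smul_mem _ _ (Submodule.subset_span fun j => ?_)
    rw [mem_powStalk_iff F _ v ha h]
    by_cases hij : j = i
    · subst hij
      rw [Pi.single_eq_same, mul_inv_cancel₀ (zpow_ne_zero _ ha)]
      exact v.ring.one_mem
    · rw [Pi.single_eq_of_ne hij, zero_mul]
      exact v.ring.zero_mem
  coherent := by
    obtain ⟨a, ha, h⟩ := exists_coherent_generator F
    refine ⟨2 * n + 2, (Pi.basisFun K (Fin (2 * n + 2))).isUnitSMul
      (fun i => isUnit_iff_ne_zero.2 (zpow_ne_zero ((n : ℤ) - (i : ℕ)) ha)),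
      h.subset fun v hv h' => hv ?_⟩
    have : ((Pi.basisFun K (Fin (2 * n + 2))).isUnitSMul
        (fun i => isUnit_iff_ne_zero.2 (zpow_ne_zero ((n : ℤ) - (i : ℕ)) ha)) :
          Fin (2 * n + 2) → Fin (2 * n + 2) → K)
        = fun i : Fin (2 * n + 2) => Pi.single (M := fun _ => K) i (a ^ ((n : ℤ) - (i : ℕ))) := by
      funext i
      rw [Basis.isUnitSMul_apply, Pi.basisFun_apply, ← Pi.single_smul, smul_eq_mul, mul_one]
    rw [this]
    ext x
    rw [mem_pi_span_iff v.ring _ (fun i => zpow_ne_zero _ ha)]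
    exact forall_congr' fun i => mem_powStalk_iff F _ v ha h'

theorem antidiag_apply {m : ℕ} (x y : Fin m → K) :
    Matrix.toBilin' (antidiag K m) x y = ∑ i, x i * y (Fin.rev i) := by
  rw [Matrix.toBilin'_apply]
  simp [antidiag]

/-- The `GSO(2n+2)`-bundle `F^n ⊕ ⋯ ⊕ F^(-n-1)` with the standard split form, which has values in
`F^(-1)`, and the standard orientation. It is the bundle obtained from `F` through the cocharacter
of `PSO(2n+2)` for which `κ₁` is equivariant, i.e. the bundle that carries the sections `κ₁(c)`. -/
def kostantBundle (n : ℕ) (F : LineBundle k K) : GSOBundle k K n (Fin (2 * n + 2) → K) where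
  E := kostantVec n F
  finrank_eq := by simp
  L := linePow F (-1)
  q := Matrix.toBilin' (antidiag K (2 * n + 2))
  symm x y := by
    rw [antidiag_apply, antidiag_apply, ← Equiv.sum_comp Fin.revPerm]
    exact Finset.sum_congr rfl fun i _ => by simp [mul_comm]
  perfect v y := by
    obtain ⟨a, ha, h⟩ := F.exists_generator v
    have hE : ∀ x, x ∈ (kostantVec n F).stalk v ↔
        ∀ i : Fin (2 * n + 2), x i * (a ^ ((n : ℤ) - (i : ℕ)))⁻¹ ∈ v.ring := fun x =>
      forall_congr' fun i => mem_powStalk_iff F _ v ha h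
    have hL : ∀ x, x ∈ (linePow F (-1)).stalk v ↔ x * (a ^ (-1 : ℤ))⁻¹ ∈ v.ring := fun x =>
      mem_powStalk_iff F _ v ha h
    have hexp : ∀ i : Fin (2 * n + 2), (a ^ ((n : ℤ) - (i : ℕ)))⁻¹ *
        (a ^ ((n : ℤ) - (Fin.rev i : ℕ)))⁻¹ = (a ^ (-1 : ℤ))⁻¹ := by
      intro i
      rw [← mul_inv, ← zpow_add₀ ha]
      congr 2
      rw [Fin.val_rev]
      have := i.2
      omega
    constructor
    · intro hy x hx
      rw [hL, antidiag_apply, Finset.sum_mul]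
      refine sum_mem fun i _ => ?_
      rw [← hexp i, mul_mul_mul_comm]
      exact v.ring.mul_mem _ _ ((hE x).1 hx i) ((hE y).1 hy (Fin.rev i))
    · intro hy
      rw [hE]
      intro i
      have hx : Pi.single (M := fun _ => K) (Fin.rev i) (a ^ ((n : ℤ) - (Fin.rev i : ℕ)))
          ∈ (kostantVec n F).stalk v := by
        rw [hE]
        intro j
        by_cases hij : j = Fin.rev i
        · subst hij
          rw [Pi.single_eq_same, mul_inv_cancel₀ (zpow_ne_zero _ ha)]
          exact v.ring.one_mem
        · rw [Pi.single_eq_of_ne hij, zero_mul]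
          exact v.ring.zero_mem
      have := hy _ hx
      rw [hL, antidiag_apply, Finset.sum_eq_single (Fin.rev i), Pi.single_eq_same, Fin.rev_rev,
        ← hexp i] at this
      · have e : a ^ ((n : ℤ) - (Fin.rev i : ℕ)) * y i * ((a ^ ((n : ℤ) - (i : ℕ)))⁻¹ *
            (a ^ ((n : ℤ) - (Fin.rev i : ℕ)))⁻¹) = y i * (a ^ ((n : ℤ) - (i : ℕ)))⁻¹ := by
          have := zpow_ne_zero ((n : ℤ) - (Fin.rev i : ℕ)) ha
          field_simp
        rwa [e] at this
      · intro j _ hj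
        rw [Pi.single_eq_of_ne hj, zero_mul]
      · simp
  η := Matrix.detRowAlternating
  η_sq b := by
    have : (Matrix.of fun i j => Matrix.toBilin' (antidiag K (2 * n + 2)) (b i) (b j))
        = Matrix.of b * antidiag K (2 * n + 2) * (Matrix.of b).transpose := by
      ext i j
      rw [Matrix.of_apply, Matrix.toBilin'_apply', Matrix.mul_assoc, Matrix.mul_apply]
      rfl
    rw [this, Matrix.det_mul, Matrix.det_mul, Matrix.det_transpose, det_antidiag]
    have h1 : ((-1 : K) ^ (n + 1)) * (-1) ^ (n + 1) = 1 := by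
      rw [← mul_pow]; simp
    change (Matrix.of b).det ^ 2 = _
    linear_combination (-(Matrix.of b).det ^ 2) * h1

end Kostant

/-! ## The contribution of the stratum to the average -/

section Counting

variable {k K : Type u} [Field k] [Field K] [Algebra k K]

/-- The pairs `(E, s)` with `E` a `PSO(2n+2)`-bundle in the stratum of `F` and `s` a section of
`(E ×^G V^reg) ⊗ F` with generically nonzero discriminant. (Up to isomorphism, the generic fibre is
`K^(2n+2)`.) -/
structure StratumPair (n : ℕ) (F : LineBundle k K) where
  A : GSOBundle k K n (Fin (2 * n + 2) → K)
  s : (Fin (2 * n + 2) → K) →ₗ[K] (Fin (2 * n + 2) → K)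
  inStratum : InStratum A F
  good : IsGoodSection A F s

/-- Isomorphism of pairs. -/
instance StratumPair.setoid (n : ℕ) (F : LineBundle k K) : Setoid (StratumPair n F) where
  r P P' := ∃ φ : (Fin (2 * n + 2) → K) ≃ₗ[K] (Fin (2 * n + 2) → K),
    IsGIso P.A P'.A φ ∧ ∀ x, φ (P.s x) = P'.s (φ x)
  iseqv :=
    { refl := fun P => ⟨_, IsGIso.refl P.A, fun _ => rfl⟩
      symm := by
        rintro P P' ⟨φ, h, hs⟩
        refine ⟨φ.symm, h.symm, fun x => ?_⟩
        rw [LinearEquiv.symm_apply_eq, hs, LinearEquiv.apply_symm_apply]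
      trans := by
        rintro P P' P'' ⟨φ, h, hs⟩ ⟨ψ, h', hs'⟩
        refine ⟨φ.trans ψ, h.trans h', fun x => ?_⟩
        simp only [LinearEquiv.trans_apply]
        rw [hs, hs'] }

/-- The isomorphism classes of the pairs `(E, s)` in the stratum of `F`. -/
def StratumClasses (n : ℕ) (F : LineBundle k K) : Type u :=
  Quotient (StratumPair.setoid n F)

end Counting

end CurveBundle

end

open CurveBundle

/-! Write f = deg F, d = deg L, and let w span the generic fibre of the first line E_1 of the
canonical flag. The slopes of the stratum give f > 0 and μ_1 + μ_{j+1} = d + (2n+1-j) f. If the form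
y ↦ (s^i w, y) vanishes on E_j but not on E_{j+1}, it is a nonzero map X_1 ⊗ X_{j+1} → L ⊗ F^i, so
that i ≥ 2n+1-j. Hence s^i w is orthogonal to E_{j+1} whenever i + j ≤ 2n
(`StratumData.pairing_eq_zero`). In particular (s^i w, w) = 0 for i ≤ 2n, and w, s w, ..., s^n w lie
in the Lagrangian E_{n+1}. The value l = (s^(2n+1) w, w) is not zero: otherwise the cyclic space of
w would be isotropic, which a separable characteristic polynomial forbids (`eq_zero_of_isotropic`).
Since 2 μ_1 = d + (2n+1) f, l is a nonzero section of a line bundle of degree 0 and has no zeros.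

On the other side, e_0 is a cyclic vector of κ₁(c), and e_j = P_j(κ₁(c)) e_0 for explicit
polynomials P_j, with P_{2n+2} the characteristic polynomial. Sending e_j to P_j(s) w therefore
intertwines κ₁(c) with s. A form for which a cyclic operator T is self-adjoint is determined by the
values (T^i e_0, e_0), so this map is a similitude of factor l (`eq_antidiag_of_selfAdjoint`). It
respects the orientation because the first half of the basis lands in E_{n+1}. It respects the
stalks, up to a twist, because P_j(s) w has degree j in F and both lattices are self-dual
(`StratumData.mem_stalk_iff`).

An automorphism that commutes with κ₁(c) sends e_0 to a multiple of itself, the other coordinates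
being sections of negative degree, and is then scalar by cyclicity. The characteristic polynomial
recovers c, and κ₁(c) is regular, so the isomorphism classes correspond to the c with nonzero
discriminant. For the limit, c_{2n+2} is translated by h ∈ H⁰(F^(2n+2)): at most 2n+1 values of h
make a given polynomial inseparable, while the number of h tends to infinity by Riemann's
inequality.

The degrees rest on the product formula and on Riemann's inequality for function fields. Both are
derived here from one fact: elements independent over k modulo x M are independent over k(x)
(`linearIndependent_adjoin`). -/

noncomputable section

namespace CurveBundle

/-! ### Closed points: their local rings are discrete valuation rings; orders. -/

section Places

variable {k K : Type u} [Field k] [Field K] [Algebra k K]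

-- The transcendence degree of K is at most one, so x alone is a transcendence basis and K is
-- algebraic over k(x). K is also essentially of finite type over k, hence over k(x), and the two
-- together give finiteness.
open IntermediateField in
theorem IsCurveFunctionField.finiteDimensional_adjoin (hC : IsCurveFunctionField k K) {x : K}
    (hx : Transcendental k x) : FiniteDimensional k⟮x⟯ K := by
  obtain ⟨t, ht, hfin⟩ := hC.finite_over_rational
  have h1 : Algebra.EssFiniteType k k⟮t⟯ :=
    IntermediateField.essFiniteType_iff.2 ⟨{t}, by simp⟩
  have h2 : Algebra.EssFiniteType k K := Algebra.EssFiniteType.comp k k⟮t⟯ K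
  have h3 : Algebra.EssFiniteType k⟮x⟯ K := Algebra.EssFiniteType.of_comp k _ _
  have ht' : Algebra.IsAlgebraic (Algebra.adjoin k {t}) K := isAlgebraic_adjoin_iff_top.1
    (inferInstanceAs (Algebra.IsAlgebraic k⟮t⟯ K))
  have hx' : IsTranscendenceBasis k (fun _ : Unit => x) := by
    refine (algebraicIndependent_unique_type_iff.2 hx).isTranscendenceBasis_of_lift_trdeg_le_of_finite ?_
    refine le_trans (Cardinal.lift_le.2 (Algebra.IsAlgebraic.trdeg_le_cardinalMk k {t})) ?_
    simp
  have h4 : Algebra.IsAlgebraic k⟮x⟯ K := by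
    have := (isTranscendenceBasis_iff_algebraicIndependent_isAlgebraic.1 hx').2
    rw [Set.range_const] at this
    exact isAlgebraic_adjoin_iff_top.2 this
  exact Algebra.finite_of_essFiniteType_of_isAlgebraic

theorem IsCurveFunctionField.transcendental (hC : IsCurveFunctionField k K) {x : K}
    (hx : ∀ a : k, algebraMap k K a ≠ x) : Transcendental k x := fun h => by
  obtain ⟨a, ha⟩ := hC.algebraically_closed x h
  exact hx a ha

open scoped IntermediateField.algebraAdjoinAdjoin in
/-- Elements of a `k[x]`-stable subspace `M` of `K` which are linearly independent over `k` modulo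
`x M` are linearly independent over `k(x)`. -/
theorem linearIndependent_adjoin {x : K} (hx : Transcendental k x) (M : Submodule k K)
    (hM : ∀ m ∈ M, x * m ∈ M) {ι : Type*} [Fintype ι] (b : ι → K) (hb : ∀ i, b i ∈ M)
    (hind : ∀ c : ι → k, (∃ m ∈ M, ∑ i, c i • b i = x * m) → c = 0) :
    LinearIndependent (IntermediateField.adjoin k {x}) b := by
  have hx0 : x ≠ 0 := by
    rintro rfl
    exact hx isAlgebraic_zero
  have hpM : ∀ p : k[X], ∀ m ∈ M, aeval x p * m ∈ M := by
    intro p m hm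
    induction p using Polynomial.induction_on' with
    | add p q hp hq => rw [map_add, add_mul]; exact M.add_mem hp hq
    | monomial j a =>
      rw [aeval_monomial, mul_assoc, ← Algebra.smul_def]
      refine M.smul_mem _ ?_
      induction j with
      | zero => simpa using hm
      | succ j ih => rw [pow_succ', mul_assoc]; exact hM _ ih
  -- Descent on the degree of a relation over k[x]: modulo x M only the constant terms survive, so
  -- they vanish by `hind`, and the relation can be divided by x.
  have key : ∀ (d : ℕ) (p : ι → k[X]), (∀ i, (p i).degree < d) →
      ∑ i, aeval x (p i) * b i = 0 → ∀ i, p i = 0 := by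
    intro d
    induction d with
    | zero => intro p hp _ i; simpa using hp i
    | succ d ih =>
      intro p hp hsum
      have hdiv : ∀ i, aeval x (p i) * b i = x * (aeval x (p i).divX * b i) + (p i).coeff 0 • b i := by
        intro i
        conv_lhs => rw [← (p i).divX_mul_X_add]
        rw [map_add, map_mul, aeval_X, aeval_C, Algebra.smul_def]
        ring
      have h0 : (fun i => (p i).coeff 0) = 0 := by
        refine hind _ ⟨-∑ i, aeval x (p i).divX * b i,
          M.neg_mem (M.sum_mem fun i _ => hpM _ _ (hb i)), ?_⟩
        simp only [hdiv, Finset.sum_add_distrib, ← Finset.mul_sum] at hsum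
        linear_combination hsum
      have h0' : ∀ i, (p i).coeff 0 = 0 := fun i => congrFun h0 i
      have h1 : ∑ i, aeval x (p i).divX * b i = 0 := by
        simp only [hdiv, h0', zero_smul, add_zero, ← Finset.mul_sum] at hsum
        exact (mul_eq_zero.1 hsum).resolve_left hx0
      have h2 := ih (fun i => (p i).divX) (fun i => ?_) h1
      · intro i
        rw [← (p i).divX_mul_X_add, h2 i, h0' i]; simp
      · by_cases hpi : p i = 0
        · simp only [hpi, divX_zero, degree_zero]; exact WithBot.bot_lt_coe d
        · have h3 := degree_divX_lt hpi
          have h4 := hp i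
          by_cases h5 : (p i).divX = 0
          · rw [h5, degree_zero]; exact WithBot.bot_lt_coe d
          · rw [degree_eq_natDegree h5, degree_eq_natDegree hpi] at h3
            rw [degree_eq_natDegree hpi] at h4
            rw [degree_eq_natDegree h5]
            norm_cast at h3 h4 ⊢
            omega
  rw [← LinearIndependent.iff_fractionRing (R := Algebra.adjoin k {x}), Fintype.linearIndependent_iff]
  intro g hg
  have hrange : ∀ y ∈ Algebra.adjoin k {x}, ∃ p : k[X], aeval x p = y := fun y hy => by
    rwa [Algebra.adjoin_singleton_eq_range_aeval] at hy
  choose p hp using fun i => hrange _ (g i).2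
  obtain ⟨d, hd⟩ : ∃ d : ℕ, ∀ i, (p i).degree < d := by
    refine ⟨(Finset.univ.sup fun i => (p i).natDegree) + 1, fun i => ?_⟩
    refine lt_of_le_of_lt degree_le_natDegree ?_
    exact_mod_cast Nat.lt_succ_of_le (Finset.le_sup (f := fun i => (p i).natDegree) (Finset.mem_univ i))
  have h := key d p hd (by simpa [hp, Algebra.smul_def] using hg)
  intro i
  ext
  rw [← hp, h i]; simp

theorem Place.transcendental (hC : IsCurveFunctionField k K) (v : Place k K) {x : K}
    (h : x⁻¹ ∉ v.ring) : Transcendental k x := hC.transcendental fun a ha => by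
  rw [← ha, ← map_inv₀] at h
  exact h (v.const_mem _)

instance (v : Place k K) : IsScalarTower k v.ring K := IsScalarTower.of_algebraMap_eq fun _ => rfl

/-- As x⁻¹ is not in the local ring, x is not constant. Lifts of vectors independent modulo x are
then independent over k(x), so the dimension is at most [K : k(x)]. -/
theorem Place.finite_quotient (hC : IsCurveFunctionField k K) (v : Place k K) {x : v.ring}
    (h0 : x ≠ 0) (h : ¬ IsUnit x) : Module.Finite k (v.ring ⧸ Ideal.span {x}) := by
  have hx0 : (x : K) ≠ 0 := by simpa using h0
  have hinv : (x : K)⁻¹ ∉ v.ring := fun h' => h (IsUnit.of_mul_eq_one ⟨_, h'⟩ (by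
    ext; exact mul_inv_cancel₀ hx0))
  have htr := v.transcendental hC hinv
  have := hC.finiteDimensional_adjoin htr
  refine Module.rank_lt_aleph0_iff.1 (lt_of_le_of_lt (rank_le (n := finrank
    (IntermediateField.adjoin k {(x : K)}) K) ?_) Cardinal.natCast_lt_aleph0)
  intro s hs
  have hsurj := Ideal.Quotient.mk_surjective (I := Ideal.span {x})
  choose lift hlift using hsurj
  have := linearIndependent_adjoin htr (LinearMap.range (IsScalarTower.toAlgHom k v.ring K).toLinearMap)
    (by rintro _ ⟨m, rfl⟩; exact ⟨x * m, rfl⟩) (fun i : s => (lift i : K)) (fun i => ⟨lift i, rfl⟩) ?_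
  · simpa using this.fintype_card_le_finrank
  · rintro c ⟨_, ⟨m, rfl⟩, hm⟩
    rw [Fintype.linearIndependent_iff] at hs
    funext i
    refine hs c ?_ i
    have h1 : ∑ i : s, c i • lift i = x * m := by
      ext
      have : ((∑ i : s, c i • lift i : v.ring) : K) = ∑ i : s, c i • (lift i : K) := by
        change IsScalarTower.toAlgHom k v.ring K _ = _
        rw [map_sum]
        simp only [map_smul]
        rfl
      rw [this, hm]; rfl
    have h2 := congrArg (Ideal.Quotient.mkₐ k (Ideal.span {x})) h1
    rw [map_sum] at h2
    simp only [map_smul, Ideal.Quotient.mkₐ_eq_mk, hlift] at h2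
    rw [h2, Ideal.Quotient.eq_zero_iff_mem]
    exact Ideal.mul_mem_right _ _ (Ideal.mem_span_singleton_self x)

theorem Place.exists_nonunit (v : Place k K) : ∃ x : v.ring, x ≠ 0 ∧ ¬ IsUnit x := by
  by_contra! h
  refine v.ne_top (eq_top_iff.2 fun x _ => ?_)
  rcases v.ring.mem_or_inv_mem x with hx | hx
  · exact hx
  · by_cases h0 : x = 0
    · rw [h0]; exact v.ring.zero_mem
    · obtain ⟨y, hy⟩ := (h ⟨x⁻¹, hx⟩ (by simpa [Subtype.ext_iff] using h0)).exists_right_inv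
      have : x⁻¹ * (y : K) = 1 := congrArg Subtype.val hy
      rw [inv_mul_eq_one₀ h0] at this
      rw [this]; exact y.2

/-- A nonzero ideal contains a principal ideal modulo which the ring is finite over k, so it is
finitely generated. A valuation ring is Bézout, so noetherian implies principal. -/
theorem Place.isDiscreteValuationRing (hC : IsCurveFunctionField k K) (v : Place k K) :
    IsDiscreteValuationRing v.ring := by
  obtain ⟨x, h0, hx⟩ := v.exists_nonunit
  have hnoeth : IsNoetherianRing v.ring := by
    refine ⟨fun I => ?_⟩
    by_cases hI : I = ⊥
    · rw [hI]; exact Submodule.fg_bot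
    obtain ⟨y, hyI, hy⟩ := Submodule.exists_mem_ne_zero_of_ne_bot hI
    -- The element y may be a unit; y x is not, as `finite_quotient` requires.
    have hyx : y * x ≠ 0 := mul_ne_zero hy h0
    have := v.finite_quotient hC hyx (fun h => hx (isUnit_of_mul_isUnit_right h))
    have h1 : IsNoetherian k (v.ring ⧸ Ideal.span {y * x}) := inferInstance
    have h2 : IsNoetherian v.ring (v.ring ⧸ Ideal.span {y * x}) := isNoetherian_of_tower k h1
    refine Submodule.fg_of_fg_map_of_fg_inf_ker (Submodule.mkQ (Ideal.span {y * x})) (h2.noetherian _) ?_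
    rw [Submodule.ker_mkQ, inf_eq_right.2]
    · exact Submodule.fg_span_singleton _
    · rw [Ideal.span_singleton_le_iff_mem]
      exact Ideal.mul_mem_right _ _ hyI
  have : IsPrincipalIdealRing v.ring := (IsBezout.TFAE (R := v.ring)).out 0 1 |>.1 hnoeth
  exact { not_a_field' := fun h => hx (by
            by_contra hu
            have : x ∈ IsLocalRing.maximalIdeal v.ring := hu
            rw [h] at this
            exact h0 this) }

theorem Place.finite_residueField (hC : IsCurveFunctionField k K) (v : Place k K) :
    Module.Finite k (IsLocalRing.ResidueField v.ring) := by
  obtain ⟨x, h0, hx⟩ := v.exists_nonunit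
  have := v.finite_quotient hC h0 hx
  have hle : Ideal.span {x} ≤ IsLocalRing.maximalIdeal v.ring := by
    rw [Ideal.span_singleton_le_iff_mem]; exact hx
  exact Module.Finite.of_surjective (Ideal.Quotient.factorₐ k hle).toLinearMap
    (Ideal.Quotient.factor_surjective hle)

theorem Place.unit_mul_mem_iff (v : Place k K) (a : v.ringˣ) (y : K) :
    ((a : v.ring) : K) * y ∈ v.ring ↔ y ∈ v.ring := by
  refine ⟨fun h => ?_, fun h => v.ring.mul_mem _ _ (a : v.ring).2 h⟩
  have h1 : (((a⁻¹ : v.ringˣ) : v.ring) : K) * ((a : v.ring) : K) = 1 :=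
    congrArg Subtype.val a.inv_mul
  have := v.ring.mul_mem _ _ ((a⁻¹ : v.ringˣ) : v.ring).2 h
  rwa [← mul_assoc, h1, one_mul] at this

variable [hC : Fact (IsCurveFunctionField k K)]

instance (v : Place k K) : IsDiscreteValuationRing v.ring := v.isDiscreteValuationRing hC.out

instance (v : Place k K) : Module.Finite k (IsLocalRing.ResidueField v.ring) :=
  v.finite_residueField hC.out

theorem Place.degree_pos (v : Place k K) : 0 < v.degree := finrank_pos

/-- A uniformizer at `v`. -/
def Place.unif (v : Place k K) : v.ring := (IsDiscreteValuationRing.exists_irreducible v.ring).choose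

theorem Place.irreducible_unif (v : Place k K) : Irreducible v.unif :=
  (IsDiscreteValuationRing.exists_irreducible v.ring).choose_spec

theorem Place.unif_ne_zero (v : Place k K) : (v.unif : K) ≠ 0 := by
  simpa using v.irreducible_unif.ne_zero

theorem Place.exists_ord (v : Place k K) (x : Kˣ) :
    ∃ (m : ℤ) (a : v.ringˣ), (x : K) = a * (v.unif : K) ^ m := by
  obtain ⟨m, a, h⟩ := IsDiscreteValuationRing.exists_units_eq_smul_zpow_of_irreducible (K := K)
    v.irreducible_unif x.ne_zero
  exact ⟨m, a, h⟩

/-- The order at `v` of a nonzero function. -/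
def Place.ord (v : Place k K) (x : Kˣ) : ℤ := (v.exists_ord x).choose

theorem Place.ord_spec (v : Place k K) (x : Kˣ) :
    ∃ a : v.ringˣ, (x : K) = a * (v.unif : K) ^ v.ord x := (v.exists_ord x).choose_spec

theorem Place.unif_zpow_mem_iff (v : Place k K) (m : ℤ) : (v.unif : K) ^ m ∈ v.ring ↔ 0 ≤ m := by
  refine ⟨fun h => ?_, fun h => ?_⟩
  · by_contra! hm
    obtain ⟨j, rfl⟩ : ∃ j : ℕ, m = -(j + 1 : ℕ) := ⟨(-m - 1).toNat, by omega⟩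
    have h1 : (v.unif : K)⁻¹ = (v.unif : K) ^ j * (v.unif : K) ^ (-(j + 1 : ℕ) : ℤ) := by
      have := v.unif_ne_zero
      rw [zpow_neg, zpow_natCast, pow_succ]
      field_simp
    have h2 : (v.unif : K)⁻¹ ∈ v.ring := by
      rw [h1]; exact v.ring.mul_mem _ _ (pow_mem v.unif.2 j) h
    exact v.irreducible_unif.not_isUnit (IsUnit.of_mul_eq_one ⟨_, h2⟩ (by
      ext; exact mul_inv_cancel₀ v.unif_ne_zero))
  · lift m to ℕ using h
    rw [zpow_natCast]
    exact pow_mem v.unif.2 m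

theorem Place.mem_iff (v : Place k K) (x : Kˣ) : (x : K) ∈ v.ring ↔ 0 ≤ v.ord x := by
  obtain ⟨a, ha⟩ := v.ord_spec x
  rw [ha, v.unit_mul_mem_iff, v.unif_zpow_mem_iff]

theorem Place.ord_eq (v : Place k K) (x : Kˣ) (a : v.ringˣ) (m : ℤ)
    (h : (x : K) = a * (v.unif : K) ^ m) : v.ord x = m := by
  have key : ∀ j : ℤ, (x : K) * (v.unif : K) ^ j ∈ v.ring ↔ 0 ≤ m + j := fun j => by
    rw [h, mul_assoc, ← zpow_add₀ v.unif_ne_zero, v.unit_mul_mem_iff, v.unif_zpow_mem_iff]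
  obtain ⟨b, hb⟩ := v.ord_spec x
  have key' : ∀ j : ℤ, (x : K) * (v.unif : K) ^ j ∈ v.ring ↔ 0 ≤ v.ord x + j := fun j => by
    conv_lhs => rw [hb]
    rw [mul_assoc, ← zpow_add₀ v.unif_ne_zero, v.unit_mul_mem_iff, v.unif_zpow_mem_iff]
  have h1 := (key (-v.ord x)).1 ((key' _).2 (by omega))
  have h2 := (key' (-m)).1 ((key _).2 (by omega))
  omega

theorem Place.ord_mul (v : Place k K) (x y : Kˣ) : v.ord (x * y) = v.ord x + v.ord y := by
  obtain ⟨a, ha⟩ := v.ord_spec x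
  obtain ⟨b, hb⟩ := v.ord_spec y
  refine v.ord_eq _ (a * b) _ ?_
  rw [Units.val_mul, ha, hb, zpow_add₀ v.unif_ne_zero]
  push_cast
  ring

/-- The order at `v` as a homomorphism. -/
def Place.ordHom (v : Place k K) : Kˣ →* Multiplicative ℤ where
  toFun x := Multiplicative.ofAdd (v.ord x)
  map_one' := by
    have := v.ord_mul 1 1
    rw [mul_one] at this
    rw [show v.ord 1 = 0 by omega]; rfl
  map_mul' x y := by rw [v.ord_mul]; rfl

@[simp] theorem Place.ord_one (v : Place k K) : v.ord 1 = 0 :=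
  Multiplicative.ofAdd.injective v.ordHom.map_one

@[simp] theorem Place.ord_inv (v : Place k K) (x : Kˣ) : v.ord x⁻¹ = - v.ord x :=
  Multiplicative.ofAdd.injective (v.ordHom.map_inv x)

theorem Place.ord_div (v : Place k K) (x y : Kˣ) : v.ord (x / y) = v.ord x - v.ord y :=
  Multiplicative.ofAdd.injective (v.ordHom.map_div x y)

theorem Place.ord_zpow (v : Place k K) (x : Kˣ) (m : ℤ) : v.ord (x ^ m) = m * v.ord x :=
  Multiplicative.ofAdd.injective (by
    rw [mul_comm, Int.ofAdd_mul]
    exact v.ordHom.map_zpow x m)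

theorem Place.ord_unif (v : Place k K) (m : ℤ) : v.ord (Units.mk0 _ v.unif_ne_zero ^ m) = m :=
  v.ord_eq _ 1 _ (by simp)

/-- `m ≤ ord_v x`, where `ord_v 0 = ∞`. -/
def Place.LeOrd (v : Place k K) (m : ℤ) (x : K) : Prop := x * (v.unif : K) ^ (-m) ∈ v.ring

theorem Place.leOrd_iff (v : Place k K) (m : ℤ) (x : Kˣ) : v.LeOrd m x ↔ m ≤ v.ord x := by
  have h : (x : K) * (v.unif : K) ^ (-m) = ((x * Units.mk0 _ v.unif_ne_zero ^ (-m) : Kˣ) : K) := by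
    simp
  rw [Place.LeOrd, h, v.mem_iff, v.ord_mul, v.ord_unif]
  omega

theorem Place.leOrd_zero (v : Place k K) (m : ℤ) : v.LeOrd m 0 := by
  rw [Place.LeOrd, zero_mul]; exact v.ring.zero_mem

theorem Place.LeOrd.add {v : Place k K} {m : ℤ} {x y : K} (hx : v.LeOrd m x) (hy : v.LeOrd m y) :
    v.LeOrd m (x + y) := by
  rw [Place.LeOrd, add_mul]; exact v.ring.add_mem _ _ hx hy

theorem Place.LeOrd.mul {v : Place k K} {m j : ℤ} {x y : K} (hx : v.LeOrd m x)
    (hy : v.LeOrd j y) : v.LeOrd (m + j) (x * y) := by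
  rw [Place.LeOrd, neg_add, zpow_add₀ v.unif_ne_zero, mul_mul_mul_comm]
  exact v.ring.mul_mem _ _ hx hy

theorem Place.LeOrd.mono {v : Place k K} {m j : ℤ} {x : K} (hx : v.LeOrd m x) (h : j ≤ m) :
    v.LeOrd j x := by
  have : x * (v.unif : K) ^ (-j) = x * (v.unif : K) ^ (-m) * (v.unif : K) ^ (m - j) := by
    rw [mul_assoc, ← zpow_add₀ v.unif_ne_zero]; congr 2; omega
  rw [Place.LeOrd, this]
  exact v.ring.mul_mem _ _ hx ((v.unif_zpow_mem_iff _).2 (by omega))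

theorem Place.leOrd_zero_iff (v : Place k K) (x : K) : v.LeOrd 0 x ↔ x ∈ v.ring := by
  rw [Place.LeOrd, neg_zero, zpow_zero, mul_one]

theorem Place.leOrd_const (v : Place k K) (a : k) : v.LeOrd 0 (algebraMap k K a) :=
  (v.leOrd_zero_iff _).2 (v.const_mem a)

theorem Place.leOrd_one_iff (v : Place k K) (x : v.ring) :
    v.LeOrd 1 (x : K) ↔ IsLocalRing.residue v.ring x = 0 := by
  rw [IsLocalRing.residue_eq_zero_iff, v.irreducible_unif.maximalIdeal_eq, Ideal.mem_span_singleton]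
  constructor
  · intro h
    refine ⟨⟨_, h⟩, ?_⟩
    ext
    change (x : K) = v.unif * (x * (v.unif : K) ^ (-1 : ℤ))
    have := v.unif_ne_zero
    rw [zpow_neg_one]
    field_simp
  · rintro ⟨y, rfl⟩
    change (v.unif * y : K) * (v.unif : K) ^ (-1 : ℤ) ∈ v.ring
    have : (v.unif * y : K) * (v.unif : K) ^ (-1 : ℤ) = y := by
      have := v.unif_ne_zero
      rw [zpow_neg_one]
      field_simp
    rw [this]; exact y.2

theorem Place.ord_eq_zero_iff (v : Place k K) (x : Kˣ) :
    v.ord x = 0 ↔ (x : K) ∈ v.ring ∧ (x : K)⁻¹ ∈ v.ring := by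
  rw [v.mem_iff, ← Units.val_inv_eq_inv_val, v.mem_iff, v.ord_inv]
  omega

end Places

/-! ### Weak approximation at finitely many places. -/

section Approximation

variable {k K : Type u} [Field k] [Field K] [Algebra k K] 

theorem Place.ext_ring {v w : Place k K} (h : v.ring = w.ring) : v = w := by
  cases v; cases w; cases h; rfl

variable [hC : Fact (IsCurveFunctionField k K)]

theorem Place.leOrd_inv_of_notMem (v : Place k K) {x : K} (hx : x ∉ v.ring) : v.LeOrd 1 x⁻¹ := by
  have h0 : x ≠ 0 := by rintro rfl; exact hx v.ring.zero_mem
  lift x to Kˣ using isUnit_iff_ne_zero.2 h0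
  rw [v.mem_iff] at hx
  rw [← Units.val_inv_eq_inv_val, v.leOrd_iff, v.ord_inv]
  omega

theorem Place.not_leOrd_one_one (v : Place k K) : ¬ v.LeOrd 1 (1 : K) := by
  rw [← Units.val_one (α := K), v.leOrd_iff, v.ord_one]
  omega

theorem Place.LeOrd.neg {v : Place k K} {m : ℤ} {x : K} (hx : v.LeOrd m x) : v.LeOrd m (-x) := by
  rw [Place.LeOrd, neg_mul]; exact v.ring.neg_mem _ hx

open scoped Classical in
/-- The absolute value attached to a place. -/
def Place.abv (v : Place k K) : AbsoluteValue K ℝ where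
  toFun x := if h : x = 0 then 0 else (2⁻¹ : ℝ) ^ v.ord (Units.mk0 x h)
  map_mul' x y := by
    by_cases hx : x = 0
    · simp [hx]
    by_cases hy : y = 0
    · simp [hy]
    have : Units.mk0 (x * y) (mul_ne_zero hx hy) = Units.mk0 x hx * Units.mk0 y hy := by ext; simp
    simp only [hx, hy, mul_eq_zero, or_self, dite_false]
    rw [this, v.ord_mul, zpow_add₀ (by norm_num)]
  nonneg' x := by
    split_ifs
    · exact le_rfl
    · positivity
  eq_zero' x := by
    split_ifs with h
    · simp [h]
    · simp only [h, iff_false]; positivity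
  add_le' x y := by
    by_cases hx : x = 0
    · simp [hx]
    by_cases hy : y = 0
    · simp [hy]
    by_cases hxy : x + y = 0
    · simp only [hxy, hx, hy, dite_true, dite_false]; positivity
    simp only [hx, hy, hxy, dite_false]
    have hpos : ∀ m : ℤ, (0 : ℝ) < 2⁻¹ ^ m := fun m => by positivity
    have hx' : v.LeOrd (v.ord (Units.mk0 x hx)) x := (v.leOrd_iff _ (Units.mk0 x hx)).2 le_rfl
    have hy' : v.LeOrd (v.ord (Units.mk0 y hy)) y := (v.leOrd_iff _ (Units.mk0 y hy)).2 le_rfl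
    have h : min (v.ord (Units.mk0 x hx)) (v.ord (Units.mk0 y hy)) ≤ v.ord (Units.mk0 _ hxy) :=
      (v.leOrd_iff _ (Units.mk0 _ hxy)).1 ((hx'.mono (min_le_left _ _)).add
        (hy'.mono (min_le_right _ _)))
    have hanti : ∀ i j : ℤ, i ≤ j → (2⁻¹ : ℝ) ^ j ≤ 2⁻¹ ^ i := fun i j hij =>
      zpow_le_zpow_right_of_le_one₀ (by norm_num) (by norm_num) hij
    rcases min_choice (v.ord (Units.mk0 x hx)) (v.ord (Units.mk0 y hy)) with h' | h'
    · rw [h'] at h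
      exact (hanti _ _ h).trans (le_add_of_nonneg_right (hpos _).le)
    · rw [h'] at h
      exact (hanti _ _ h).trans (le_add_of_nonneg_left (hpos _).le)

theorem Place.abv_lt_one_iff (v : Place k K) (x : K) : v.abv x < 1 ↔ v.LeOrd 1 x := by
  by_cases hx : x = 0
  · simp [hx, v.leOrd_zero]
  have h1 : v.abv x = (2⁻¹ : ℝ) ^ v.ord (Units.mk0 x hx) := dif_neg hx
  rw [h1, zpow_lt_one_iff_right_of_lt_one₀ (by norm_num) (by norm_num)]
  exact (v.leOrd_iff 1 (Units.mk0 x hx)).symm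

theorem Place.one_lt_abv_iff (v : Place k K) (x : K) : 1 < v.abv x ↔ x ∉ v.ring := by
  by_cases hx : x = 0
  · simp [hx, v.ring.zero_mem]
  have h1 : v.abv x = (2⁻¹ : ℝ) ^ v.ord (Units.mk0 x hx) := dif_neg hx
  rw [h1, one_lt_zpow_iff_right_of_lt_one₀ (by norm_num) (by norm_num), ← not_le]
  exact not_congr (v.mem_iff (Units.mk0 x hx)).symm

/-- Weak approximation. -/
theorem exists_approximation (S : Finset (Place k K)) (v : Place k K) (hv : v ∈ S) :
    ∃ e : K, v.LeOrd 1 (e - 1) ∧ ∀ w ∈ S, w ≠ v → w.LeOrd 1 e := by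
  obtain ⟨z, hz, hz'⟩ := AbsoluteValue.exists_one_lt_lt_one_pi_of_not_isEquiv
    (v := fun w : S => w.1.abv) (fun w => ⟨w.1.unif, w.1.unif_ne_zero, ne_of_lt
      ((w.1.abv_lt_one_iff _).2 (((w.1.leOrd_iff 1 (Units.mk0 _ w.1.unif_ne_zero))).2
        (by have := w.1.ord_unif 1; rw [zpow_one] at this; rw [this])))⟩)
    (fun w w' hww' h => hww' (Subtype.ext (Place.ext_ring (by
      ext x
      rw [← not_iff_not, ← w.1.one_lt_abv_iff, ← w'.1.one_lt_abv_iff]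
      exact h.one_lt_iff)))) ⟨v, hv⟩
  rw [v.one_lt_abv_iff] at hz
  have h1 : 1 + z ∉ v.ring := fun h => hz (by
    have := v.ring.add_mem _ _ h (v.ring.neg_mem _ v.ring.one_mem)
    rwa [add_neg_cancel_comm] at this)
  have h0 : 1 + z ≠ 0 := fun h => h1 (h ▸ v.ring.zero_mem)
  -- Since z has a pole at v and a zero at the other places of S, z / (1 + z) is close to 1 at v and
  -- to 0 at the others.
  refine ⟨z / (1 + z), ?_, fun w hw hwv => ?_⟩
  · have : z / (1 + z) - 1 = -(1 + z)⁻¹ := by field_simp; ring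
    rw [this]
    exact (v.leOrd_inv_of_notMem h1).neg
  · have h2 := (w.abv_lt_one_iff _).1 (hz' ⟨w, hw⟩ (fun h => hwv (congrArg Subtype.val h)))
    have h3 : (1 + z)⁻¹ ∈ w.ring := by
      by_contra h3
      have h4 := w.leOrd_inv_of_notMem h3
      rw [inv_inv] at h4
      have := h4.add h2.neg
      rw [add_neg_cancel_right] at this
      exact w.not_leOrd_one_one this
    have := h2.mul ((w.leOrd_zero_iff _).2 h3)
    rwa [add_zero, ← div_eq_mul_inv] at this

end Approximation

/-! ### Spaces L(D) over a set of places, and the bound for the number of zeros. -/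

section RiemannRoch

variable {k K : Type u} [Field k] [Field K] [Algebra k K] 

open scoped Classical in
/-- The divisor `D + v`. -/
def addPlace (D : Place k K → ℤ) (v : Place k K) : Place k K → ℤ := D + Pi.single v 1

theorem addPlace_self (D : Place k K → ℤ) (v : Place k K) : addPlace D v v = D v + 1 := by
  simp [addPlace]

theorem addPlace_of_ne (D : Place k K → ℤ) {v w : Place k K} (h : w ≠ v) :
    addPlace D v w = D w := by
  simp [addPlace, h]

variable [hC : Fact (IsCurveFunctionField k K)]

/-- The functions whose divisor is at least `-D` at the places of `S`. -/
def sectionSpace (S : Set (Place k K)) (D : Place k K → ℤ) : Submodule k K where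
  carrier := {x | ∀ v ∈ S, v.LeOrd (-D v) x}
  add_mem' hx hy v hv := (hx v hv).add (hy v hv)
  zero_mem' v _ := v.leOrd_zero _
  smul_mem' a x hx v hv := by
    rw [Algebra.smul_def]
    have := (v.leOrd_const a).mul (hx v hv)
    rwa [zero_add] at this

theorem mem_sectionSpace {S : Set (Place k K)} {D : Place k K → ℤ} {x : K} :
    x ∈ sectionSpace S D ↔ ∀ v ∈ S, v.LeOrd (-D v) x := Iff.rfl

theorem sectionSpace_mono {S : Set (Place k K)} {D D' : Place k K → ℤ} (h : ∀ v ∈ S, D v ≤ D' v) :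
    sectionSpace S D ≤ sectionSpace S D' :=
  fun _ hx v hv => (hx v hv).mono (neg_le_neg (h v hv))

/-- The leading coefficient at `v` of the functions with divisor at least `-(D + v)`. -/
def leadingCoeff {S : Set (Place k K)} (D : Place k K → ℤ) {v : Place k K} (hv : v ∈ S) :
    sectionSpace S (addPlace D v) →ₗ[k] IsLocalRing.ResidueField v.ring where
  toFun x := IsLocalRing.residue v.ring ⟨x * (v.unif : K) ^ (D v + 1), by
    have := x.2 v hv
    rwa [Place.LeOrd, neg_neg, addPlace_self] at this⟩
  map_add' x y := by
    rw [← map_add]; congr 1; ext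
    exact add_mul _ _ _
  map_smul' a x := by
    rw [Algebra.smul_def, RingHom.id_apply, IsScalarTower.algebraMap_apply k v.ring]
    change _ = IsLocalRing.residue _ _ * _
    rw [← map_mul]; congr 1; ext
    change (a • (x : K)) * _ = algebraMap k K a * (_ * _)
    rw [Algebra.smul_def, mul_assoc]

theorem leadingCoeff_eq_zero_iff {S : Set (Place k K)} (D : Place k K → ℤ) {v : Place k K}
    (hv : v ∈ S) (x : sectionSpace S (addPlace D v)) :
    leadingCoeff D hv x = 0 ↔ (x : K) ∈ sectionSpace S D := by
  change IsLocalRing.residue v.ring _ = 0 ↔ _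
  rw [← v.leOrd_one_iff]
  have h : v.LeOrd 1 ((x : K) * (v.unif : K) ^ (D v + 1)) ↔ v.LeOrd (-D v) x := by
    rw [Place.LeOrd, Place.LeOrd, mul_assoc, ← zpow_add₀ v.unif_ne_zero]
    congr! 3; ring
  rw [h]
  refine ⟨fun h w hw => ?_, fun h => h v hv⟩
  by_cases hwv : w = v
  · rw [hwv]; exact h
  · have := x.2 w hw
    rwa [addPlace_of_ne D hwv] at this

/-- The leading coefficient at v has kernel L(D) and takes values in a space of dimension deg v. -/
theorem finite_sectionSpace_addPlace {S : Set (Place k K)} (D : Place k K → ℤ) {v : Place k K}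
    (hv : v ∈ S) [Module.Finite k (sectionSpace S D)] :
    Module.Finite k (sectionSpace S (addPlace D v)) ∧
      finrank k (sectionSpace S (addPlace D v)) ≤ finrank k (sectionSpace S D) + v.degree := by
  have hle : sectionSpace S D ≤ sectionSpace S (addPlace D v) := sectionSpace_mono fun w _ => by
    by_cases h : w = v
    · rw [h, addPlace_self]; omega
    · rw [addPlace_of_ne D h]
  have hker : LinearMap.ker (leadingCoeff D hv) = LinearMap.range (Submodule.inclusion hle) := by
    ext x
    rw [LinearMap.mem_ker, leadingCoeff_eq_zero_iff, Submodule.range_inclusion]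
    rfl
  have h1 : Module.Finite k (LinearMap.ker (leadingCoeff D hv)) := by
    rw [hker]; infer_instance
  have h2 : Module.Finite k (sectionSpace S (addPlace D v)) :=
    have := Module.Finite.equiv (LinearMap.quotKerEquivRange (leadingCoeff D hv)).symm
    Module.Finite.of_submodule_quotient (LinearMap.ker (leadingCoeff D hv))
  refine ⟨h2, ?_⟩
  have h3 := LinearMap.finrank_range_add_finrank_ker (leadingCoeff D hv)
  have h4 : finrank k (LinearMap.range (leadingCoeff D hv)) ≤ v.degree := Submodule.finrank_le _
  have h5 : finrank k (LinearMap.ker (leadingCoeff D hv)) = finrank k (sectionSpace S D) := by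
    rw [hker]
    exact (LinearEquiv.ofInjective _ (Submodule.inclusion_injective hle)).finrank_eq.symm
  omega

/-- A function t with the prescribed leading term at v may have poles elsewhere in S. Multiplying it
by a high power of an e that is 1 at v and 0 at the other places repairs this. Finiteness of S is
essential here. -/
theorem leadingCoeff_surjective (S : Finset (Place k K)) (D : Place k K → ℤ) {v : Place k K}
    (hv : v ∈ S) : Function.Surjective (leadingCoeff (S := (S : Set (Place k K))) D hv) := by
  intro y
  obtain ⟨y, rfl⟩ := IsLocalRing.residue_surjective y
  obtain ⟨e, he, he'⟩ := exists_approximation S v hv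
  have hbound : ∀ (w : Place k K) (x : K), ∃ m : ℤ, w.LeOrd m x := fun w x => by
    by_cases hx : x = 0
    · exact ⟨0, hx ▸ w.leOrd_zero 0⟩
    · exact ⟨_, (w.leOrd_iff _ (Units.mk0 x hx)).2 le_rfl⟩
  set t : K := y * (v.unif : K) ^ (-(D v + 1)) with ht
  choose m hm using fun w => hbound w t
  set N : ℕ := S.sup fun w => (-D w - m w).toNat with hN
  have hpow : ∀ w ∈ S, w ≠ v → ∀ j : ℕ, w.LeOrd j (e ^ j) := fun w hw hwv j => by
    induction j with
    | zero => rw [pow_zero, Nat.cast_zero, w.leOrd_zero_iff]; exact w.ring.one_mem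
    | succ j ih => rw [pow_succ, Nat.cast_succ]; exact ih.mul (he' w hw hwv)
  have hering : e ∈ v.ring := by
    have := v.ring.add_mem _ _ ((v.leOrd_zero_iff _).1 (he.mono zero_le_one)) v.ring.one_mem
    rwa [sub_add_cancel] at this
  have hres : IsLocalRing.residue v.ring ⟨e, hering⟩ = 1 := by
    rw [← sub_eq_zero, ← map_one (IsLocalRing.residue v.ring), ← map_sub, ← v.leOrd_one_iff]
    exact he
  have htv : (e ^ N * t) * (v.unif : K) ^ (D v + 1) = e ^ N * y := by
    rw [ht, mul_assoc, mul_assoc, ← zpow_add₀ v.unif_ne_zero, neg_add_cancel, zpow_zero, mul_one]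
  have hmem : e ^ N * t ∈ sectionSpace (S : Set (Place k K)) (addPlace D v) := by
    intro w hw
    by_cases hwv : w = v
    · subst hwv
      rw [Place.LeOrd, addPlace_self, neg_neg, htv]
      exact w.ring.mul_mem _ _ (pow_mem hering N) y.2
    · rw [addPlace_of_ne D hwv]
      refine ((hpow w hw hwv N).mul (hm w)).mono ?_
      have := Finset.le_sup (f := fun w => (-D w - m w).toNat) hw
      have h2 := Int.self_le_toNat (-D w - m w)
      omega
  refine ⟨⟨_, hmem⟩, ?_⟩
  have : (⟨(e ^ N * t) * (v.unif : K) ^ (D v + 1), by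
      rw [htv]; exact v.ring.mul_mem _ _ (pow_mem hering N) y.2⟩ : v.ring)
      = ⟨e, hering⟩ ^ N * y := by
    ext; exact htv
  change IsLocalRing.residue v.ring _ = _
  rw [this, map_mul, map_pow, hres, one_pow, one_mul]

open scoped Classical in
/-- `D` plus an effective divisor. -/
def addDivisor (D : Place k K → ℤ) (s : Multiset (Place k K)) : Place k K → ℤ :=
  fun v => D v + s.count v

theorem addDivisor_zero (D : Place k K → ℤ) : addDivisor D 0 = D := by
  funext v; simp [addDivisor]

theorem addDivisor_cons (D : Place k K → ℤ) (v : Place k K) (s : Multiset (Place k K)) :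
    addDivisor D (v ::ₘ s) = addPlace (addDivisor D s) v := by
  funext w
  by_cases h : w = v
  · subst h; simp [addDivisor, addPlace, add_assoc]
  · simp [addDivisor, addPlace, h]

theorem finite_sectionSpace_addDivisor {S : Set (Place k K)} (D : Place k K → ℤ)
    [Module.Finite k (sectionSpace S D)] (s : Multiset (Place k K)) (hs : ∀ v ∈ s, v ∈ S) :
    Module.Finite k (sectionSpace S (addDivisor D s)) ∧
      finrank k (sectionSpace S (addDivisor D s)) ≤
        finrank k (sectionSpace S D) + (s.map Place.degree).sum := by
  induction s using Multiset.induction with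
  | empty => rw [addDivisor_zero]; exact ⟨inferInstance, by simp⟩
  | cons v s ih =>
    obtain ⟨h1, h2⟩ := ih fun w hw => hs w (Multiset.mem_cons_of_mem hw)
    have h3 := finite_sectionSpace_addPlace (addDivisor D s) (hs v (Multiset.mem_cons_self v s))
    rw [addDivisor_cons, Multiset.map_cons, Multiset.sum_cons]
    exact ⟨h3.1, by omega⟩

/-- Over a finite set of places the leading coefficient map is onto, so each added place contributes
lifts of a basis of its residue field: the quotient of L(D + s) by L(D) has at least deg s
independent elements. -/
theorem exists_independent (S : Finset (Place k K)) (D : Place k K → ℤ)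
    (s : Multiset (Place k K)) (hs : ∀ v ∈ s, v ∈ S) :
    ∃ b : Fin (s.map Place.degree).sum → K,
      (∀ i, b i ∈ sectionSpace (S : Set (Place k K)) (addDivisor D s)) ∧
      ∀ c : Fin (s.map Place.degree).sum → k,
        ∑ i, c i • b i ∈ sectionSpace (S : Set (Place k K)) D → c = 0 := by
  induction s using Multiset.induction with
  | empty => exact ⟨fun i => Fin.elim0 (by simpa using i), fun i => Fin.elim0 (by simpa using i), fun c _ => funext fun i => Fin.elim0 (by simpa using i)⟩
  | cons v s ih =>
    obtain ⟨b, hb, hb'⟩ := ih fun w hw => hs w (Multiset.mem_cons_of_mem hw)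
    have hv : v ∈ S := hs v (Multiset.mem_cons_self v s)
    choose r hr using leadingCoeff_surjective S (addDivisor D s) hv
    let β := finBasis k (IsLocalRing.ResidueField v.ring)
    rw [Multiset.map_cons, Multiset.sum_cons, addDivisor_cons]
    have hle : sectionSpace (S : Set (Place k K)) (addDivisor D s) ≤
        sectionSpace S (addPlace (addDivisor D s) v) := sectionSpace_mono fun w _ => by
      by_cases h : w = v
      · rw [h, addPlace_self]; omega
      · rw [addPlace_of_ne _ h]
    have hle' : sectionSpace (S : Set (Place k K)) D ≤ sectionSpace S (addDivisor D s) :=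
      sectionSpace_mono fun w _ => by simp [addDivisor]
    refine ⟨Fin.append (fun i => (r (β i) : K)) b, ?_, ?_⟩
    · intro i
      refine Fin.addCases (fun i => ?_) (fun i => ?_) i
      · rw [Fin.append_left]; exact (r (β i)).2
      · rw [Fin.append_right]; exact hle (hb i)
    · intro c hc
      rw [Fin.sum_univ_add] at hc
      simp only [Fin.append_left, Fin.append_right] at hc
      have h2 : ∑ i, c (Fin.natAdd _ i) • b i ∈ sectionSpace (S : Set (Place k K)) (addDivisor D s) :=
        Submodule.sum_mem _ fun i _ => Submodule.smul_mem _ _ (hb i)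
      have h1 : ∑ i, c (Fin.castAdd _ i) • (r (β i) : K) ∈
          sectionSpace (S : Set (Place k K)) (addDivisor D s) := by
        have := Submodule.sub_mem _ (hle' hc) h2
        rwa [add_sub_cancel_right] at this
      have h3 : ∀ i, c (Fin.castAdd _ i) = 0 := by
        have h4 := (leadingCoeff_eq_zero_iff (addDivisor D s) hv
          (∑ i, c (Fin.castAdd _ i) • r (β i))).2 (by
            rw [Submodule.coe_sum]; exact h1)
        rw [map_sum] at h4
        simp only [map_smul, hr] at h4
        exact Fintype.linearIndependent_iff.1 β.linearIndependent _ h4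
      simp only [h3, zero_smul, Finset.sum_const_zero, zero_add] at hc
      have h4 := hb' _ hc
      funext i
      refine Fin.addCases (fun i => ?_) (fun i => ?_) i
      · exact h3 i
      · exact congrFun h4 i

-- A multiset encodes an effective divisor, so that places can be added one at a time.
open scoped Classical in
theorem exists_multiset (S : Finset (Place k K)) (e : Place k K → ℕ) :
    ∃ s : Multiset (Place k K), (∀ v ∈ s, v ∈ S) ∧ (∀ v ∈ S, s.count v = e v) ∧
      (s.map Place.degree).sum = ∑ v ∈ S, e v * v.degree := by
  refine ⟨∑ v ∈ S, e v • {v}, fun v hv => ?_, fun v hv => ?_, ?_⟩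
  · rw [Multiset.mem_sum] at hv
    obtain ⟨w, hw, hv⟩ := hv
    have := Multiset.mem_of_mem_nsmul hv
    rw [Multiset.mem_singleton] at this
    rwa [this]
  · rw [Multiset.count_sum', Finset.sum_eq_single v]
    · simp
    · intro w _ hw
      simp [hw.symm]
    · exact fun h => absurd hv h
  · have : ∀ t : Multiset (Place k K), (t.map Place.degree).sum =
      (Multiset.sumAddMonoidHom.comp (Multiset.mapAddMonoidHom Place.degree)) t := fun t => rfl
    rw [this, map_sum]
    refine Finset.sum_congr rfl fun v _ => ?_
    rw [map_nsmul]
    simp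

/-- A function has at most `[K : k(x)]` zeros, counted with multiplicities and degrees. -/
theorem sum_zeros_le {x : Kˣ} (hx : Transcendental k (x : K)) (S : Finset (Place k K))
    (hS : ∀ v ∈ S, 0 ≤ v.ord x) :
    ∑ v ∈ S, v.degree * v.ord x ≤ finrank (IntermediateField.adjoin k {(x : K)}) K := by
  have := hC.out.finiteDimensional_adjoin hx
  -- On S the divisor s leads from -(x) up to 0. With M the functions regular on S, the b_i lie in M
  -- and are independent modulo the functions vanishing at least as much as x, in particular modulo
  -- x M.
  obtain ⟨s, hs, hcount', hsum⟩ := exists_multiset S fun v => (v.ord x).toNat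
  obtain ⟨b, hb, hb'⟩ := exists_independent S (fun v => -v.ord x) s hs
  have hcount : ∀ v ∈ S, addDivisor (fun v => -v.ord x) s v = 0 := fun v hv => by
    have h1 := Int.toNat_of_nonneg (hS v hv)
    simp only [addDivisor]
    convert neg_add_cancel (v.ord x)
    rw [← h1, ← hcount' v hv]
  have hind := linearIndependent_adjoin hx (sectionSpace (S : Set (Place k K)) 0)
    (fun m hm v hv => by
      have := ((v.leOrd_iff 0 x).2 (hS v hv)).mul (hm v hv)
      rwa [zero_add] at this) b
    (fun i v hv => by have := hb i v hv; rwa [hcount v hv] at this) ?_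
  · have := hind.fintype_card_le_finrank
    rw [Fintype.card_fin, hsum] at this
    refine le_trans (le_of_eq ?_) (Int.ofNat_le.2 this)
    push_cast
    exact Finset.sum_congr rfl fun v hv => by rw [Int.toNat_of_nonneg (hS v hv), mul_comm]
  · rintro c ⟨m, hm, hc⟩
    refine hb' c ?_
    rw [hc]
    intro v hv
    have := ((v.leOrd_iff _ x).2 le_rfl).mul (hm v hv)
    simpa using this

end RiemannRoch

/-! ### Global divisors, the product formula and Riemann's inequality. -/

section ProductFormula

variable {k K : Type u} [Field k] [Field K] [Algebra k K] [hC : Fact (IsCurveFunctionField k K)]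

theorem Place.ord_const (v : Place k K) {x : Kˣ} (hx : ∃ a : k, algebraMap k K a = x) :
    v.ord x = 0 := by
  obtain ⟨a, ha⟩ := hx
  rw [v.ord_eq_zero_iff, ← ha, ← map_inv₀]
  exact ⟨v.const_mem _, v.const_mem _⟩

theorem transcendental_of_ord_ne_zero {x : Kˣ} {v : Place k K} (h : v.ord x ≠ 0) :
    Transcendental k (x : K) :=
  hC.out.transcendental fun a ha => h (v.ord_const ⟨a, ha⟩)

theorem finite_zeros (x : Kˣ) : {v : Place k K | 0 < v.ord x}.Finite := by
  by_cases hx : ∃ a : k, algebraMap k K a = x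
  · convert Set.finite_empty (α := Place k K)
    ext v
    simp [v.ord_const hx]
  · push Not at hx
    by_contra h
    obtain ⟨t, ht, htc⟩ := Set.Infinite.exists_subset_card_eq h
      (finrank (IntermediateField.adjoin k {(x : K)}) K + 1)
    have h1 := sum_zeros_le (hC.out.transcendental hx) t fun v hv => (ht hv).le
    have h2 : ∑ v ∈ t, (1 : ℤ) ≤ ∑ v ∈ t, v.degree * v.ord x := by
      refine Finset.sum_le_sum fun v hv => ?_
      have h3 : 0 < v.ord x := ht hv
      have h4 := v.degree_pos
      nlinarith
    rw [Finset.sum_const, htc] at h2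
    simp at h2
    omega

theorem finite_ord_ne_zero (x : Kˣ) : {v : Place k K | v.ord x ≠ 0}.Finite := by
  refine ((finite_zeros x).union (finite_zeros x⁻¹)).subset fun v hv => ?_
  simp only [Set.mem_union, Set.mem_ofPred_eq, Place.ord_inv] at hv ⊢
  omega

/-- The degree of a divisor. -/
def divDegree : (Place k K →₀ ℤ) →ₗ[ℤ] ℤ := Finsupp.linearCombination ℤ fun v => (v.degree : ℤ)

theorem divDegree_eq_sum (D : Place k K →₀ ℤ) {S : Finset (Place k K)} (h : D.support ⊆ S) :
    divDegree D = ∑ v ∈ S, v.degree * D v := by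
  rw [divDegree, Finsupp.linearCombination_apply, Finsupp.sum_of_support_subset _ h _ (by simp)]
  exact Finset.sum_congr rfl fun v _ => by rw [smul_eq_mul, mul_comm]

/-- The divisor of a function. -/
def principal (x : Kˣ) : Place k K →₀ ℤ :=
  Finsupp.ofSupportFinite (fun v => v.ord x) (finite_ord_ne_zero x)

@[simp] theorem principal_apply (x : Kˣ) (v : Place k K) : principal x v = v.ord x := rfl

/-- The divisor of poles of a function. -/
def poles (x : Kˣ) : Place k K →₀ ℤ := (principal x)⁻

theorem poles_apply (x : Kˣ) (v : Place k K) : poles x v = max (-v.ord x) 0 := by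
  rw [poles, negPart_def]
  simp

/-- Being algebraically closed in K, k is integrally closed in K, hence the intersection of the
valuation rings of K above it; one of these omits x. -/
theorem exists_pole {x : K} (hx : Transcendental k x) : ∃ v : Place k K, x ∉ v.ring := by
  have hcl : IsIntegrallyClosedIn (⊥ : Subalgebra k K).toSubring K := by
    rw [Subring.isIntegrallyClosedIn_iff]
    intro y hy
    have h1 : IsIntegral (⊥ : Subalgebra k K) y := hy
    have h2 : IsIntegral k y := isIntegral_trans y h1
    obtain ⟨a, ha⟩ := hC.out.algebraically_closed y h2.isAlgebraic
    exact ⟨a, ha⟩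
  obtain ⟨V, hV, hxV⟩ := Subring.exists_le_valuationSubring_of_isIntegrallyClosedIn
    (R := (⊥ : Subalgebra k K).toSubring) (x := x) (by
      rintro ⟨a, ha⟩
      exact hx (ha ▸ isAlgebraic_algebraMap a))
  exact ⟨⟨V, fun a => hV ⟨a, rfl⟩, fun h => hxV (h ▸ ValuationSubring.mem_top x)⟩, hxV⟩

theorem exists_transcendental : ∃ x : Kˣ, Transcendental k (x : K) := by
  obtain ⟨t, ht, _⟩ := hC.out.finite_over_rational
  exact ⟨Units.mk0 t (by rintro rfl; exact ht isAlgebraic_zero), ht⟩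

instance : Nonempty (Place k K) := by
  obtain ⟨x, hx⟩ := exists_transcendental (k := k) (K := K)
  exact ⟨(exists_pole hx).choose⟩

/-- The space of global sections attached to a divisor. -/
abbrev globalSections (D : Place k K →₀ ℤ) : Submodule k K := sectionSpace Set.univ D

/-- A nonzero function vanishing at v is not constant, so it has a pole somewhere. -/
theorem globalSections_neg_single (v : Place k K) :
    globalSections (-Finsupp.single v 1 : Place k K →₀ ℤ) = ⊥ := by
  rw [eq_bot_iff]
  intro x hx
  by_contra h0
  lift x to Kˣ using isUnit_iff_ne_zero.2 h0
  have h1 : ∀ w, -(-Finsupp.single v 1 : Place k K →₀ ℤ) w ≤ w.ord x :=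
    fun w => (w.leOrd_iff _ x).1 (hx w trivial)
  have h2 := h1 v
  simp at h2
  obtain ⟨w, hw⟩ := exists_pole (transcendental_of_ord_ne_zero (x := x) (v := v) (by omega))
  have h3 := h1 w
  rw [w.mem_iff] at hw
  simp only [Finsupp.neg_apply, neg_neg] at h3
  have : (0 : ℤ) ≤ Finsupp.single v 1 w := by
    classical
    rw [Finsupp.single_apply]; split_ifs <;> simp
  omega

theorem globalSections_le {D D' : Place k K →₀ ℤ} (h : D ≤ D')
    [Module.Finite k (globalSections D)] :
    Module.Finite k (globalSections D') ∧ (finrank k (globalSections D') : ℤ) ≤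
      finrank k (globalSections D) + divDegree (D' - D) := by
  obtain ⟨s, hs, hcount, hsum⟩ := exists_multiset (D' - D).support fun v => ((D' - D) v).toNat
  have h1 : addDivisor D s = D' := by
    classical
    funext v
    have hle := h v
    by_cases hv : v ∈ (D' - D).support
    · have := hcount v hv
      rw [addDivisor]
      convert add_sub_cancel (D v) (D' v)
      rw [← Finsupp.sub_apply, ← Int.toNat_of_nonneg (show 0 ≤ (D' - D) v by
        rw [Finsupp.sub_apply]; omega), ← this]
    · have h2 : s.count v = 0 := Multiset.count_eq_zero.2 fun h => hv (hs v h)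
      rw [Finsupp.notMem_support_iff, Finsupp.sub_apply] at hv
      have h3 : addDivisor D s v = D v + s.count v := by rw [addDivisor]
      rw [h3, h2, Nat.cast_zero]
      omega
  obtain ⟨h2, h3⟩ := finite_sectionSpace_addDivisor (S := Set.univ) D s fun _ _ => trivial
  rw [h1] at h2 h3
  refine ⟨h2, (Int.ofNat_le.2 h3).trans (le_of_eq ?_)⟩
  rw [hsum, divDegree_eq_sum _ subset_rfl]
  push_cast
  congr 1
  refine Finset.sum_congr rfl fun v _ => ?_
  rw [Int.toNat_of_nonneg, mul_comm]
  exact sub_nonneg.2 (h v)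

theorem divDegree_mono {D D' : Place k K →₀ ℤ} (h : D ≤ D') : divDegree D ≤ divDegree D' := by
  rw [← sub_nonneg, ← map_sub, divDegree_eq_sum _ subset_rfl]
  refine Finset.sum_nonneg fun v _ => mul_nonneg (by positivity) ?_
  have := h v
  rw [Finsupp.sub_apply]; omega

instance (D : Place k K →₀ ℤ) : Module.Finite k (globalSections D) := by
  obtain ⟨v⟩ := (inferInstance : Nonempty (Place k K))
  -- Any divisor is reached by an effective step from one below -v, which has no sections.
  have h1 : globalSections (D ⊓ -Finsupp.single v 1) = ⊥ := by
    rw [eq_bot_iff, ← globalSections_neg_single v]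
    exact sectionSpace_mono fun w _ => (inf_le_right : D ⊓ -Finsupp.single v 1 ≤ _) w
  have : Module.Finite k (globalSections (D ⊓ -Finsupp.single v 1)) := by
    rw [h1]; infer_instance
  exact (globalSections_le (inf_le_left : D ⊓ -Finsupp.single v 1 ≤ D)).1

variable (k K) in
theorem exists_finrank_le : ∃ c : ℤ, ∀ D : Place k K →₀ ℤ, 0 ≤ D →
    (finrank k (globalSections D) : ℤ) ≤ divDegree D + c := by
  obtain ⟨v⟩ := (inferInstance : Nonempty (Place k K))
  refine ⟨divDegree (Finsupp.single v 1), fun D hD => ?_⟩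
  have := (globalSections_le (D := -Finsupp.single v 1) (D' := D) (le_trans (by
    rw [neg_nonpos]; exact Finsupp.single_nonneg.2 zero_le_one) hD)).2
  rw [globalSections_neg_single, finrank_bot, sub_neg_eq_add, map_add] at this
  simpa using this

theorem mul_mem_globalSections {D D' : Place k K →₀ ℤ} {x y : K} (hx : x ∈ globalSections D)
    (hy : y ∈ globalSections D') : x * y ∈ globalSections (D + D') := fun v hv => by
  have := (hx v hv).mul (hy v hv)
  rwa [← neg_add, ← Finsupp.add_apply] at this

theorem mem_globalSections_poles (x : Kˣ) : (x : K) ∈ globalSections (poles (k := k) x) :=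
  fun v _ => (v.leOrd_iff _ x).2 (by rw [poles_apply]; omega)

theorem poles_nonneg (x : Kˣ) : 0 ≤ poles (k := k) x := negPart_nonneg _

theorem one_mem_globalSections {D : Place k K →₀ ℤ} (hD : 0 ≤ D) : (1 : K) ∈ globalSections D :=
  fun v _ => by
    rw [← Units.val_one, v.leOrd_iff, v.ord_one]
    have := hD v
    simpa using this

/-- The sections of multiples of the pole divisor of `x`. -/
theorem exists_le_finrank {x : Kˣ} (hx : Transcendental k (x : K)) :
    ∃ C : Place k K →₀ ℤ, 0 ≤ C ∧ ∀ m : ℕ,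
      (finrank (IntermediateField.adjoin k {(x : K)}) K : ℤ) * (m + 1) ≤
        finrank k (globalSections (m • poles (k := k) x + C)) := by
  have := hC.out.finiteDimensional_adjoin hx
  let β := finBasis (IntermediateField.adjoin k {(x : K)}) K
  let b : Fin (finrank (IntermediateField.adjoin k {(x : K)}) K) → Kˣ := fun i =>
    Units.mk0 (β i) (β.ne_zero i)
  -- C bounds the poles of a basis b of K over k(x). The products x^i b_j with i ≤ m are independent
  -- over k and have poles at most m (x)_∞ + C.
  refine ⟨∑ i, poles (k := k) (b i), Finset.sum_nonneg fun i _ => poles_nonneg _, fun m => ?_⟩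
  let x' : IntermediateField.adjoin k {(x : K)} :=
    ⟨x, IntermediateField.mem_adjoin_simple_self k (x : K)⟩
  have h1 : LinearIndependent k fun i : Fin (m + 1) => x' ^ (i : ℕ) := by
    have hx' : Function.Injective (aeval (R := k) x') := by
      rw [← transcendental_iff_injective]
      exact (transcendental_algebraMap_iff (algebraMap (IntermediateField.adjoin k {(x : K)})
        K).injective).1 hx
    have := ((Polynomial.basisMonomials k).linearIndependent.map' (aeval x').toLinearMap
      (LinearMap.ker_eq_bot.2 hx')).comp (fun i : Fin (m + 1) => (i : ℕ)) Fin.val_injective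
    have heq : (fun i : Fin (m + 1) => x' ^ (i : ℕ)) = ((aeval x').toLinearMap ∘
        Polynomial.basisMonomials k) ∘ fun i : Fin (m + 1) => (i : ℕ) := by
      funext i; simp
    rw [heq]
    exact this
  have h2 := linearIndependent_smul h1 β.linearIndependent
  have h3 : ∀ p : Fin (m + 1) × Fin (finrank (IntermediateField.adjoin k {(x : K)}) K),
      x' ^ (p.1 : ℕ) • β p.2 ∈ globalSections (m • poles (k := k) x + ∑ i, poles (k := k) (b i)) := by
    intro p
    have h4 : ∀ i j : ℕ, i ≤ j → (x : K) ^ i ∈ globalSections (j • poles (k := k) x) := by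
      intro i j
      induction j generalizing i with
      | zero => 
        intro h
        rw [Nat.le_zero.1 h, pow_zero]; exact one_mem_globalSections (by simp)
      | succ j ih =>
        intro h
        rcases i with _ | i
        · rw [pow_zero]; exact one_mem_globalSections (nsmul_nonneg (poles_nonneg x) _)
        · rw [pow_succ, succ_nsmul]
          exact mul_mem_globalSections (ih i (by omega)) (mem_globalSections_poles (k := k) x)
    have h5 : β p.2 ∈ globalSections (∑ i, poles (k := k) (b i)) :=
      sectionSpace_mono (fun v _ => Finset.single_le_sum (f := fun i => poles (k := k) (b i))
        (fun i _ => poles_nonneg _) (Finset.mem_univ p.2) v)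
        (mem_globalSections_poles (b p.2))
    exact mul_mem_globalSections (h4 _ _ (Nat.lt_succ_iff.1 p.1.2)) h5
  have h4 : LinearIndependent k fun p => (⟨_, h3 p⟩ :
      globalSections (m • poles (k := k) x + ∑ i, poles (k := k) (b i))) :=
    LinearIndependent.of_comp (Submodule.subtype _) h2
  have := h4.fintype_card_le_finrank
  rw [Fintype.card_prod, Fintype.card_fin, Fintype.card_fin, mul_comm] at this
  exact_mod_cast this

theorem adjoin_inv (x : Kˣ) : IntermediateField.adjoin k {((x⁻¹ : Kˣ) : K)} =
    IntermediateField.adjoin k {(x : K)} := by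
  refine le_antisymm (IntermediateField.adjoin_simple_le_iff.2 ?_)
    (IntermediateField.adjoin_simple_le_iff.2 ?_)
  · rw [Units.val_inv_eq_inv_val]
    exact inv_mem (IntermediateField.mem_adjoin_simple_self k (x : K))
  · have := inv_mem (IntermediateField.mem_adjoin_simple_self k ((x⁻¹ : Kˣ) : K))
    rwa [← Units.val_inv_eq_inv_val, inv_inv] at this

/-- The bound from above is `sum_zeros_le` for x⁻¹. From below, L(m (x)_∞ + C) has dimension at
least [K : k(x)] (m + 1) and at most m deg (x)_∞ plus a constant, for every m. -/
theorem divDegree_poles {x : Kˣ} (hx : Transcendental k (x : K)) :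
    divDegree (poles (k := k) x) = finrank (IntermediateField.adjoin k {(x : K)}) K := by
  refine le_antisymm ?_ ?_
  · have hx' : Transcendental k ((x⁻¹ : Kˣ) : K) := by
      rw [Units.val_inv_eq_inv_val]
      exact fun h => hx (inv_inv (x : K) ▸ h.inv)
    have hadj := adjoin_inv (k := k) x
    have h1 := sum_zeros_le hx' (poles x).support fun v hv => by
      rw [Finsupp.mem_support_iff, poles_apply] at hv
      rw [v.ord_inv]
      omega
    rw [hadj] at h1
    rw [divDegree_eq_sum _ subset_rfl]
    refine le_trans (Finset.sum_le_sum fun v hv => ?_) h1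
    rw [Finsupp.mem_support_iff, poles_apply] at hv
    rw [poles_apply, v.ord_inv, max_eq_left (by omega)]
  · obtain ⟨C, hC0, hCm⟩ := exists_le_finrank hx
    obtain ⟨c, hc⟩ := exists_finrank_le k K
    by_contra! hlt
    have h1 : ∀ m : ℕ, (finrank (IntermediateField.adjoin k {(x : K)}) K : ℤ) * (m + 1) ≤
        m * divDegree (poles x) + divDegree C + c := fun m => by
      have := (hCm m).trans (hc _ (add_nonneg (nsmul_nonneg (poles_nonneg x) m) hC0))
      rwa [map_add, map_nsmul, nsmul_eq_mul] at this
    -- If the degree were at most [K : k(x)] - 1, this m would give m + [K : k(x)] ≤ deg C + c ≤ m.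
    have h2 := h1 (divDegree C + c).toNat
    have h3 := Int.self_le_toNat (divDegree C + c)
    have h4 : (0 : ℤ) ≤ (divDegree C + c).toNat := by positivity
    have h5 := mul_le_mul_of_nonneg_left (Int.le_sub_one_of_lt hlt) h4
    have h6 : 0 ≤ divDegree (poles (k := k) x) := by
      rw [← map_zero (divDegree (k := k) (K := K))]; exact divDegree_mono (poles_nonneg x)
    linarith

/-- The zeros of x are the poles of x⁻¹, and k(x) = k(x⁻¹), so zeros and poles have the same degree.
-/
theorem divDegree_principal (x : Kˣ) : divDegree (principal (k := k) x) = 0 := by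
  by_cases hx : ∃ a : k, algebraMap k K a = x
  · have : principal (k := k) x = 0 := by
      ext v; simp [v.ord_const hx]
    rw [this, map_zero]
  · push Not at hx
    have htr := hC.out.transcendental hx
    have h0 : principal (k := k) x = poles x⁻¹ - poles x := by
      ext v
      rw [Finsupp.sub_apply, poles_apply, poles_apply, v.ord_inv, principal_apply]
      omega
    have hx' : Transcendental k ((x⁻¹ : Kˣ) : K) := by
      rw [Units.val_inv_eq_inv_val]
      exact fun h => htr (inv_inv (x : K) ▸ h.inv)
    have hadj := adjoin_inv (k := k) x
    rw [h0, map_sub, divDegree_poles hx', divDegree_poles htr, hadj, sub_self]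

variable (k K) in
/-- Riemann's inequality. -/
theorem exists_riemann : ∃ g : ℤ, ∀ A : Place k K →₀ ℤ,
    divDegree A - g ≤ finrank k (globalSections A) := by
  obtain ⟨x, hx⟩ := exists_transcendental (k := k) (K := K)
  obtain ⟨C, hC0, hCm⟩ := exists_le_finrank hx
  have hdeg := divDegree_poles hx
  have hpos : 0 < (finrank (IntermediateField.adjoin k {(x : K)}) K : ℤ) := by
    have := hC.out.finiteDimensional_adjoin hx
    exact_mod_cast finrank_pos
  obtain ⟨d, hd⟩ : ∃ d : ℤ, d = finrank (IntermediateField.adjoin k {(x : K)}) K := ⟨_, rfl⟩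
  rw [← hd] at hdeg hpos
  simp only [← hd] at hCm
  refine ⟨divDegree C - d, fun A => ?_⟩
  -- This m is large enough for m (x)_∞ + C - A to have a nonzero section z. Then A - (z) ≤ m (x)_∞
  -- + C, and the lower bound for the latter passes to L(A - (z)), which multiplication by z⁻¹
  -- embeds in L(A). The terms in m cancel because deg (x)_∞ = [K : k(x)].
  set m : ℕ := (divDegree A⁺).toNat with hm
  have h1 : 0 < finrank k (globalSections (m • poles x + C - A)) := by
    have h2 := (globalSections_le (D := m • poles x + C - A⁺) (D' := m • poles x + C)
      (sub_le_self _ (posPart_nonneg A))).2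
    have h3 : finrank k (globalSections (m • poles x + C - A⁺)) ≤
        finrank k (globalSections (m • poles x + C - A)) :=
      Submodule.finrank_mono (sectionSpace_mono fun v _ =>
        (sub_le_sub_left (le_posPart A) (m • poles x + C) : _ ≤ m • poles x + C - A) v)
    have h4 := hCm m
    rw [sub_sub_cancel] at h2
    have h5 := Int.self_le_toNat (divDegree A⁺)
    rw [← hm] at h5
    have h6 : (0 : ℤ) ≤ m := by positivity
    nlinarith
  obtain ⟨⟨z, hz⟩, hz0⟩ := (Module.finrank_pos_iff_exists_ne_zero (R := k)).1 h1
  have hz0' : z ≠ 0 := by simpa using hz0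
  lift z to Kˣ using isUnit_iff_ne_zero.2 hz0'
  have h2 : A - principal z ≤ m • poles x + C := fun v => by
    have := (v.leOrd_iff _ z).1 (hz v trivial)
    simp only [Finsupp.sub_apply, Finsupp.add_apply, principal_apply] at this ⊢
    omega
  have h3 := (globalSections_le h2).2
  have h4 : finrank k (globalSections (A - principal z)) ≤ finrank k (globalSections A) := by
    let μ : globalSections (A - principal (k := k) z) →ₗ[k] globalSections A :=
      ((LinearMap.mulRight k ((z⁻¹ : Kˣ) : K)).restrict (q := globalSections A) fun y hy => by
        have h4 : ((z⁻¹ : Kˣ) : K) ∈ globalSections (principal (k := k) z) := fun v _ =>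
          (v.leOrd_iff _ z⁻¹).2 (by simp)
        have := mul_mem_globalSections hy h4
        rwa [sub_add_cancel] at this)
    refine LinearMap.finrank_le_finrank_of_injective (f := μ) fun y y' h => ?_
    have h5 : (y : K) * ((z⁻¹ : Kˣ) : K) = y' * ((z⁻¹ : Kˣ) : K) := congrArg Subtype.val h
    exact Subtype.ext (mul_right_cancel₀ (Units.ne_zero _) h5)
  have h5 := hCm m
  have h6 : divDegree (m • poles x + C - (A - principal z)) =
      m * d + divDegree C - divDegree A := by
    rw [map_sub, map_sub, divDegree_principal, map_add, map_nsmul, hdeg, nsmul_eq_mul]; ring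
  rw [h6] at h3
  have : (finrank k (globalSections (A - principal z)) : ℤ) ≤ finrank k (globalSections A) := by
    exact_mod_cast h4
  linarith

end ProductFormula

/-! ### Degrees of rank one lattices in terms of divisors. -/

section RankOne

variable {k K : Type u} [Field k] [Field K] [Algebra k K] [hC : Fact (IsCurveFunctionField k K)]

theorem Place.leOrd_mul_unit (v : Place k K) (m : ℤ) (x : K) (y : Kˣ) :
    v.LeOrd (m + v.ord y) (x * y) ↔ v.LeOrd m x := by
  refine ⟨fun h => ?_, fun h => h.mul ((v.leOrd_iff _ y).2 le_rfl)⟩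
  have := h.mul ((v.leOrd_iff _ y⁻¹).2 le_rfl)
  rwa [v.ord_inv, add_neg_cancel_right, mul_assoc, Units.mul_inv, mul_one] at this

theorem Place.exists_ord_eq (v : Place k K) (m : ℤ) : ∃ x : Kˣ, v.ord x = m :=
  ⟨_, v.ord_unif m⟩

theorem Place.length_quotient (v : Place k K) (m : ℕ) :
    Module.length v.ring (v.ring ⧸ Ideal.span {v.unif ^ m}) = m := by
  have h := Ring.ord_pow (R := v.ring) (x := v.unif)
    (mem_nonZeroDivisors_of_ne_zero v.irreducible_unif.ne_zero) m
  rw [Ring.ord_of_irreducible v.irreducible_unif, nsmul_one] at h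
  exact h

/-- A generator of S identifies S ⧸ T with the local ring modulo the power j - m of a uniformizer.
-/
theorem Place.length_lattice (v : Place k K) {Q : Type w} [AddCommGroup Q] [Module K Q]
    (e : Q ≃ₗ[K] K) {S T : Submodule v.ring Q} {m j : ℤ} (hS : ∀ q, q ∈ S ↔ v.LeOrd m (e q))
    (hT : ∀ q, q ∈ T ↔ v.LeOrd j (e q)) (hmj : m ≤ j) :
    Module.length v.ring (S ⧸ T.submoduleOf S) = (j - m).toNat := by
  obtain ⟨t, ht⟩ := v.exists_ord_eq m
  have h0 : e.symm t ∈ S := by rw [hS, e.apply_symm_apply, v.leOrd_iff, ht]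
  let f : v.ring →ₗ[v.ring] (S ⧸ T.submoduleOf S) :=
    (T.submoduleOf S).mkQ ∘ₗ LinearMap.toSpanSingleton v.ring S ⟨e.symm t, h0⟩
  have hval : ∀ r : v.ring, e (r • e.symm (t : K)) = r * t := fun r => by
    change e ((r : K) • e.symm (t : K)) = r * t
    rw [map_smul, e.apply_symm_apply, smul_eq_mul]
  have hf : Function.Surjective f := by
    intro q
    obtain ⟨⟨q, hq⟩, rfl⟩ := Submodule.mkQ_surjective _ q
    have h1 : e q * ((t⁻¹ : Kˣ) : K) ∈ v.ring := by
      rw [← v.leOrd_zero_iff]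
      have := ((hS q).1 hq).mul ((v.leOrd_iff _ t⁻¹).2 le_rfl)
      rwa [v.ord_inv, ht, add_neg_cancel] at this
    refine ⟨⟨_, h1⟩, congrArg (T.submoduleOf S).mkQ (Subtype.ext (e.injective ?_))⟩
    refine (hval _).trans ?_
    simp
  have hker : LinearMap.ker f = Ideal.span {v.unif ^ (j - m).toNat} := by
    ext r
    have h1 : r ∈ LinearMap.ker f ↔ v.LeOrd j ((r : K) * t) := by
      rw [LinearMap.mem_ker]
      change (T.submoduleOf S).mkQ _ = 0 ↔ _
      rw [← LinearMap.mem_ker, Submodule.ker_mkQ]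
      change r • e.symm (t : K) ∈ T ↔ _
      rw [hT, hval]
    have h2 : v.LeOrd j ((r : K) * t) ↔ v.LeOrd (j - m) r := by
      rw [← v.leOrd_mul_unit (j - m) r t, ht, sub_add_cancel]
    have h4 : ((v.unif : K) ^ (j - m).toNat) ≠ 0 := pow_ne_zero _ v.unif_ne_zero
    have h5 : (v.unif : K) ^ (-(j - m)) = ((v.unif : K) ^ (j - m).toNat)⁻¹ := by
      rw [zpow_neg, ← zpow_natCast, Int.toNat_of_nonneg (by omega)]
    rw [h1, h2, Ideal.mem_span_singleton, Place.LeOrd, h5]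
    constructor
    · intro h
      refine ⟨⟨_, h⟩, ?_⟩
      ext
      change (r : K) = (v.unif : K) ^ (j - m).toNat * (r * ((v.unif : K) ^ (j - m).toNat)⁻¹)
      field_simp
    · rintro ⟨y, rfl⟩
      change (v.unif : K) ^ (j - m).toNat * y * ((v.unif : K) ^ (j - m).toNat)⁻¹ ∈ v.ring
      rw [mul_comm _ (y : K), mul_inv_cancel_right₀ h4]
      exact y.2
  rw [← (f.quotKerEquivOfSurjective hf).length_eq, hker, v.length_quotient]

theorem Place.relLength_eq (v : Place k K) {Q : Type w} [AddCommGroup Q] [Module K Q]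
    (e : Q ≃ₗ[K] K) {S T : Submodule v.ring Q} {m j : ℤ} (hS : ∀ q, q ∈ S ↔ v.LeOrd m (e q))
    (hT : ∀ q, q ∈ T ↔ v.LeOrd j (e q)) : relLength S T = j - m := by
  have hself : ∀ S : Submodule v.ring Q, Module.length v.ring (S ⧸ S.submoduleOf S) = 0 := by
    intro S
    rw [Module.length_eq_zero_iff, Submodule.Quotient.subsingleton_iff,
      Submodule.submoduleOf_self]
  rcases le_total m j with h | h
  · have hle : T ≤ S := fun q hq => (hS q).2 (((hT q).1 hq).mono h)
    rw [relLength, inf_eq_right.2 hle, v.length_lattice e hS hT h, hself]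
    simp
    omega
  · have hle : S ≤ T := fun q hq => (hT q).2 (((hS q).1 hq).mono h)
    rw [relLength, inf_eq_left.2 hle, v.length_lattice e hT hS h, hself]
    simp
    omega

/-- The degree of a family of rank one lattices described by a divisor. -/
theorem degree_eq_neg_divDegree {Q : Type w} [AddCommGroup Q] [Module K Q] [Module.Finite K Q]
    (e : Q ≃ₗ[K] K) (S : ∀ v : Place k K, Submodule v.ring Q) (D : Place k K →₀ ℤ)
    (hS : ∀ v q, q ∈ S v ↔ v.LeOrd (D v) (e q)) : degree S = -divDegree D := by
  have hfin : finrank K Q = 1 := by rw [e.finrank_eq, finrank_self]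
  let i0 : Fin (finrank K Q) := ⟨0, by omega⟩
  have hsub : ∀ i : Fin (finrank K Q), i = i0 := fun i => Fin.ext (by
    have := i.2; change (i : ℕ) = 0; omega)
  have hrange : Set.range (finBasis K Q) = {finBasis K Q i0} := by
    ext q
    simp only [Set.mem_range, Set.mem_singleton_iff]
    exact ⟨fun ⟨i, hi⟩ => by rw [← hi, hsub i], fun h => ⟨i0, h.symm⟩⟩
  have hh0 : e (finBasis K Q i0) ≠ 0 := by
    rw [Ne, e.map_eq_zero_iff]; exact (finBasis K Q).ne_zero i0
  obtain ⟨h, hh⟩ : ∃ h : Kˣ, (h : K) = e (finBasis K Q i0) := ⟨Units.mk0 _ hh0, rfl⟩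
  have hT : ∀ (v : Place k K) q, q ∈ Submodule.span v.ring (Set.range (finBasis K Q)) ↔
      v.LeOrd (v.ord h) (e q) := by
    intro v q
    rw [hrange, Submodule.mem_span_singleton]
    constructor
    · rintro ⟨r, rfl⟩
      have : e (r • finBasis K Q i0) = r * h := by
        change e ((r : K) • finBasis K Q i0) = r * h
        rw [map_smul, hh, smul_eq_mul]
      rw [this, ← zero_add (v.ord h), v.leOrd_mul_unit, v.leOrd_zero_iff]
      exact r.2
    · intro hq
      have h1 : e q * ((h⁻¹ : Kˣ) : K) ∈ v.ring := by
        rw [← v.leOrd_zero_iff]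
        have := hq.mul ((v.leOrd_iff _ h⁻¹).2 le_rfl)
        rwa [v.ord_inv, add_neg_cancel] at this
      refine ⟨⟨_, h1⟩, e.injective ?_⟩
      change e ((e q * ((h⁻¹ : Kˣ) : K)) • finBasis K Q i0) = e q
      rw [map_smul, ← hh, smul_eq_mul, mul_assoc, Units.inv_mul, mul_one]
  -- Measured against the chosen basis vector, the degree is that of (h) - D, where h is the image
  -- of that vector under e; the product formula removes (h).
  have h1 : ∀ v : Place k K, (v.degree : ℤ) *
      relLength (S v) (Submodule.span v.ring (Set.range (finBasis K Q))) =
      v.degree * (principal h - D : Place k K →₀ ℤ) v := fun v => by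
    rw [v.relLength_eq e (hS v) (hT v)]
    rfl
  rw [degree]
  simp only [h1]
  rw [finsum_eq_sum_of_support_subset (s := (principal h - D : Place k K →₀ ℤ).support),
    ← divDegree_eq_sum _ subset_rfl, map_sub, divDegree_principal, zero_sub]
  intro v hv
  rw [Function.mem_support] at hv
  rw [Finset.mem_coe, Finsupp.mem_support_iff]
  exact right_ne_zero_of_mul hv

theorem finite_not_leOrd (x : K) : {v : Place k K | ¬ v.LeOrd 0 x}.Finite := by
  by_cases h0 : x = 0
  · convert Set.finite_empty (α := Place k K)
    ext v
    simp [h0, v.leOrd_zero]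
  · lift x to Kˣ using isUnit_iff_ne_zero.2 h0
    refine (finite_ord_ne_zero x).subset fun v hv => ?_
    simp only [Set.mem_ofPred_eq, v.leOrd_iff] at hv ⊢
    omega

theorem Place.LeOrd.le_ord {v : Place k K} {m : ℤ} {x : Kˣ} (h : v.LeOrd m x) : m ≤ v.ord x :=
  (v.leOrd_iff m x).1 h

theorem Place.exists_leOrd (v : Place k K) (x : K) : ∃ m : ℤ, v.LeOrd m x := by
  by_cases hx : x = 0
  · exact ⟨0, hx ▸ v.leOrd_zero 0⟩
  · exact ⟨_, (v.leOrd_iff _ (Units.mk0 x hx)).2 le_rfl⟩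

/-- A nonzero bounded submodule of `K` is a fractional ideal. -/
theorem Place.exists_eq_leOrd (v : Place k K) (M : Submodule v.ring K) {x : Kˣ} (hx : (x : K) ∈ M)
    {m : ℤ} (hm : ∀ y ∈ M, v.LeOrd m y) : ∃ j : ℤ, ∀ y, y ∈ M ↔ v.LeOrd j y := by
  obtain ⟨j, ⟨z, hz, rfl⟩, hj⟩ := Int.exists_least_of_bdd
    (P := fun j => ∃ z : Kˣ, (z : K) ∈ M ∧ v.ord z = j)
    ⟨m, by rintro _ ⟨z, hz, rfl⟩; exact (hm _ hz).le_ord⟩ ⟨_, x, hx, rfl⟩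
  refine ⟨v.ord z, fun y => ⟨fun hy => ?_, fun hy => ?_⟩⟩
  · by_cases h0 : y = 0
    · rw [h0]; exact v.leOrd_zero _
    · lift y to Kˣ using isUnit_iff_ne_zero.2 h0
      exact (v.leOrd_iff _ y).2 (hj _ ⟨y, hy, rfl⟩)
  · have h1 : y * ((z⁻¹ : Kˣ) : K) ∈ v.ring := by
      rw [← v.leOrd_zero_iff]
      have := hy.mul ((v.leOrd_iff _ z⁻¹).2 le_rfl)
      rwa [v.ord_inv, add_neg_cancel] at this
    have h2 : y = (⟨_, h1⟩ : v.ring) • (z : K) := by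
      change y = y * ((z⁻¹ : Kˣ) : K) * z
      rw [mul_assoc, Units.inv_mul, mul_one]
    rw [h2]
    exact M.smul_mem _ hz

variable {W : Type w} [AddCommGroup W] [Module K W]

/-- The image of the stalk of `E ∩ U` under a linear form. -/
def imageStalk (E : VecBundle k K W) (U : Submodule K W) (Ψ : W →ₗ[K] K) (v : Place k K) :
    Submodule v.ring K :=
  Submodule.map (Ψ.restrictScalars v.ring) (U.restrictScalars v.ring ⊓ E.stalk v)

theorem mem_imageStalk {E : VecBundle k K W} {U : Submodule K W} {Ψ : W →ₗ[K] K} {v : Place k K}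
    {x : K} : x ∈ imageStalk E U Ψ v ↔ ∃ y ∈ U, y ∈ E.stalk v ∧ Ψ y = x := by
  constructor
  · rintro ⟨y, ⟨h1, h2⟩, h3⟩
    exact ⟨y, h1, h2, h3⟩
  · rintro ⟨y, h1, h2, h3⟩
    exact ⟨y, ⟨h1, h2⟩, h3⟩

theorem Place.exists_smul_mem (v : Place k K) (E : VecBundle k K W) (y : W) :
    ∃ a : Kˣ, (a : K) • y ∈ E.stalk v := by
  have hy : y ∈ Submodule.span K (E.stalk v : Set W) := by rw [E.span_eq_top]; trivial
  induction hy using Submodule.span_induction with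
  | mem y hy => exact ⟨1, by simpa using hy⟩
  | zero => exact ⟨1, by simp⟩
  | add y z _ _ hy hz =>
    obtain ⟨a, ha⟩ := hy
    obtain ⟨b, hb⟩ := hz
    rcases le_total (v.ord a) (v.ord b) with h | h
    · refine ⟨b, ?_⟩
      rw [smul_add]
      refine Submodule.add_mem _ ?_ hb
      have : ((b / a : Kˣ) : K) ∈ v.ring := by rw [v.mem_iff, v.ord_div]; omega
      have h2 := (E.stalk v).smul_mem (⟨_, this⟩ : v.ring) ha
      convert h2 using 1
      change _ = ((b / a : Kˣ) : K) • ((a : K) • y)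
      rw [smul_smul, Units.val_div_eq_div_val, div_mul_cancel₀ _ a.ne_zero]
    · refine ⟨a, ?_⟩
      rw [smul_add]
      refine Submodule.add_mem _ ha ?_
      have : ((a / b : Kˣ) : K) ∈ v.ring := by rw [v.mem_iff, v.ord_div]; omega
      have h2 := (E.stalk v).smul_mem (⟨_, this⟩ : v.ring) hb
      convert h2 using 1
      change _ = ((a / b : Kˣ) : K) • ((b : K) • z)
      rw [smul_smul, Units.val_div_eq_div_val, div_mul_cancel₀ _ b.ne_zero]
  | smul c y _ hy =>
    obtain ⟨a, ha⟩ := hy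
    by_cases hc : c = 0
    · exact ⟨1, by simp [hc]⟩
    · refine ⟨a * (Units.mk0 c hc)⁻¹, ?_⟩
      rw [smul_smul]
      convert ha using 2
      simp [hc]

/-- The image of a vector bundle under a linear form is a line bundle, described by a divisor. -/
theorem exists_divisor_imageStalk (E : VecBundle k K W) (U : Submodule K W) (Ψ : W →ₗ[K] K)
    {y : W} (hy : y ∈ U) (hΨ : Ψ y ≠ 0) :
    ∃ D : Place k K →₀ ℤ, ∀ v x, x ∈ imageStalk E U Ψ v ↔ v.LeOrd (D v) x := by
  have h1 : ∀ v, ∃ j : ℤ, ∀ x, x ∈ imageStalk E U Ψ v ↔ v.LeOrd j x := by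
    intro v
    obtain ⟨a, ha⟩ := v.exists_smul_mem E y
    have hx : ((a * Units.mk0 _ hΨ : Kˣ) : K) ∈ imageStalk E U Ψ v :=
      mem_imageStalk.2 ⟨(a : K) • y, U.smul_mem _ hy, ha, by simp⟩
    obtain ⟨s, hs⟩ := E.fg v
    have h2 : ∀ t : Finset W, ∃ m : ℤ, ∀ z ∈ Submodule.span v.ring (t : Set W), v.LeOrd m (Ψ z) := by
      classical
      intro t
      induction t using Finset.induction_on with
      | empty =>
        refine ⟨0, fun z hz => ?_⟩
        rw [Finset.coe_empty, Submodule.span_empty, Submodule.mem_bot] at hz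
        rw [hz, map_zero]
        exact v.leOrd_zero 0
      | insert b t _ ih =>
        obtain ⟨m, hm⟩ := ih
        obtain ⟨j, hj⟩ := v.exists_leOrd (Ψ b)
        refine ⟨min m j, fun z hz => ?_⟩
        rw [Finset.coe_insert, Submodule.mem_span_insert] at hz
        obtain ⟨r, z, hz, rfl⟩ := hz
        have h3 : Ψ (r • b) = r * Ψ b := by
          change Ψ ((r : K) • b) = _
          rw [map_smul, smul_eq_mul]
        rw [map_add, h3]
        refine Place.LeOrd.add ?_ ((hm z hz).mono (min_le_left _ _))
        have := ((v.leOrd_zero_iff _).2 r.2).mul hj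
        rw [zero_add] at this
        exact this.mono (min_le_right _ _)
    obtain ⟨m, hm⟩ := h2 s
    refine v.exists_eq_leOrd _ hx (m := m) fun x hx => ?_
    obtain ⟨z, _, hz, rfl⟩ := mem_imageStalk.1 hx
    rw [← hs] at hz
    exact hm z hz
  choose D hD using h1
  obtain ⟨r, b, hb⟩ := E.coherent
  -- At almost every place the stalk is spanned by b and contains y, Ψ is integral on it, and Ψ y is
  -- a unit; the image is then the local ring.
  have hfin : {v : Place k K | D v ≠ 0}.Finite := by
    refine ((hb.union (Set.finite_iUnion fun i => finite_not_leOrd (b.repr y i))).union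
      ((Set.finite_iUnion fun i => finite_not_leOrd (Ψ (b i))).union
        (finite_ord_ne_zero (Units.mk0 _ hΨ)))).subset fun v hv => ?_
    by_contra hcon
    simp only [Set.mem_union, Set.mem_iUnion, Set.mem_ofPred_eq, not_or, not_exists, not_not] at hcon
    obtain ⟨⟨h1, h2⟩, h3, h4⟩ := hcon
    have hyE : y ∈ E.stalk v := by
      rw [h1, ← b.sum_repr y]
      refine Submodule.sum_mem _ fun i _ => ?_
      exact Submodule.smul_mem _ (⟨_, (v.leOrd_zero_iff _).1 (h2 i)⟩ : v.ring)
        (Submodule.subset_span ⟨i, rfl⟩)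
    have h5 : v.LeOrd (D v) (Units.mk0 _ hΨ : Kˣ) :=
      (hD v _).1 (mem_imageStalk.2 ⟨y, hy, hyE, rfl⟩)
    have h6 := h5.le_ord
    rw [h4] at h6
    obtain ⟨t, ht⟩ := v.exists_ord_eq (D v)
    obtain ⟨z, hzU, hz, hzt⟩ := mem_imageStalk.1 ((hD v t).2 ((v.leOrd_iff _ t).2 ht.ge))
    have h7 : v.LeOrd 0 (Ψ z) := by
      rw [h1] at hz
      clear hzt hzU
      induction hz using Submodule.span_induction with
      | mem z hz => obtain ⟨i, rfl⟩ := hz; exact h3 i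
      | zero => rw [map_zero]; exact v.leOrd_zero 0
      | add z z' _ _ hz hz' => rw [map_add]; exact hz.add hz'
      | smul r z _ hz =>
        have h3 : Ψ (r • z) = r * Ψ z := by
          change Ψ ((r : K) • z) = _
          rw [map_smul, smul_eq_mul]
        rw [h3]
        have := ((v.leOrd_zero_iff _).2 r.2).mul hz
        rwa [zero_add] at this
    rw [hzt] at h7
    have := h7.le_ord
    exact hv (by omega)
  exact ⟨Finsupp.ofSupportFinite D hfin, hD⟩

theorem LineBundle.exists_divisor (F : LineBundle k K) : ∃ D : Place k K →₀ ℤ,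
    (∀ v x, x ∈ F.stalk v ↔ v.LeOrd (D v) x) ∧ degree F.stalk = -divDegree D := by
  obtain ⟨D, hD⟩ := exists_divisor_imageStalk F ⊤ LinearMap.id (y := 1) trivial one_ne_zero
  have h1 : ∀ v x, x ∈ F.stalk v ↔ v.LeOrd (D v) x := fun v x => by
    rw [← hD, mem_imageStalk]
    simp
  exact ⟨D, h1, degree_eq_neg_divDegree (LinearEquiv.refl K K) _ D h1⟩

variable [Module.Finite K W] {n : ℕ} {A : GSOBundle k K n W}

/-- A linear form that vanishes on W_j but not on W_{j+1} identifies the line W_{j+1} / W_j with K,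
so the slope can be read off from its image. -/
theorem BorelReduction.slope_eq (B : BorelReduction A) (j : Fin (n + 1)) (Ψ : W →ₗ[K] K)
    (h0 : ∀ x ∈ B.flag j.castSucc, Ψ x = 0) {y : W} (hy : y ∈ B.flag j.succ) (hΨ : Ψ y ≠ 0)
    {D : Place k K →₀ ℤ}
    (hD : ∀ v x, x ∈ imageStalk A.E (B.flag j.succ) Ψ v ↔ v.LeOrd (D v) x) :
    B.slope j = -divDegree D := by
  let N := (B.flag j.castSucc).submoduleOf (B.flag j.succ)
  let f : (B.flag j.succ ⧸ N) →ₗ[K] K := N.liftQ (Ψ ∘ₗ (B.flag j.succ).subtype) fun x hx => h0 _ hx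
  have hf : ∀ x, f (N.mkQ x) = Ψ x := fun x => Submodule.liftQ_apply _ _ _
  have hrank : finrank K (B.flag j.succ ⧸ N) = 1 := by
    have h1 := N.finrank_quotient_add_finrank
    have h2 : finrank K N = j := by
      rw [(Submodule.submoduleOfEquivOfLe (B.mono (Fin.castSucc_lt_succ (i := j)).le)).finrank_eq,
        B.finrank_flag]
      rfl
    rw [h2, B.finrank_flag, Fin.val_succ] at h1
    omega
  have hsurj : Function.Surjective f := LinearMap.surjective (by
    intro h
    apply hΨ
    rw [← hf ⟨y, hy⟩, h, LinearMap.zero_apply])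
  have hinj : Function.Injective f :=
    (LinearMap.injective_iff_surjective_of_finrank_eq_finrank
      (by rw [hrank, finrank_self])).2 hsurj
  have hbij : Function.Bijective f := ⟨hinj, hsurj⟩
  refine degree_eq_neg_divDegree (LinearEquiv.ofBijective f hbij) _ D fun v q => ?_
  change _ ↔ v.LeOrd (D v) (f q)
  rw [← hD, mem_imageStalk]
  constructor
  · rintro ⟨x, hx, rfl⟩
    exact ⟨x, x.2, hx, (hf x).symm⟩
  · rintro ⟨x, hx, hxE, hxq⟩
    refine ⟨⟨x, hx⟩, hxE, hinj ?_⟩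
    rw [← hxq]
    exact hf ⟨x, hx⟩

end RankOne

/-! ### The Kostant section: cyclic vector, characteristic polynomial, invariant form. -/

section KostantAlgebra

variable {K : Type u} [Field K] {n : ℕ}

theorem coef_zero (c : Fin (2 * n + 1) → K) : coef c 0 = 0 := dif_neg (by omega)

theorem coef_one (c : Fin (2 * n + 1) → K) : coef c 1 = 0 := dif_neg (by omega)

theorem coef_of_lt (c : Fin (2 * n + 1) → K) {m : ℕ} (h : 2 * n + 2 < m) : coef c m = 0 :=
  dif_neg (by omega)

theorem coef_add_two (c : Fin (2 * n + 1) → K) (j : Fin (2 * n + 1)) : coef c (j + 2) = c j := by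
  rw [coef, dif_pos (by omega)]
  congr 1

/-- The entries of the Kostant section above the diagonal, in terms of a family of vectors. -/
def kostantCorr {W : Type*} [AddCommGroup W] [Module K W] (c : Fin (2 * n + 1) → K) (j : ℕ)
    (x : ℕ → W) : W :=
  if n + 1 ≤ j then
    coef c (2 * j - 2 * n) • x (2 * n + 1 - j) + (coef c (2 * j - 2 * n + 1) / 2) • x (2 * n - j) +
      (coef c (2 * j - 2 * n - 1) / 2) • x (2 * n + 2 - j)
  else 0

theorem kostant_apply (c : Fin (2 * n + 1) → K) (i j : Fin (2 * n + 2)) :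
    kostant c i j = (if (i : ℕ) = j + 1 then 1 else 0) -
      (if n + 1 ≤ (j : ℕ) then
        (if (i : ℕ) + j = 2 * n + 1 then coef c (2 * j - 2 * n) else 0) +
        (if (i : ℕ) + j = 2 * n then coef c (2 * j - 2 * n + 1) / 2 else 0) +
        (if (i : ℕ) + j = 2 * n + 2 then coef c (2 * j - 2 * n - 1) / 2 else 0) else 0) := by
  have hi := i.2
  have hj := j.2
  rw [kostant, Matrix.of_apply]
  by_cases h1 : (i : ℕ) = j + 1
  · rw [if_pos h1, if_pos h1]
    by_cases h2 : n + 1 ≤ (j : ℕ)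
    · rw [if_pos h2, if_neg (by omega), if_neg (by omega), if_neg (by omega)]; simp
    · rw [if_neg h2]; simp
  rw [if_neg h1, if_neg h1]
  by_cases h2 : n + 1 ≤ (j : ℕ)
  · rw [if_pos h2]
    by_cases h3 : (i : ℕ) + j = 2 * n + 1
    · rw [if_pos ⟨by omega, h2⟩, if_pos h3, if_pos h3, if_neg (by omega), if_neg (by omega),
        show (j : ℕ) - i + 1 = 2 * j - 2 * n by omega]
      simp
    by_cases h4 : (i : ℕ) + j = 2 * n
    · rw [if_pos ⟨by omega, h2⟩, if_neg h3, if_neg h3, if_pos (Or.inl h4), if_pos h4,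
        if_neg (by omega), show (j : ℕ) - i + 1 = 2 * j - 2 * n + 1 by omega]
      simp [neg_div]
    by_cases h5 : (i : ℕ) + j = 2 * n + 2
    · rw [if_neg h3, if_neg h4, if_pos h5]
      by_cases h6 : (i : ℕ) ≤ n
      · rw [if_pos ⟨h6, h2⟩, if_neg h3, if_pos (Or.inr h5),
          show (j : ℕ) - i + 1 = 2 * j - 2 * n - 1 by omega]
        simp [neg_div]
      -- Here i = j = n + 1 lies just outside the upper right block, and the formula agrees only
      -- because c_1 = 0.
      · rw [if_neg (by tauto), if_neg h3, show 2 * (j : ℕ) - 2 * n - 1 = 1 by omega, coef_one]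
        simp
    · rw [if_neg h3, if_neg h3, if_neg h4, if_neg h5, if_neg (not_or.2 ⟨h4, h5⟩)]
      simp
  · rw [if_neg h2, if_neg (by tauto)]
    simp

theorem sum_kostant_smul {W : Type*} [AddCommGroup W] [Module K W] (c : Fin (2 * n + 1) → K)
    (j : Fin (2 * n + 2)) (x : ℕ → W) :
    ∑ i, kostant c i j • x i = (if (j : ℕ) + 1 < 2 * n + 2 then x (j + 1) else 0) -
      kostantCorr c j x := by
  have hj := j.2
  have key : ∀ (m : ℕ) (a : K), ∑ i : Fin (2 * n + 2), (if (i : ℕ) = m then a else 0) • x i =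
      if m < 2 * n + 2 then a • x m else 0 := by
    intro m a
    split_ifs with h
    · rw [Finset.sum_eq_single (⟨m, h⟩ : Fin (2 * n + 2))]
      · simp
      · intro i _ hi
        rw [if_neg (fun h => hi (Fin.ext h)), zero_smul]
      · simp
    · refine Finset.sum_eq_zero fun i _ => ?_
      rw [if_neg (by omega), zero_smul]
  have key' : ∀ (m : ℕ) (a : K), j ≤ m → m - j < 2 * n + 2 →
      ∑ i : Fin (2 * n + 2), (if (i : ℕ) + j = m then a else 0) • x i = a • x (m - j) := by
    intro m a h h'
    have h1 : ∀ i : Fin (2 * n + 2), (i : ℕ) + j = m ↔ (i : ℕ) = m - j := fun i => by omega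
    simp only [h1]
    rw [key, if_pos h']
  simp only [kostant_apply, sub_smul, Finset.sum_sub_distrib]
  congr 1
  · rw [key]; simp
  · rw [kostantCorr]
    by_cases h : n + 1 ≤ (j : ℕ)
    · simp only [if_pos h, add_smul, Finset.sum_add_distrib]
      rw [key' (2 * n + 1) _ (by omega) (by omega), key' (2 * n + 2) _ (by omega) (by omega)]
      congr 2
      by_cases h' : (j : ℕ) ≤ 2 * n
      · exact key' _ _ h' (by omega)
      -- For j = 2n + 1 the index 2n - j is truncated, but its coefficient c_{2n+3} is zero.
      · rw [coef_of_lt c (m := 2 * (j : ℕ) - 2 * n + 1) (by omega)]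
        simp
    · simp only [if_neg h, zero_smul, Finset.sum_const_zero]

/-- The polynomials `P_j` such that `P_j(κ₁(c)) e₀ = e_j`. -/
def kostantPoly (c : Fin (2 * n + 1) → K) : ℕ → K[X]
  | 0 => 1
  | j + 1 => X * kostantPoly c j + kostantCorr c j (fun i => (X : K[X]) ^ i)

theorem kostantPoly_of_le (c : Fin (2 * n + 1) → K) {j : ℕ} (hj : j ≤ n + 1) :
    kostantPoly c j = X ^ j := by
  induction j with
  | zero => rw [kostantPoly, pow_zero]
  | succ j ih =>
    rw [kostantPoly, ih (by omega), kostantCorr, if_neg (by omega), add_zero, pow_succ']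

theorem natDegree_kostantPoly (c : Fin (2 * n + 1) → K) (j : ℕ) :
    (kostantPoly c j).natDegree ≤ j := by
  induction j with
  | zero => simp [kostantPoly]
  | succ j ih =>
    rw [kostantPoly]
    refine natDegree_add_le_of_degree_le ?_ ?_
    · refine natDegree_mul_le.trans ?_
      rw [natDegree_X]; omega
    · rw [kostantCorr]
      split_ifs with h
      · refine natDegree_add_le_of_degree_le (natDegree_add_le_of_degree_le ?_ ?_) ?_
        all_goals
          refine (natDegree_smul_le _ _).trans ((natDegree_X_pow_le _).trans (by omega))
      · simp

/-- Each odd coefficient occurs halved on two adjacent parallels of κ₁(c): one half enters at a step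
of the recursion, and the second half completes it at the next. The even coefficients enter at once.
For r = n + 1 no half is left over and the result is the characteristic polynomial. -/
theorem kostantPoly_eq (h2 : (2 : K) ≠ 0) (c : Fin (2 * n + 1) → K) {r : ℕ} (hr : r ≤ n + 1) :
    kostantPoly c (n + 1 + r) = X ^ (n + 1 + r) +
      ∑ m ∈ Finset.range (2 * r + 1), C (coef c m) * X ^ (n + 1 + r - m) +
      C (coef c (2 * r + 1) / 2) * X ^ (n - r) := by
  induction r with
  | zero => rw [kostantPoly_of_le c (by omega)]; simp [coef_zero, coef_one]
  | succ r ih =>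
    rw [← add_assoc, kostantPoly, ih (by omega), kostantCorr, if_pos (by omega)]
    simp only [smul_eq_C_mul]
    rw [show 2 * (r + 1) + 1 = 2 * r + 1 + 1 + 1 by ring,
      Finset.sum_range_succ _ (2 * r + 1 + 1), Finset.sum_range_succ _ (2 * r + 1), mul_add, mul_add, Finset.mul_sum]
    have h3 : ∀ m ∈ Finset.range (2 * r + 1), X * (C (coef c m) * X ^ (n + 1 + r - m)) =
        C (coef c m) * X ^ (n + 1 + r + 1 - m) := fun m hm => by
      rw [Finset.mem_range] at hm
      rw [show n + 1 + r + 1 - m = (n + 1 + r - m) + 1 by omega, pow_succ]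
      ring
    rw [Finset.sum_congr rfl h3, show 2 * (n + 1 + r) - 2 * n = 2 * r + 2 by omega,
      show 2 * r + 2 - 1 = 2 * r + 1 by omega, show 2 * n + 1 - (n + 1 + r) = n - r by omega,
      show 2 * n - (n + 1 + r) = n - (r + 1) by omega,
      show 2 * n + 2 - (n + 1 + r) = n - r + 1 by omega,
      show n + 1 + r + 1 - (2 * r + 1) = n - r + 1 by omega,
      show n + 1 + r + 1 - (2 * r + 1 + 1) = n - r by omega]
    have h4 : C (coef c (2 * r + 1)) = C (coef c (2 * r + 1) / 2) + C (coef c (2 * r + 1) / 2) := by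
      have : NeZero (2 : K) := ⟨h2⟩
      rw [← map_add, add_halves]
    rw [h4]
    ring

theorem kostantPoly_eq_invPoly (h2 : (2 : K) ≠ 0) (c : Fin (2 * n + 1) → K) :
    kostantPoly c (2 * n + 2) = invPoly c := by
  have h := kostantPoly_eq h2 c (r := n + 1) le_rfl
  rw [show n + 1 + (n + 1) = 2 * n + 2 by ring, coef_of_lt c (by omega), zero_div, map_zero,
    zero_mul, add_zero, show 2 * (n + 1) + 1 = 2 * n + 1 + 1 + 1 by ring, Finset.sum_range_succ',
    Finset.sum_range_succ', coef_zero, zero_add, coef_one, map_zero, zero_mul, add_zero, zero_mul,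
    add_zero, Finset.sum_range] at h
  rw [h, invPoly]
  congr 1
  refine Finset.sum_congr rfl fun j _ => ?_
  rw [add_assoc, coef_add_two]
  congr 2
  omega

theorem kostantCorr_map {W W' : Type*} [AddCommGroup W] [Module K W] [AddCommGroup W']
    [Module K W'] (c : Fin (2 * n + 1) → K) (j : ℕ) (x : ℕ → W) (f : W →ₗ[K] W') :
    f (kostantCorr c j x) = kostantCorr c j fun i => f (x i) := by
  rw [kostantCorr, kostantCorr]
  split_ifs <;> simp

theorem kostantCorr_congr {W : Type*} [AddCommGroup W] [Module K W] (c : Fin (2 * n + 1) → K)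
    (j : ℕ) {x y : ℕ → W} (h : ∀ i, i ≤ n + 1 → x i = y i) :
    kostantCorr c j x = kostantCorr c j y := by
  rw [kostantCorr, kostantCorr]
  split_ifs with hj
  · rw [h _ (by omega), h _ (by omega), h _ (by omega)]
  · rfl

section Vectors

variable {W : Type*} [AddCommGroup W] [Module K W]

/-- The vectors `P_j(s) w`. -/
def kostantVector (c : Fin (2 * n + 1) → K) (s : W →ₗ[K] W) (w : W) (j : ℕ) : W :=
  aeval s (kostantPoly c j) w

theorem kostantVector_of_le (c : Fin (2 * n + 1) → K) (s : W →ₗ[K] W) (w : W) {j : ℕ}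
    (hj : j ≤ n + 1) : kostantVector c s w j = (s ^ j) w := by
  rw [kostantVector, kostantPoly_of_le c hj, map_pow, aeval_X]

/-- The corrections only involve indices i ≤ n + 1, for which P_i = X^i, so the recursion for
polynomials becomes one for the vectors themselves. -/
theorem kostantVector_succ (c : Fin (2 * n + 1) → K) (s : W →ₗ[K] W) (w : W) (j : ℕ) :
    kostantVector c s w (j + 1) =
      s (kostantVector c s w j) + kostantCorr c j (kostantVector c s w) := by
  rw [kostantVector, kostantPoly, map_add, map_mul, aeval_X, LinearMap.add_apply]
  congr 1
  have := kostantCorr_map c j (fun i => (X : K[X]) ^ i)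
    ((LinearMap.applyₗ w).comp (aeval s).toLinearMap)
  refine this.trans (kostantCorr_congr c j fun i hi => ?_)
  rw [kostantVector_of_le c s w hi]
  simp

/-- The linear map which takes the standard basis to the vectors `P_j(s) w`. -/
def kostantMap (c : Fin (2 * n + 1) → K) (s : W →ₗ[K] W) (w : W) :
    (Fin (2 * n + 2) → K) →ₗ[K] W :=
  Fintype.linearCombination K fun j : Fin (2 * n + 2) => kostantVector c s w j

theorem kostantMap_single (c : Fin (2 * n + 1) → K) (s : W →ₗ[K] W) (w : W)
    (j : Fin (2 * n + 2)) : kostantMap c s w (Pi.single j 1) = kostantVector c s w j := by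
  rw [kostantMap, Fintype.linearCombination_apply_single, one_smul]

/-- Column j of κ₁(c) is the recursion for P_j(s) w. The last column needs P_{2n+2}(s) w = 0, which
is `hw`. -/
theorem kostantMap_comp (h2 : (2 : K) ≠ 0) (c : Fin (2 * n + 1) → K) (s : W →ₗ[K] W) (w : W)
    (hw : aeval s (invPoly c) w = 0) (x : Fin (2 * n + 2) → K) :
    kostantMap c s w (Matrix.toLin' (kostant c) x) = s (kostantMap c s w x) := by
  have : kostantMap c s w ∘ₗ Matrix.toLin' (kostant c) = s ∘ₗ kostantMap c s w := by
    refine (Pi.basisFun K _).ext fun j => ?_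
    rw [Pi.basisFun_apply, LinearMap.comp_apply, LinearMap.comp_apply, kostantMap_single,
      Matrix.toLin'_apply, Matrix.mulVec_single_one, kostantMap, Fintype.linearCombination_apply]
    simp only [Matrix.col_apply]
    rw [sum_kostant_smul c j (kostantVector c s w), sub_eq_iff_eq_add, ← kostantVector_succ]
    split_ifs with h
    · rfl
    · rw [show (j : ℕ) + 1 = 2 * n + 2 by omega, kostantVector, kostantPoly_eq_invPoly h2, hw]
  exact LinearMap.congr_fun this x

end Vectors

/-- The Kostant section as an operator. -/
abbrev kostantOp (c : Fin (2 * n + 1) → K) : (Fin (2 * n + 2) → K) →ₗ[K] (Fin (2 * n + 2) → K) :=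
  Matrix.toLin' (kostant c)

theorem kostantOp_single (c : Fin (2 * n + 1) → K) (j : Fin (2 * n + 2)) (u : ℕ → Fin (2 * n + 2) → K)
    (hu : ∀ i : Fin (2 * n + 2), u i = Pi.single i 1) :
    kostantOp c (Pi.single j 1) =
      (if (j : ℕ) + 1 < 2 * n + 2 then u (j + 1) else 0) - kostantCorr c j u := by
  rw [← sum_kostant_smul, Matrix.toLin'_apply, Matrix.mulVec_single_one]
  simp only [hu]
  conv_lhs => rw [← (Pi.basisFun K (Fin (2 * n + 2))).sum_repr ((kostant c).col j)]
  simp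

/-- Column j expresses e_{j+1} through κ₁(c) e_j and basis vectors of index at most j, by the same
recursion that defines P_{j+1}. -/
theorem kostantVector_kostantOp (c : Fin (2 * n + 1) → K) (j : Fin (2 * n + 2)) :
    kostantVector c (kostantOp c) (Pi.single 0 1) j = Pi.single j 1 := by
  obtain ⟨u, hu⟩ : ∃ u : ℕ → Fin (2 * n + 2) → K, ∀ i : Fin (2 * n + 2), u i = Pi.single i 1 :=
    ⟨fun i => if h : i < 2 * n + 2 then Pi.single ⟨i, h⟩ 1 else 0, fun i => by simp⟩
  obtain ⟨j, hj⟩ := j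
  induction j using Nat.strong_induction_on with
  | _ j ih =>
    rcases j with _ | j
    · simp [kostantVector, kostantPoly]
    · change kostantVector c _ _ (j + 1) = _
      rw [kostantVector_succ]
      have h1 := ih j (by omega) (by omega)
      simp only at h1
      rw [h1, kostantOp_single c _ u hu, if_pos (by simpa using hj), ← hu ⟨j + 1, hj⟩]
      simp only
      rw [kostantCorr, kostantCorr]
      split_ifs with h
      · have h3 : ∀ i, i ≤ j → kostantVector c (kostantOp c) (Pi.single 0 1) i = u i := fun i hi =>
          (ih i (by omega) (by omega)).trans (hu ⟨i, by omega⟩).symm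
        rw [h3 _ (by omega), h3 _ (by omega), h3 _ (by omega)]
        abel
      · abel

theorem aeval_invPoly_kostantOp (h2 : (2 : K) ≠ 0) (c : Fin (2 * n + 1) → K) :
    aeval (kostantOp c) (invPoly c) (Pi.single 0 1) = 0 := by
  obtain ⟨u, hu⟩ : ∃ u : ℕ → Fin (2 * n + 2) → K, ∀ i : Fin (2 * n + 2), u i = Pi.single i 1 :=
    ⟨fun i => if h : i < 2 * n + 2 then Pi.single ⟨i, h⟩ 1 else 0, fun i => by simp⟩
  rw [← kostantPoly_eq_invPoly h2]
  change kostantVector c _ _ (2 * n + 1 + 1) = 0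
  rw [kostantVector_succ]
  have h1 := kostantVector_kostantOp c (Fin.last (2 * n + 1))
  rw [Fin.val_last] at h1
  rw [h1, kostantOp_single c _ u hu, if_neg (by simp), zero_sub, Fin.val_last]
  rw [kostantCorr_congr c (2 * n + 1) (x := kostantVector c _ _) (y := u) fun i hi =>
    (kostantVector_kostantOp c ⟨i, by omega⟩).trans (hu ⟨i, by omega⟩).symm]
  exact neg_add_cancel _

/-- `e₀` is a cyclic vector. -/
theorem exists_aeval_kostantOp (c : Fin (2 * n + 1) → K) (x : Fin (2 * n + 2) → K) :
    ∃ f : K[X], f.degree < (2 * n + 2 : ℕ) ∧ aeval (kostantOp c) f (Pi.single 0 1) = x := by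
  refine ⟨∑ j : Fin (2 * n + 2), C (x j) * kostantPoly c j, ?_, ?_⟩
  · refine lt_of_le_of_lt (degree_sum_le _ _) ?_
    rw [Finset.sup_lt_iff (WithBot.bot_lt_coe _)]
    intro j _
    refine lt_of_le_of_lt ((degree_mul_le _ _).trans (add_le_add_left degree_C_le _) |>.trans (zero_add _).le) (lt_of_le_of_lt degree_le_natDegree ?_)
    exact_mod_cast lt_of_le_of_lt (natDegree_kostantPoly c j) j.2
  · rw [map_sum, LinearMap.sum_apply]
    conv_rhs => rw [← (Pi.basisFun K (Fin (2 * n + 2))).sum_repr x]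
    refine Finset.sum_congr rfl fun j _ => ?_
    rw [map_mul, aeval_C, Pi.basisFun_apply, Pi.basisFun_repr, ← kostantVector_kostantOp c j]
    rfl

/-- Evaluation at the cyclic vector maps polynomials of degree < 2n+2 onto a space of the same
dimension, so it is injective. This yields the characteristic polynomial: its difference with
`invPoly c` has lower degree and kills e_0. -/
theorem eq_zero_of_aeval_kostantOp (c : Fin (2 * n + 1) → K) {f : K[X]}
    (hf : f.degree < (2 * n + 2 : ℕ)) (h : aeval (kostantOp c) f (Pi.single 0 1) = 0) : f = 0 := by
  let g : degreeLT K (2 * n + 2) →ₗ[K] (Fin (2 * n + 2) → K) :=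
    ((LinearMap.applyₗ (Pi.single 0 1)).comp (aeval (kostantOp c)).toLinearMap).comp
      (degreeLT K (2 * n + 2)).subtype
  have hsurj : Function.Surjective g := fun x => by
    obtain ⟨f, hf, hx⟩ := exists_aeval_kostantOp c x
    exact ⟨⟨f, mem_degreeLT.2 hf⟩, hx⟩
  have hinj : Function.Injective g := by
    have e := degreeLTEquiv K (2 * n + 2)
    have : Module.Finite K (degreeLT K (2 * n + 2)) := Module.Finite.equiv e.symm
    exact (LinearMap.injective_iff_surjective_of_finrank_eq_finrank e.finrank_eq).2 hsurj
  have : (⟨f, mem_degreeLT.2 hf⟩ : degreeLT K (2 * n + 2)) = 0 := hinj (by rw [map_zero]; exact h)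
  exact congrArg Subtype.val this

theorem invPoly_sub_degree (c : Fin (2 * n + 1) → K) :
    (invPoly c - X ^ (2 * n + 2) : K[X]).degree < ((2 * n + 2 : ℕ) : WithBot ℕ) := by
  rw [invPoly, add_sub_cancel_left]
  refine lt_of_le_of_lt (degree_sum_le _ _) ?_
  rw [Finset.sup_lt_iff (WithBot.bot_lt_coe _)]
  intro j _
  refine lt_of_le_of_lt (degree_C_mul_X_pow_le _ _) ?_
  exact_mod_cast (by omega : 2 * n - (j : ℕ) < 2 * n + 2)

theorem invPoly_monic (c : Fin (2 * n + 1) → K) : (invPoly c).Monic := by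
  have := monic_X_pow_add (n := 2 * n + 2) (p := invPoly c - X ^ (2 * n + 2))
    (invPoly_sub_degree c)
  rwa [add_sub_cancel] at this

theorem invPoly_natDegree (c : Fin (2 * n + 1) → K) : (invPoly c).natDegree = 2 * n + 2 := by
  have h := degree_add_eq_left_of_degree_lt
    ((invPoly_sub_degree c).trans_eq (degree_X_pow (R := K) (2 * n + 2)).symm)
  rw [add_sub_cancel, degree_X_pow] at h
  exact natDegree_eq_of_degree_eq_some h

theorem charpoly_kostantOp (h2 : (2 : K) ≠ 0) (c : Fin (2 * n + 1) → K) :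
    (kostantOp c).charpoly = invPoly c := by
  rw [← sub_eq_zero]
  refine eq_zero_of_aeval_kostantOp c ?_ ?_
  · have h1 : (kostantOp c).charpoly.natDegree = 2 * n + 2 := by
      rw [LinearMap.charpoly_natDegree]; simp
    have h3 := degree_sub_lt_left (p := (kostantOp c).charpoly) (q := invPoly c) (by
      rw [degree_eq_natDegree (LinearMap.charpoly_monic _).ne_zero,
        degree_eq_natDegree (invPoly_monic c).ne_zero, h1, invPoly_natDegree])
      (LinearMap.charpoly_monic _).ne_zero (by
      rw [(LinearMap.charpoly_monic _).leadingCoeff, (invPoly_monic c).leadingCoeff])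
    rwa [degree_eq_natDegree (LinearMap.charpoly_monic _).ne_zero, h1] at h3
  · rw [map_sub, LinearMap.aeval_self_charpoly, LinearMap.sub_apply, aeval_invPoly_kostantOp h2]
    simp

theorem invPoly_coeff (c : Fin (2 * n + 1) → K) (j : Fin (2 * n + 1)) :
    (invPoly c).coeff (2 * n - j) = c j := by
  rw [invPoly, coeff_add, coeff_X_pow, if_neg (by omega), zero_add, finsetSum_coeff,
    Finset.sum_eq_single j]
  · simp
  · intro i _ hi
    rw [coeff_C_mul, coeff_X_pow, if_neg, mul_zero]
    intro h
    exact hi (Fin.ext (by omega))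
  · simp

theorem invPoly_injective : Function.Injective (invPoly : (Fin (2 * n + 1) → K) → K[X]) := by
  intro c c' h
  funext j
  rw [← invPoly_coeff c j, h, invPoly_coeff]

theorem invPoly_coeff_of_lt (c : Fin (2 * n + 1) → K) : (invPoly c).coeff (2 * n + 1) = 0 := by
  rw [invPoly, coeff_add, coeff_X_pow, if_neg (by omega), zero_add, finsetSum_coeff]
  refine Finset.sum_eq_zero fun j _ => ?_
  rw [coeff_C_mul, coeff_X_pow, if_neg (by omega), mul_zero]

theorem eq_invPoly {f : K[X]} (hf : f.Monic) (hdeg : f.natDegree = 2 * n + 2)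
    (h : f.coeff (2 * n + 1) = 0) :
    f = invPoly fun j : Fin (2 * n + 1) => f.coeff (2 * n - j) := by
  ext m
  rcases lt_trichotomy m (2 * n + 2) with hm | rfl | hm
  · rcases Nat.lt_or_ge m (2 * n + 1) with hm' | hm'
    · have h1 := invPoly_coeff (fun j : Fin (2 * n + 1) => f.coeff (2 * n - j))
        ⟨2 * n - m, by omega⟩
      simp only [show 2 * n - (2 * n - m) = m by omega] at h1
      exact h1.symm
    · rw [show m = 2 * n + 1 by omega, h, invPoly_coeff_of_lt]
  · have h1 := (invPoly_monic fun j : Fin (2 * n + 1) => f.coeff (2 * n - j)).coeff_natDegree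
    rw [invPoly_natDegree] at h1
    rw [h1, ← hdeg, hf.coeff_natDegree]
  · rw [coeff_eq_zero_of_natDegree_lt (by omega),
      coeff_eq_zero_of_natDegree_lt (by rw [invPoly_natDegree]; exact hm)]

/-- Symmetry under reflection in the antidiagonal is self-adjointness for the antidiagonal form. -/
theorem kostant_rev (c : Fin (2 * n + 1) → K) (i j : Fin (2 * n + 2)) :
    kostant c (Fin.rev j) (Fin.rev i) = kostant c i j := by
  have hi := i.2
  have hj := j.2
  simp only [kostant, Matrix.of_apply, Fin.val_rev]
  have e1 : (2 * n + 2 - ((j : ℕ) + 1) = 2 * n + 2 - (i + 1) + 1) ↔ (i : ℕ) = j + 1 := by omega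
  have e2 : (2 * n + 2 - ((j : ℕ) + 1) ≤ n ∧ n + 1 ≤ 2 * n + 2 - ((i : ℕ) + 1)) ↔
      ((i : ℕ) ≤ n ∧ n + 1 ≤ (j : ℕ)) := by omega
  have e3 : (2 * n + 2 - ((j : ℕ) + 1) + (2 * n + 2 - (i + 1)) = 2 * n + 1) ↔
      (i : ℕ) + j = 2 * n + 1 := by omega
  have e4 : (2 * n + 2 - ((j : ℕ) + 1) + (2 * n + 2 - (i + 1)) = 2 * n ∨
      2 * n + 2 - ((j : ℕ) + 1) + (2 * n + 2 - (i + 1)) = 2 * n + 2) ↔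
      ((i : ℕ) + j = 2 * n ∨ (i : ℕ) + j = 2 * n + 2) := by omega
  have e5 : 2 * n + 2 - ((i : ℕ) + 1) - (2 * n + 2 - (j + 1)) + 1 = j - i + 1 := by omega
  simp only [e1, e2, e3, e4, e5]

theorem antidiag_kostantOp (c : Fin (2 * n + 1) → K) (x y : Fin (2 * n + 2) → K) :
    Matrix.toBilin' (antidiag K (2 * n + 2)) (kostantOp c x) y =
      Matrix.toBilin' (antidiag K (2 * n + 2)) x (kostantOp c y) := by
  simp only [antidiag_apply, Matrix.toLin'_apply, Matrix.mulVec, dotProduct, Finset.sum_mul,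
    Finset.mul_sum]
  rw [Finset.sum_comm]
  refine Finset.sum_congr rfl fun j _ => ?_
  rw [← Equiv.sum_comp Fin.revPerm]
  refine Finset.sum_congr rfl fun i _ => ?_
  rw [Fin.revPerm_apply, Fin.rev_rev, ← kostant_rev c (Fin.rev i) j, Fin.rev_rev]
  ring

theorem kostant_hessenberg (c : Fin (2 * n + 1) → K) {i j : Fin (2 * n + 2)}
    (h : (j : ℕ) + 1 < i) : kostant c i j = 0 := by
  rw [kostant, Matrix.of_apply, if_neg (by omega), if_neg (by omega)]

/-- κ₁(c) is lower Hessenberg with ones below the diagonal, so T^i e_0 is e_i plus a combination of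
earlier basis vectors. For m = 2n+1 this computes (T^i e_0, e_0). -/
theorem kostantOp_pow (c : Fin (2 * n + 1) → K) (i : ℕ) (m : Fin (2 * n + 2)) (h : i ≤ m) :
    ((kostantOp c) ^ i) (Pi.single 0 1) m = if (m : ℕ) = i then 1 else 0 := by
  induction i generalizing m with
  | zero =>
    rw [pow_zero, Module.End.one_apply, Pi.single_apply]
    simp only [Fin.ext_iff]
    rfl
  | succ i ih =>
    rw [pow_succ', Module.End.mul_apply, Matrix.toLin'_apply, Matrix.mulVec, dotProduct]
    have hm := m.2
    rw [Finset.sum_eq_single (⟨(m : ℕ) - 1, by omega⟩ : Fin (2 * n + 2))]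
    · rw [ih _ (by simp; omega)]
      have : kostant c m ⟨(m : ℕ) - 1, by omega⟩ = 1 := by
        rw [kostant, Matrix.of_apply, if_pos (by simp; omega)]
      rw [this, one_mul]
      congr 1
      simp only [eq_iff_iff]
      omega
    · intro j _ hj
      rcases lt_or_ge ((j : ℕ) + 1) m with h' | h'
      · rw [kostant_hessenberg c h', zero_mul]
      · have : (j : ℕ) ≠ m - 1 := fun h => hj (Fin.ext h)
        rw [ih j (by omega), if_neg (by omega), mul_zero]
    · simp

/-- A form for which `κ₁(c)` is self-adjoint is determined by its values on `(T^i e₀, e₀)`. -/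
theorem eq_antidiag_of_selfAdjoint (c : Fin (2 * n + 1) → K)
    (β : LinearMap.BilinForm K (Fin (2 * n + 2) → K)) (l : K)
    (hβ : ∀ x y, β (kostantOp c x) y = β x (kostantOp c y))
    (h : ∀ i, i ≤ 2 * n → β (((kostantOp c) ^ i) (Pi.single 0 1)) (Pi.single 0 1) = 0)
    (hl : β (((kostantOp c) ^ (2 * n + 1)) (Pi.single 0 1)) (Pi.single 0 1) = l) :
    β = l • Matrix.toBilin' (antidiag K (2 * n + 2)) := by
  rw [← sub_eq_zero]
  set γ := β - l • Matrix.toBilin' (antidiag K (2 * n + 2)) with hγ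
  have hsa : ∀ x y, γ (kostantOp c x) y = γ x (kostantOp c y) := fun x y => by
    simp only [hγ, LinearMap.sub_apply, LinearMap.smul_apply, hβ, antidiag_kostantOp]
  -- Every vector is f(T) e_0, and polynomials in T move across the form, so it suffices that γ
  -- vanishes on all pairs (x, e_0).
  have hpoly : ∀ (f : K[X]) x y, γ (aeval (kostantOp c) f x) y = γ x (aeval (kostantOp c) f y) := by
    intro f
    induction f using Polynomial.induction_on' with
    | add f g hf hg => intro x y; simp only [map_add, LinearMap.add_apply, hf, hg]
    | monomial j a =>
      intro x y
      simp only [aeval_monomial, Module.End.mul_apply, Module.algebraMap_end_apply, map_smul,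
        LinearMap.smul_apply]
      congr 1
      induction j generalizing x y with
      | zero => simp
      | succ j ih => rw [pow_succ, Module.End.mul_apply, ih, hsa, ← Module.End.mul_apply, ← pow_succ', pow_succ]
  have h0 : ∀ x, γ x (Pi.single 0 1) = 0 := by
    intro x
    obtain ⟨f, hf, rfl⟩ := exists_aeval_kostantOp c x
    have hf' : f.natDegree < 2 * n + 2 := by
      rcases eq_or_ne f 0 with rfl | h'
      · simp
      · exact (natDegree_lt_iff_degree_lt h').2 hf
    rw [aeval_eq_sum_range' hf', LinearMap.sum_apply, map_sum,
      LinearMap.sum_apply]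
    refine Finset.sum_eq_zero fun i hi => ?_
    rw [LinearMap.smul_apply, map_smul, LinearMap.smul_apply]
    have : γ (((kostantOp c) ^ i) (Pi.single 0 1)) (Pi.single 0 1) = 0 := by
      rw [Finset.mem_range] at hi
      simp only [hγ, LinearMap.sub_apply, LinearMap.smul_apply]
      have h3 : Matrix.toBilin' (antidiag K (2 * n + 2)) (((kostantOp c) ^ i) (Pi.single 0 1))
          (Pi.single 0 1) = ((kostantOp c) ^ i) (Pi.single 0 1) (Fin.last (2 * n + 1)) := by
        rw [antidiag_apply, Finset.sum_eq_single (Fin.last (2 * n + 1))]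
        · simp
        · intro m _ hm
          rw [Pi.single_eq_of_ne, mul_zero]
          intro h
          exact hm (by rw [← Fin.rev_rev m, h, Fin.rev_zero])
        · simp
      rw [h3, kostantOp_pow c i _ (by simp; omega), Fin.val_last]
      split_ifs with h4
      · rw [← h4, hl]; simp
      · rw [h i (by omega)]; simp
    rw [this, smul_zero]
  ext x y
  simp only [LinearMap.coe_comp, LinearMap.coe_single, Function.comp_apply, LinearMap.zero_apply]
  obtain ⟨f, _, hf⟩ := exists_aeval_kostantOp c (Pi.single y 1)
  rw [← hf, ← hpoly, h0]

end KostantAlgebra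

/-! ### Self-adjoint operators with separable characteristic polynomial. -/

section SeparableOperators

variable {K : Type u} [Field K]

theorem separable_iff_discr {f : K[X]} (hf : f.Monic) (h0 : 0 < f.natDegree) :
    f.Separable ↔ f.discr ≠ 0 := by
  have h1 := resultant_deriv (natDegree_pos_iff_degree_pos.1 h0)
  -- `resultant_deriv` uses the formal degree deg f - 1 for the derivative, whose degree may be
  -- smaller in positive characteristic. The change costs a power of the leading coefficient, here
  -- 1.
  obtain ⟨j, hj⟩ := Nat.exists_eq_add_of_le (natDegree_derivative_le f)
  rw [hj, resultant_add_right_deg _ _ _ _ _ le_rfl, hf.coeff_natDegree, one_pow, one_mul,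
    hf.leadingCoeff, mul_one] at h1
  have h2 : f.discr ≠ 0 ↔ resultant f (derivative f) ≠ 0 := by
    rw [h1, not_iff_not]
    simp
  rw [h2, Ne, resultant_eq_zero_iff, Separable]
  simp [hf.ne_zero]

variable {V : Type w} [AddCommGroup V] [Module K V]

/-- Apply the linear factors of f to w one after the other: the last nonzero vector is an
eigenvector in the cyclic space of w. -/
theorem exists_eigenvector_of_aeval (s : Module.End K V) {w : V} (hw : w ≠ 0) {f : K[X]}
    (hf : f.Splits) (hf0 : f ≠ 0) (h : aeval s f w = 0) :
    ∃ (g : K[X]) (a : K), aeval s g w ≠ 0 ∧ s (aeval s g w) = a • aeval s g w := by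
  have h1 : ∀ (m : Multiset K) (w : V), w ≠ 0 → aeval s (m.map fun a => X - C a).prod w = 0 →
      ∃ (g : K[X]) (a : K), aeval s g w ≠ 0 ∧ s (aeval s g w) = a • aeval s g w := by
    intro m
    induction m using Multiset.induction_on with
    | empty => intro w hw h; exact absurd (by simpa using h) hw
    | cons a m ih =>
      intro w hw h
      by_cases h2 : aeval s (X - C a) w = 0
      · refine ⟨1, a, by simpa using hw, ?_⟩
        rw [map_sub, aeval_X, aeval_C, LinearMap.sub_apply, Module.algebraMap_end_apply,
          sub_eq_zero] at h2
        simpa using h2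
      · rw [Multiset.map_cons, Multiset.prod_cons, mul_comm, map_mul, Module.End.mul_apply] at h
        obtain ⟨g, b, hg, hb⟩ := ih _ h2 h
        refine ⟨g * (X - C a), b, ?_, ?_⟩
        · rwa [map_mul, Module.End.mul_apply]
        · rwa [map_mul, Module.End.mul_apply]
  refine h1 f.roots w hw ?_
  rw [hf.eq_prod_roots, map_mul, aeval_C, Module.End.mul_apply, Module.algebraMap_end_apply,
    smul_eq_zero] at h
  exact h.resolve_left (leadingCoeff_ne_zero.2 hf0)

theorem aeval_selfAdjoint {s : Module.End K V} {q : LinearMap.BilinForm K V}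
    (hs : ∀ x y, q (s x) y = q x (s y)) (f : K[X]) (x y : V) :
    q (aeval s f x) y = q x (aeval s f y) := by
  induction f using Polynomial.induction_on' generalizing x y with
  | add f g hf hg => simp only [map_add, LinearMap.add_apply, hf, hg]
  | monomial j a =>
    simp only [aeval_monomial, Module.End.mul_apply, Module.algebraMap_end_apply, map_smul,
      LinearMap.smul_apply]
    congr 1
    induction j generalizing x y with
    | zero => simp
    | succ j ih => rw [pow_succ, Module.End.mul_apply, ih, hs, ← Module.End.mul_apply, ← pow_succ',
        pow_succ]

variable [Module.Finite K V]

theorem finrank_eigenspace_of_separable {s : Module.End K V} (hs : s.charpoly.Separable) (a : K) :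
    finrank K (s.eigenspace a) ≤ 1 := by
  refine (LinearMap.finrank_eigenspace_le s a).trans ?_
  have := rootMultiplicity_le_one_of_separable hs a
  exact this

/-- A vector whose cyclic subspace is isotropic for a self-adjoint operator with separable
characteristic polynomial is zero. -/
theorem eq_zero_of_isotropic_of_splits {s : Module.End K V} {q : LinearMap.BilinForm K V}
    (hsep : s.charpoly.Separable) (hsplit : s.charpoly.Splits)
    (hs : ∀ x y, q (s x) y = q x (s y)) (hq : ∀ x, (∀ y, q x y = 0) → x = 0) {w : V}
    (hw : ∀ f : K[X], q (aeval s f w) w = 0) : w = 0 := by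
  by_contra h0
  obtain ⟨g, a, hg, ha⟩ := exists_eigenvector_of_aeval s h0 hsplit
    (LinearMap.charpoly_monic s).ne_zero (by rw [LinearMap.aeval_self_charpoly]; rfl)
  set u := aeval s g w with hu
  have huu : q u u = 0 := by
    rw [hu, ← aeval_selfAdjoint hs, ← Module.End.mul_apply, ← map_mul]
    exact hw _
  have hroot : s.charpoly.IsRoot a := by
    rw [← Module.End.hasEigenvalue_iff_isRoot_charpoly]
    exact Module.End.hasEigenvalue_of_hasEigenvector
      ⟨Module.End.mem_eigenspace_iff.2 ha, hg⟩
  -- With f = charpoly / (X - a), f(s) maps V into the eigenline of u, and f(s) u = f(a) u with f(a)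
  -- ≠ 0. Hence f(a) (u, y) = (u, f(s) y) is a multiple of (u, u) = 0, and u lies in the radical.
  obtain ⟨f, hf⟩ := dvd_iff_isRoot.2 hroot
  have hfa : f.eval a ≠ 0 := by
    intro h
    obtain ⟨f', hf'⟩ := dvd_iff_isRoot.2 (show f.IsRoot a from h)
    have h2 := (Polynomial.Separable.squarefree hsep) (X - C a) ⟨f', by rw [hf, hf']; ring⟩
    exact not_isUnit_X_sub_C a h2
  have hfu : aeval s f u = f.eval a • u :=
    Module.End.aeval_apply_of_hasEigenvector ⟨Module.End.mem_eigenspace_iff.2 ha, hg⟩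
  refine hg (hq u fun y => ?_)
  have h3 : aeval s f y ∈ s.eigenspace a := by
    rw [Module.End.mem_eigenspace_iff]
    have h4 : aeval s s.charpoly y = 0 := by rw [LinearMap.aeval_self_charpoly]; rfl
    rw [hf, map_mul, Module.End.mul_apply, map_sub, aeval_X, aeval_C, LinearMap.sub_apply,
      Module.algebraMap_end_apply, sub_eq_zero] at h4
    exact h4
  obtain ⟨c, hc⟩ := (finrank_le_one_iff.1 (finrank_eigenspace_of_separable hsep a))
  obtain ⟨r, hr⟩ := hc ⟨u, Module.End.mem_eigenspace_iff.2 ha⟩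
  obtain ⟨t, ht⟩ := hc ⟨_, h3⟩
  have hr0 : r ≠ 0 := by
    rintro rfl
    rw [zero_smul] at hr
    exact hg (congrArg Subtype.val hr).symm
  have h5 : aeval s f y = (t * r⁻¹) • u := by
    have hr' : r • (c : V) = u := congrArg Subtype.val hr
    have ht' : t • (c : V) = aeval s f y := congrArg Subtype.val ht
    rw [← hr', ← ht', smul_smul, inv_mul_cancel_right₀ hr0]
  have h6 : f.eval a * q u y = 0 := by
    rw [← smul_eq_mul, ← LinearMap.smul_apply, ← map_smul, ← hfu, aeval_selfAdjoint hs, h5,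
      map_smul, huu, smul_zero]
  exact (mul_eq_zero.1 h6).resolve_left hfa

-- All hypotheses survive base change to an algebraic closure, where the polynomial splits;
-- nondegeneracy is carried over by the Gram determinant.
open TensorProduct in
theorem eq_zero_of_isotropic {s : Module.End K V} {q : LinearMap.BilinForm K V}
    (hsep : s.charpoly.Separable)
    (hs : ∀ x y, q (s x) y = q x (s y)) (hq : q.Nondegenerate) {w : V}
    (hw : ∀ i, q ((s ^ i) w) w = 0) : w = 0 := by
  let Ω := AlgebraicClosure K
  have key : (1 : Ω) ⊗ₜ[K] w = 0 := by
    refine eq_zero_of_isotropic_of_splits (s := s.baseChange Ω) (q := q.baseChange Ω) ?_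
      (IsAlgClosed.splits _) ?_ ?_ ?_
    · rw [LinearMap.charpoly_baseChange]
      exact hsep.map
    · intro x y
      induction x with
      | zero => simp
      | add x x' hx hx' => simp only [map_add, LinearMap.add_apply, hx, hx']
      | tmul a x =>
        induction y with
        | zero => simp
        | add x x' hx hx' => simp only [map_add, hx, hx']
        | tmul b y =>
          rw [LinearMap.baseChange_tmul, LinearMap.baseChange_tmul,
            LinearMap.BilinForm.baseChange_tmul, LinearMap.BilinForm.baseChange_tmul, hs]
    · have b := finBasis K V
      have hdet : (LinearMap.BilinForm.toMatrix b q).det ≠ 0 := by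
        rw [← LinearMap.BilinForm.nondegenerate_iff_det_ne_zero b]
        exact hq
      have hdet' : (LinearMap.BilinForm.toMatrix (b.baseChange Ω) (q.baseChange Ω)).det ≠ 0 := by
        have : LinearMap.BilinForm.toMatrix (b.baseChange Ω) (q.baseChange Ω) =
            (LinearMap.BilinForm.toMatrix b q).map (algebraMap K Ω) := by
          ext i j
          rw [LinearMap.BilinForm.toMatrix_apply, Basis.baseChange_apply, Basis.baseChange_apply,
            LinearMap.BilinForm.baseChange_tmul, Matrix.map_apply,
            LinearMap.BilinForm.toMatrix_apply, mul_one, Algebra.algebraMap_eq_smul_one]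
        rw [this, ← RingHom.mapMatrix_apply, ← RingHom.map_det]
        simpa using hdet
      rw [← LinearMap.BilinForm.nondegenerate_iff_det_ne_zero] at hdet'
      exact fun x hx => hdet'.1 x hx
    · intro f
      rw [aeval_eq_sum_range, LinearMap.sum_apply, map_sum, LinearMap.sum_apply]
      refine Finset.sum_eq_zero fun i _ => ?_
      rw [LinearMap.smul_apply, map_smul, LinearMap.smul_apply, ← LinearMap.baseChange_pow,
        LinearMap.baseChange_tmul, LinearMap.BilinForm.baseChange_tmul, hw]
      simp
  exact (Module.FaithfullyFlat.one_tmul_eq_zero_iff K V w).1 key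

end SeparableOperators

/-! ### Vanishing of pairings along the canonical flag by degree. -/

section Reduction

variable {k K : Type u} [Field k] [Field K] [Algebra k K] [hC : Fact (IsCurveFunctionField k K)]
  {n : ℕ} {W : Type w} [AddCommGroup W] [Module K W]

theorem VecBundle.smul_mem (E : VecBundle k K W) {v : Place k K} {a : K} {y : W}
    (ha : v.LeOrd 0 a) (hy : y ∈ E.stalk v) : a • y ∈ E.stalk v :=
  (E.stalk v).smul_mem (⟨a, (v.leOrd_zero_iff a).1 ha⟩ : v.ring) hy

theorem Place.leOrd_smul_iff (v : Place k K) (m : ℤ) (a : K) (y : Kˣ) :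
    v.LeOrd m (a * y) ↔ v.LeOrd (m - v.ord y) a := by
  rw [← v.leOrd_mul_unit (m - v.ord y) a y, sub_add_cancel]

/-- If y is in the radical, perfectness puts the whole line K y into a stalk, which is bounded. -/
theorem GSOBundle.nondegenerate (A : GSOBundle k K n W) : A.q.Nondegenerate := by
  have hrefl : A.q.IsRefl := fun x y h => by rw [A.symm, h]
  refine hrefl.nondegenerate_iff_separatingRight.2 fun y hy => ?_
  by_contra h0
  obtain ⟨v⟩ := (inferInstance : Nonempty (Place k K))
  obtain ⟨Ψ, hΨ⟩ := Module.Projective.exists_dual_ne_zero K h0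
  obtain ⟨D, hD⟩ := exists_divisor_imageStalk A.E ⊤ Ψ (y := y) trivial hΨ
  have h1 : ∀ a : K, a • y ∈ A.E.stalk v := fun a => by
    rw [A.perfect]
    intro x _
    rw [map_smul, hy, smul_zero]
    exact zero_mem _
  obtain ⟨z, hz⟩ := v.exists_ord_eq (D v - v.ord (Units.mk0 _ hΨ) - 1)
  have h2 := (hD v _).1 (mem_imageStalk.2 ⟨(z : K) • y, trivial, h1 z, rfl⟩)
  rw [map_smul, smul_eq_mul, show (z : K) * Ψ y = ((z * Units.mk0 _ hΨ : Kˣ) : K) from rfl,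
    v.leOrd_iff, v.ord_mul, hz] at h2
  omega

/-- Twisting by a section of the inverse of `F` makes `s` act on the stalks. -/
theorem IsSection.smul_mem {A : GSOBundle k K n W} {F : LineBundle k K} {s : W →ₗ[K] W}
    (hs : IsSection A F s) {D : Place k K →₀ ℤ} (hD : ∀ v x, x ∈ F.stalk v ↔ v.LeOrd (D v) x)
    {v : Place k K} {m : ℤ} {x : W} (hx : ∀ a, v.LeOrd m a → a • x ∈ A.E.stalk v) {a : K}
    (ha : v.LeOrd (m - D v) a) : a • s x ∈ A.E.stalk v := by
  obtain ⟨z, hz⟩ := v.exists_ord_eq m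
  have h1 : ∀ y ∈ A.E.twistStalk F v, ∀ b, v.LeOrd (-D v) b → b • y ∈ A.E.stalk v := by
    intro y hy b hb
    induction hy using Submodule.span_induction with
    | mem y hy =>
      obtain ⟨c, hc, y, hy, rfl⟩ := hy
      rw [smul_smul]
      refine A.E.smul_mem ?_ hy
      have := hb.mul ((hD v c).1 hc)
      rwa [neg_add_cancel] at this
    | zero => rw [smul_zero]; exact zero_mem _
    | add y y' _ _ hy hy' => rw [smul_add]; exact add_mem hy hy'
    | smul r y _ hy => rw [smul_comm]; exact Submodule.smul_mem _ r hy
  have h2 := hs.stalk v _ (hx z ((v.leOrd_iff _ z).2 hz.ge))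
  have h3 : v.LeOrd (-D v) (a * ((z⁻¹ : Kˣ) : K)) := by
    rw [v.leOrd_smul_iff, v.ord_inv, hz]
    exact ha.mono (by omega)
  have h4 := h1 _ h2 _ h3
  rwa [map_smul, smul_smul, mul_assoc, Units.inv_mul, mul_one] at h4

theorem IsSection.pow_smul_mem {A : GSOBundle k K n W} {F : LineBundle k K} {s : W →ₗ[K] W}
    (hs : IsSection A F s) {D : Place k K →₀ ℤ} (hD : ∀ v x, x ∈ F.stalk v ↔ v.LeOrd (D v) x)
    {v : Place k K} {m : ℤ} {x : W} (hx : ∀ a, v.LeOrd m a → a • x ∈ A.E.stalk v) (i : ℕ) {a : K}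
    (ha : v.LeOrd (m - i * D v) a) : a • (s ^ i) x ∈ A.E.stalk v := by
  induction i generalizing a with
  | zero => exact hx a (ha.mono (by simp))
  | succ i ih =>
    rw [pow_succ', Module.End.mul_apply]
    exact hs.smul_mem hD (fun b hb => ih hb) (ha.mono (by push_cast; linarith))

variable [Module.Finite K W]

/-- The numerical data of a bundle with a Borel reduction: divisors of `F`, of the pairing line
bundle, and of the first line of the flag. -/
structure StratumData (A : GSOBundle k K n W) (F : LineBundle k K) where
  B : BorelReduction A
  vec : W
  vec_ne_zero : vec ≠ 0
  vec_mem : ∀ j : Fin (n + 1), vec ∈ B.flag j.succ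
  divF : Place k K →₀ ℤ
  divL : Place k K →₀ ℤ
  divVec : Place k K →₀ ℤ
  mem_F : ∀ v x, x ∈ F.stalk v ↔ v.LeOrd (divF v) x
  mem_L : ∀ v x, x ∈ A.L.stalk v ↔ v.LeOrd (divL v) x
  smul_vec_mem : ∀ v a, a • vec ∈ A.E.stalk v ↔ v.LeOrd (divVec v) a
  degree_neg : divDegree divF < 0
  slope_eq : ∀ j : Fin (n + 1),
    B.slope j + (n - (j : ℕ) : ℤ) * divDegree divF = B.slope (Fin.last n)
  slope_last : 2 * B.slope (Fin.last n) = - divDegree divL - divDegree divF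
  slope_zero : B.slope 0 = - divDegree divVec

theorem InStratum.exists_data {A : GSOBundle k K n W} {F : LineBundle k K} (hn : 1 ≤ n)
    (h : InStratum A F) : Nonempty (StratumData A F) := by
  obtain ⟨B, hcan, hsl, hlast⟩ := h
  obtain ⟨DF, hDF, hdF⟩ := LineBundle.exists_divisor F
  obtain ⟨DL, hDL, hdL⟩ := LineBundle.exists_divisor A.L
  have h1 : finrank K (B.flag (0 : Fin (n + 1)).succ) = 1 := B.finrank_flag _
  obtain ⟨⟨w, hw⟩, hw0, hgen⟩ := finrank_eq_one_iff'.1 h1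
  have hw0' : w ≠ 0 := fun h => hw0 (Subtype.ext h)
  obtain ⟨Ψ, hΨ⟩ := Module.Projective.exists_dual_ne_zero K hw0'
  obtain ⟨D, hD⟩ := exists_divisor_imageStalk A.E _ Ψ hw hΨ
  set t := Units.mk0 _ hΨ with ht
  have hslope := B.slope_eq 0 Ψ (fun x hx => by
    have : B.flag (0 : Fin (n + 1)).castSucc = ⊥ := by
      rw [← Submodule.finrank_eq_zero (R := K), B.finrank_flag]; rfl
    rw [this, Submodule.mem_bot] at hx
    rw [hx, map_zero]) hw hΨ hD
  have hZ : ∀ v a, a • w ∈ A.E.stalk v ↔ v.LeOrd ((D - principal t : Place k K →₀ ℤ) v) a := fun v a => by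
    rw [Finsupp.sub_apply, principal_apply, ← v.leOrd_smul_iff, ← hD, mem_imageStalk]
    constructor
    · exact fun h => ⟨a • w, Submodule.smul_mem _ _ hw, h, by rw [map_smul]; rfl⟩
    · rintro ⟨y, hy, hyE, hya⟩
      obtain ⟨c, hc⟩ := hgen ⟨y, hy⟩
      have hc' : c • w = y := congrArg Subtype.val hc
      have : c = a := by
        rw [← hc', map_smul] at hya
        exact mul_right_cancel₀ hΨ hya
      rwa [← this, hc']
  have hμ : ∀ m : ℕ, ∀ hm : m ≤ n, B.slope ⟨n - m, by omega⟩ =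
      B.slope (Fin.last n) + m * degree F.stalk := by
    intro m
    induction m with
    | zero => intro _; simp [Fin.last]
    | succ m ih =>
      intro hm
      have h2 := hsl ⟨n - (m + 1), by omega⟩
      have h3 : (⟨n - (m + 1), by omega⟩ : Fin n).succ = ⟨n - m, by omega⟩ := by
        ext; simp; omega
      have h4 : (⟨n - (m + 1), by omega⟩ : Fin n).castSucc = ⟨n - (m + 1), by omega⟩ := rfl
      rw [h3, h4, ih (by omega)] at h2
      rw [h2]; push_cast; ring
  refine ⟨⟨B, w, hw0', fun j => B.mono (Fin.succ_le_succ_iff.2 (Fin.zero_le j)) hw, DF, DL,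
    D - principal t, hDF, hDL, hZ, ?_, fun j => ?_, ?_, ?_⟩⟩
  -- Positivity of f is μ_1 > μ_2, which needs n ≥ 1. Sections of F have order at least `divF`, so
  -- deg F = -deg `divF`.
  · have h2 := hcan.1 ⟨0, hn⟩
    rw [hsl] at h2
    linarith
  · have h2 := hμ (n - j) (by omega)
    have h3 : (⟨n - (n - j), by omega⟩ : Fin (n + 1)) = j := by ext; simp; omega
    rw [h3, hdF, Nat.cast_sub (by omega)] at h2
    rw [h2]; ring
  · linarith
  · rw [map_sub, divDegree_principal, sub_zero, hslope]

/-- Induction on j lets the form y ↦ (s^i w, y) descend to the line X_{j+1}. If nonzero, it maps X_1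
⊗ X_{j+1} to L ⊗ F^i, forcing μ_1 + μ_{j+1} ≤ d + i f. The left side is d + (2n+1-j) f, so
(2n+1-i-j) f ≤ 0, against f > 0. -/
theorem StratumData.pairing_eq_zero {A : GSOBundle k K n W} {F : LineBundle k K}
    (d : StratumData A F) {s : W →ₗ[K] W} (hs : IsSection A F s) (j : ℕ) (hj : j < n + 1) (i : ℕ)
    (hij : i + j ≤ 2 * n) (y : W) (hy : y ∈ d.B.flag (⟨j, hj⟩ : Fin (n + 1)).succ) :
    A.q ((s ^ i) d.vec) y = 0 := by
  induction j using Nat.strong_induction_on generalizing i y with | _ j ih => ?_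
  by_contra h0
  have hprev : ∀ x ∈ d.B.flag (⟨j, hj⟩ : Fin (n + 1)).castSucc, A.q ((s ^ i) d.vec) x = 0 := by
    rcases j with _ | j
    · intro x hx
      have : d.B.flag (⟨0, hj⟩ : Fin (n + 1)).castSucc = ⊥ := by
        rw [← Submodule.finrank_eq_zero (R := K), d.B.finrank_flag]; rfl
      rw [this, Submodule.mem_bot] at hx
      rw [hx, map_zero]
    · exact fun x hx => ih j (by omega) (by omega) i (by omega) x hx
  obtain ⟨D, hD⟩ := exists_divisor_imageStalk A.E _ (A.q ((s ^ i) d.vec)) hy h0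
  have hslope := d.B.slope_eq ⟨j, hj⟩ _ hprev hy h0 hD
  have hloc : d.divL ≤ d.divVec - (i : ℤ) • d.divF + D := by
    intro v
    obtain ⟨x, hx⟩ := v.exists_ord_eq (D v)
    obtain ⟨y', _, hy', hyx⟩ := mem_imageStalk.1 ((hD v x).2 ((v.leOrd_iff _ x).2 hx.ge))
    obtain ⟨z, hz⟩ := v.exists_ord_eq (d.divVec v - i * d.divF v)
    have h1 := hs.pow_smul_mem d.mem_F (fun a ha => (d.smul_vec_mem v a).2 ha) i
      ((v.leOrd_iff _ z).2 hz.ge)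
    have h2 := (A.perfect v y').1 hy' _ h1
    rw [map_smul, LinearMap.smul_apply, hyx, smul_eq_mul, d.mem_L, ← Units.val_mul, v.leOrd_iff,
      v.ord_mul, hx, hz] at h2
    simpa using h2
  have h3 := divDegree_mono hloc
  simp only [map_add, map_sub, map_smul, smul_eq_mul] at h3
  have h4 := d.slope_eq ⟨j, hj⟩
  have h5 := d.slope_eq 0
  have h6 := d.slope_zero
  have h7 := d.slope_last
  have h8 := d.degree_neg
  have h9 : (i : ℤ) + j ≤ 2 * n := by exact_mod_cast hij
  simp only [Fin.val_zero] at h5 h4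
  push_cast at h5
  nlinarith

/-- The Lagrangian is its own orthogonal complement, and s^i w is orthogonal to it by the vanishing
for j = n. -/
theorem StratumData.pow_mem_flag {A : GSOBundle k K n W} {F : LineBundle k K}
    (d : StratumData A F) {s : W →ₗ[K] W} (hs : IsSection A F s) {i : ℕ} (hi : i ≤ n) :
    (s ^ i) d.vec ∈ d.B.flag (Fin.last (n + 1)) := by
  have hrefl : A.q.IsRefl := fun x y h => by rw [A.symm, h]
  have h1 : A.q.orthogonal (d.B.flag (Fin.last (n + 1))) = d.B.flag (Fin.last (n + 1)) := by
    refine (Submodule.eq_of_le_of_finrank_eq (fun x hx => ?_) ?_).symm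
    · exact fun y hy => d.B.isotropic y hy x hx
    · rw [LinearMap.BilinForm.finrank_orthogonal A.nondegenerate, d.B.finrank_flag, A.finrank_eq]
      simp
      omega
  rw [← h1]
  intro y hy
  rw [A.symm]
  exact d.pairing_eq_zero hs n (by omega) i (by omega) y hy

/-- Otherwise (s^i w, w) = 0 for all i < 2n+2, hence for all i by Cayley–Hamilton, and w would
generate an isotropic cyclic space. -/
theorem StratumData.top_pairing_ne_zero {A : GSOBundle k K n W} {F : LineBundle k K}
    (d : StratumData A F) {s : W →ₗ[K] W} (hs : IsSection A F s) (hdisc : s.charpoly.discr ≠ 0) :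
    A.q ((s ^ (2 * n + 1)) d.vec) d.vec ≠ 0 := by
  intro h0
  have hdeg : s.charpoly.natDegree = 2 * n + 2 := by
    rw [LinearMap.charpoly_natDegree, A.finrank_eq]
  have hsep := (separable_iff_discr (LinearMap.charpoly_monic s) (by omega)).2 hdisc
  have h1 : ∀ i < 2 * n + 2, A.q ((s ^ i) d.vec) d.vec = 0 := fun i hi => by
    rcases Nat.lt_or_ge i (2 * n + 1) with h | h
    · exact d.pairing_eq_zero hs 0 (by omega) i (by omega) _ (d.vec_mem _)
    · rwa [show i = 2 * n + 1 by omega]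
  refine d.vec_ne_zero (eq_zero_of_isotropic hsep hs.selfAdjoint A.nondegenerate fun i => ?_)
  have h2 : (s ^ i) = aeval s ((X : K[X]) ^ i %ₘ s.charpoly) := by
    conv_lhs => rw [← aeval_X_pow (R := K) s, ← modByMonic_add_div (X ^ i) s.charpoly]
    rw [map_add, map_mul, LinearMap.aeval_self_charpoly, zero_mul, add_zero]
  rw [h2, aeval_eq_sum_range' (n := 2 * n + 2), LinearMap.sum_apply, map_sum, LinearMap.sum_apply]
  · refine Finset.sum_eq_zero fun i hi => ?_
    rw [LinearMap.smul_apply, map_smul, LinearMap.smul_apply, h1 i (Finset.mem_range.1 hi),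
      smul_zero]
  · rw [← hdeg]
    exact natDegree_modByMonic_lt _ (LinearMap.charpoly_monic s) (by
      intro h; rw [h, natDegree_one] at hdeg; omega)

end Reduction

/-! ### The invariants of a section are sections of powers of F. -/

theorem _root_.Matrix.charpoly_smul_coeff {ι R : Type*} [Fintype ι] [DecidableEq ι] [CommRing R]
    (a : R) (M : Matrix ι ι R) {m : ℕ} (hm : m ≤ Fintype.card ι) :
    (a • M).charpoly.coeff (Fintype.card ι - m) =
      a ^ m * M.charpoly.coeff (Fintype.card ι - m) := by
  rw [Matrix.charpoly_coeff_eq_sum_minors _ _ hm, Matrix.charpoly_coeff_eq_sum_minors _ _ hm,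
    mul_left_comm]
  congr 1
  rw [Finset.mul_sum]
  refine Finset.sum_congr rfl fun s hs => ?_
  rw [show (a • M).submatrix (Subtype.val : s → ι) Subtype.val = a • M.submatrix Subtype.val Subtype.val
    from rfl, Matrix.det_smul, Fintype.card_coe,
    (Finset.mem_powersetCard.1 hs).2]

section Invariants

variable {k K : Type u} [Field k] [Field K] [Algebra k K]
  {n : ℕ} {W : Type w} [AddCommGroup W] [Module K W] [Module.Finite K W]

/-- In a local trivialisation s is a T with a a generator of F and T integral, and the m-th
coefficient is homogeneous of degree m. -/
theorem IsRegularAt.coeff_mem {A : GSOBundle k K n W} {F : LineBundle k K} {s : W →ₗ[K] W}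
    {v : Place k K} (h : IsRegularAt A F s v) {m : ℕ} (hm : m ≤ 2 * n + 2) :
    s.charpoly.coeff (2 * n + 2 - m) ∈ F.powStalk m v := by
  obtain ⟨b, l, a, J, T, hl, ha, hJ, hT, -⟩ := h
  have ha0 : a ≠ 0 := by
    rintro rfl
    have := F.span_eq_top v
    rw [ha] at this
    simp at this
  have hli : LinearIndependent K fun i => (b i : W) := by
    rw [← LinearIndependent.iff_fractionRing v.ring K]
    exact b.linearIndependent.map' (A.E.stalk v).subtype (Submodule.ker_subtype _)
  let bK : Basis (Fin (2 * n + 2)) K W := basisOfLinearIndependentOfCardEqFinrank hli (by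
    rw [A.finrank_eq, Fintype.card_fin])
  have hbK : ∀ i, bK i = b i := fun i => by simp [bK]
  have hmat : LinearMap.toMatrix bK bK s = a • T.map (algebraMap v.ring K) := by
    ext i j
    rw [LinearMap.toMatrix_apply, hbK, hT j]
    simp only [← hbK]
    rw [Basis.repr_sum_self]
    rfl
  rw [mem_powStalk_iff F _ v ha0 ha, ← LinearMap.charpoly_toMatrix s bK, hmat]
  have h1 := Matrix.charpoly_smul_coeff a (T.map (algebraMap v.ring K)) (m := m) (by simpa using hm)
  rw [Fintype.card_fin] at h1
  rw [h1, zpow_natCast, mul_comm, inv_mul_cancel_left₀ (pow_ne_zero _ ha0), Matrix.charpoly_map,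
    coeff_map]
  exact (T.charpoly.coeff _).2

theorem IsGoodSection.exists_invariants {A : GSOBundle k K n W} {F : LineBundle k K}
    {s : W →ₗ[K] W} (h : IsGoodSection A F s) :
    ∃ c : Invariants n F, s.charpoly = invPoly c.1 := by
  have hdeg : s.charpoly.natDegree = 2 * n + 2 := by
    rw [LinearMap.charpoly_natDegree, A.finrank_eq]
  refine ⟨⟨fun j => s.charpoly.coeff (2 * n - j), fun j v => ?_⟩,
    eq_invPoly (LinearMap.charpoly_monic s) hdeg ?_⟩
  · have := (h.regular v).coeff_mem (m := j + 2) (by omega)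
    rw [show 2 * n + 2 - ((j : ℕ) + 2) = 2 * n - j by omega] at this
    exact_mod_cast this
  · have h1 := h.isSection.trace_eq_zero
    have : Nontrivial W := Module.nontrivial_of_finrank_pos (R := K) (by rw [A.finrank_eq]; omega)
    let b := finBasis K W
    have h2 := Matrix.trace_eq_neg_charpoly_nextCoeff (LinearMap.toMatrix b b s)
    rw [← LinearMap.trace_eq_matrix_trace, h1, LinearMap.charpoly_toMatrix,
      nextCoeff_of_natDegree_pos (by omega), hdeg] at h2
    exact neg_eq_zero.1 h2.symm

end Invariants

/-! ### The isomorphism from the Kostant bundle to a bundle of the stratum. -/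

section Section

variable {k K : Type u} [Field k] [Field K] [Algebra k K] [hC : Fact (IsCurveFunctionField k K)]
  {n : ℕ} {F : LineBundle k K}

theorem mem_powStalk_iff_leOrd {D : Place k K →₀ ℤ} (hD : ∀ v x, x ∈ F.stalk v ↔ v.LeOrd (D v) x)
    (m : ℤ) (v : Place k K) (x : K) : x ∈ F.powStalk m v ↔ v.LeOrd (m * D v) x := by
  obtain ⟨t, ht⟩ := v.exists_ord_eq (D v)
  have h1 : F.stalk v = Submodule.span v.ring {(t : K)} := by
    ext x
    rw [mem_span_singleton_iff v.ring t.ne_zero, hD, ← v.leOrd_zero_iff,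
      ← Units.val_inv_eq_inv_val, v.leOrd_smul_iff, v.ord_inv, ht, sub_neg_eq_add, zero_add]
  rw [mem_powStalk_iff F m v t.ne_zero h1, ← v.leOrd_zero_iff, ← Units.val_zpow_eq_zpow_val,
    ← Units.val_inv_eq_inv_val, v.leOrd_smul_iff, v.ord_inv, v.ord_zpow, ht, sub_neg_eq_add,
    zero_add]

theorem Invariants.leOrd_coef (c : Invariants n F) {D : Place k K →₀ ℤ}
    (hD : ∀ v x, x ∈ F.stalk v ↔ v.LeOrd (D v) x) (v : Place k K) (m : ℕ) :
    v.LeOrd (m * D v) (coef c.1 m) := by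
  rw [coef]
  split_ifs with h
  · have := (mem_powStalk_iff_leOrd hD _ v _).1 (c.2 ⟨m - 2, by omega⟩ v)
    have h2 : (((m - 2 : ℕ) : ℤ) + 2) = m := by omega
    rwa [h2] at this
  · exact v.leOrd_zero _

theorem mem_kostantBundle_stalk {D : Place k K →₀ ℤ}
    (hD : ∀ v x, x ∈ F.stalk v ↔ v.LeOrd (D v) x) (v : Place k K) (x : Fin (2 * n + 2) → K) :
    x ∈ (kostantBundle n F).E.stalk v ↔ ∀ i : Fin (2 * n + 2),
      v.LeOrd (((n : ℤ) - (i : ℕ)) * D v) (x i) :=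
  forall_congr' fun i => mem_powStalk_iff_leOrd hD _ v _

variable {W : Type w} [AddCommGroup W] [Module K W] {A : GSOBundle k K n W}

/-- P_j is homogeneous of degree j when X has degree 1 and c_m degree m. As s and c_m take values in
F and F^m, P_j(s) x takes values in F^j. -/
theorem IsSection.kostantVector_smul_mem {s : W →ₗ[K] W} (hs : IsSection A F s) (c : Invariants n F)
    {D : Place k K →₀ ℤ} (hD : ∀ v x, x ∈ F.stalk v ↔ v.LeOrd (D v) x) {v : Place k K} {m : ℤ}
    {x : W} (hx : ∀ a, v.LeOrd m a → a • x ∈ A.E.stalk v) {j : ℕ}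
    (hj : j < 2 * n + 2) {a : K} (ha : v.LeOrd (m - j * D v) a) :
    a • kostantVector c.1 s x j ∈ A.E.stalk v := by
  induction j using Nat.strong_induction_on generalizing a with | _ j ih => ?_
  rcases j with _ | j
  · rw [kostantVector_of_le _ _ _ (by omega), pow_zero]
    exact hx a (ha.mono (by simp))
  · rw [kostantVector_succ, smul_add]
    refine Submodule.add_mem _ (hs.smul_mem hD (fun b hb => ih j (by omega) (by omega) hb)
      (ha.mono (by push_cast; linarith))) ?_
    have hterm : ∀ (p i : ℕ) (y : K), p + i = j + 1 → i ≤ j → v.LeOrd (p * D v) y →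
        a • y • kostantVector c.1 s x i ∈ A.E.stalk v := by
      intro p i y hpi hi hy
      rw [smul_smul]
      refine ih i (by omega) (by omega) ((ha.mul hy).mono (le_of_eq ?_))
      have : (p : ℤ) + i = j + 1 := by exact_mod_cast hpi
      push_cast
      linear_combination (-D v) * this
    have hhalf : ∀ (p : ℕ), v.LeOrd (p * D v) (coef c.1 p / 2) := fun p => by
      have h1 := (c.leOrd_coef hD v p).mul (v.leOrd_const (2⁻¹ : k))
      rwa [add_zero, map_inv₀, map_ofNat, ← div_eq_mul_inv] at h1
    rw [kostantCorr]
    split_ifs with h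
    · rw [smul_add, smul_add]
      exact Submodule.add_mem _ (Submodule.add_mem _
        (hterm _ _ _ (by omega) (by omega) (c.leOrd_coef hD v _))
        (hterm _ _ _ (by omega) (by omega) (hhalf _)))
        (hterm _ _ _ (by omega) (by omega) (hhalf _))
    · rw [smul_zero]
      exact zero_mem _

variable [Module.Finite K W]

theorem eq_zero_of_divDegree_eq_zero {D : Place k K →₀ ℤ} (h : 0 ≤ D) (hd : divDegree D = 0) :
    D = 0 := by
  rw [divDegree_eq_sum D subset_rfl, Finset.sum_eq_zero_iff_of_nonneg fun v _ =>
    mul_nonneg (by positivity) (h v)] at hd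
  ext v
  by_contra h0
  have h1 := hd v (Finsupp.mem_support_iff.2 h0)
  have h2 := v.degree_pos
  rcases mul_eq_zero.1 h1 with h3 | h3
  · omega
  · exact h0 h3

theorem kostantMap_pow {c : Fin (2 * n + 1) → K} {s : W →ₗ[K] W} {w : W}
    (hcomp : ∀ x, kostantMap c s w (kostantOp c x) = s (kostantMap c s w x)) (i : ℕ) :
    kostantMap c s w ((kostantOp c ^ i) (Pi.single 0 1)) = (s ^ i) w := by
  induction i with
  | zero =>
    rw [pow_zero, pow_zero, Module.End.one_apply, Module.End.one_apply, kostantMap_single,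
      kostantVector_of_le _ _ _ (by simp)]
    simp
  | succ i ih => rw [pow_succ', pow_succ', Module.End.mul_apply, Module.End.mul_apply, hcomp, ih]

/-- κ₁(c) is self-adjoint for the pulled back form, and (s^i w, w) = 0 for i ≤ 2n. -/
theorem StratumData.pairing_kostantMap (d : StratumData A F) {s : W →ₗ[K] W}
    (hs : IsSection A F s) {c : Fin (2 * n + 1) → K}
    (hcomp : ∀ x, kostantMap c s d.vec (kostantOp c x) = s (kostantMap c s d.vec x))
    (x y : Fin (2 * n + 2) → K) :
    A.q (kostantMap c s d.vec x) (kostantMap c s d.vec y) =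
      A.q ((s ^ (2 * n + 1)) d.vec) d.vec * Matrix.toBilin' (antidiag K (2 * n + 2)) x y := by
  have h0 : kostantMap c s d.vec (Pi.single 0 1) = d.vec := by
    simpa using kostantMap_pow hcomp 0
  have h := eq_antidiag_of_selfAdjoint c
    (A.q.compl₁₂ (kostantMap c s d.vec) (kostantMap c s d.vec))
    (A.q ((s ^ (2 * n + 1)) d.vec) d.vec) (fun x y => ?_) (fun i hi => ?_) ?_
  · exact LinearMap.congr_fun₂ h x y
  · simp only [LinearMap.compl₁₂_apply, hcomp, hs.selfAdjoint]
  · rw [LinearMap.compl₁₂_apply, kostantMap_pow hcomp, h0]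
    exact d.pairing_eq_zero hs 0 (by omega) i (by omega) _ (d.vec_mem _)
  · rw [LinearMap.compl₁₂_apply, kostantMap_pow hcomp, h0]

theorem StratumData.eta_kostantMap (d : StratumData A F) {s : W →ₗ[K] W}
    (hs : IsSection A F s) {c : Fin (2 * n + 1) → K} {l : K} (hl : l ≠ 0)
    (hq : ∀ x y, A.q (kostantMap c s d.vec x) (kostantMap c s d.vec y) =
      l * Matrix.toBilin' (antidiag K (2 * n + 2)) x y)
    (b : Fin (2 * n + 2) → Fin (2 * n + 2) → K) :
    A.η (fun i => kostantMap c s d.vec (b i)) = l ^ (n + 1) * Matrix.detRowAlternating b := by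
  let e := Pi.basisFun K (Fin (2 * n + 2))
  -- Scaling the second half by l⁻¹ makes the basis hyperbolic without moving w, ..., s^n w out of
  -- the Lagrangian. The scaling has determinant l^(-(n+1)), which accounts for the similitude
  -- factor.
  let g : Fin (2 * n + 2) → K := fun i => if (i : ℕ) < n + 1 then 1 else l⁻¹
  have hg : ∏ i, g i = (l ^ (n + 1))⁻¹ := by
    rw [Finset.prod_ite, Finset.prod_const_one, one_mul, Finset.prod_const, inv_pow]
    congr 2
    rw [Finset.filter_not, Finset.card_sdiff_of_subset (Finset.filter_subset _ _), Finset.card_univ,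
      Fintype.card_fin, Fin.card_filter_val_lt]
    omega
  have h1 : A.η (fun i => g i • kostantMap c s d.vec (e i)) = 1 := by
    refine d.B.oriented _ (fun i hi => ?_) fun i j => ?_
    · rw [Pi.basisFun_apply, kostantMap_single, kostantVector_of_le _ _ _ (by omega)]
      exact Submodule.smul_mem _ _ (d.pow_mem_flag hs (by omega))
    · rw [map_smul, map_smul, LinearMap.smul_apply, hq, Pi.basisFun_apply, Pi.basisFun_apply, Matrix.toBilin'_single]
      rw [antidiag, Matrix.of_apply]
      split_ifs with hij
      · subst hij
        simp only [g, Fin.val_rev, smul_eq_mul]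
        by_cases hi : (i : ℕ) < n + 1
        · rw [if_neg (by omega), if_pos hi]; field_simp
        · rw [if_pos (by omega), if_neg hi]; field_simp
      · simp
  have h2 := A.η.toMultilinearMap.map_smul_univ g fun i => kostantMap c s d.vec (e i)
  simp only [AlternatingMap.coe_multilinearMap] at h2
  rw [h1, hg, smul_eq_mul] at h2
  have h3 := (A.η.compLinearMap (kostantMap c s d.vec)).eq_smul_basis_det e
  have h4 := congrArg (fun f => f b) h3
  simp only [AlternatingMap.compLinearMap_apply, AlternatingMap.smul_apply, smul_eq_mul] at h4
  rw [show (A.η fun i => kostantMap c s d.vec (b i)) = _ from h4, Pi.basisFun_det]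
  congr 1
  have := pow_ne_zero (n + 1) hl
  change A.η (fun i => kostantMap c s d.vec (e i)) = _
  field_simp at h2
  exact h2.symm

/-- One inclusion is the homogeneity of P_j. The other follows by duality, since l generates the
expected line bundle at every place. The scalar r matches F^n, the first summand of the Kostant
bundle, with X_1. -/
theorem StratumData.mem_stalk_iff (d : StratumData A F) {s : W →ₗ[K] W}
    (hs : IsSection A F s) (c : Invariants n F) {l : Kˣ}
    (hl : A.q ((s ^ (2 * n + 1)) d.vec) d.vec = l)
    (hq : ∀ x y, A.q (kostantMap c.1 s d.vec x) (kostantMap c.1 s d.vec y) =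
      l * Matrix.toBilin' (antidiag K (2 * n + 2)) x y) (v : Place k K) {r : Kˣ}
    (hr : v.ord r = d.divVec v - n * d.divF v) (x : Fin (2 * n + 2) → K) :
    x ∈ (kostantBundle n F).E.stalk v ↔ (r : K) • kostantMap c.1 s d.vec x ∈ A.E.stalk v := by
  have hvec : ∀ v a, v.LeOrd (d.divVec v) a → a • d.vec ∈ A.E.stalk v :=
    fun v a ha => (d.smul_vec_mem v a).2 ha
  -- This is the divisor of l as a section of L ⊗ F^(2n+1) ⊗ X_1^(-2). It is effective by
  -- integrality of the pairing, and its degree d + (2n+1) f - 2 μ_1 is 0.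
  have hG : principal l + (2 : ℤ) • d.divVec - (2 * n + 1 : ℤ) • d.divF - d.divL = 0 := by
    refine eq_zero_of_divDegree_eq_zero (fun v => ?_) ?_
    · obtain ⟨z, hz⟩ := v.exists_ord_eq (d.divVec v)
      obtain ⟨u, hu⟩ := v.exists_ord_eq (d.divVec v - (2 * n + 1 : ℕ) * d.divF v)
      have h1 := hs.pow_smul_mem d.mem_F (hvec v) (2 * n + 1) ((v.leOrd_iff _ u).2 hu.ge)
      have h2 := hvec v z ((v.leOrd_iff _ z).2 hz.ge)
      have h3 := (A.perfect v _).1 h2 _ h1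
      rw [map_smul, map_smul, LinearMap.smul_apply, hl, d.mem_L, smul_eq_mul, smul_eq_mul,
        ← Units.val_mul, ← Units.val_mul, v.leOrd_iff, v.ord_mul, v.ord_mul, hz, hu] at h3
      simp only [Finsupp.sub_apply, Finsupp.add_apply, Finsupp.smul_apply, principal_apply,
        smul_eq_mul, Finsupp.zero_apply]
      push_cast at h3
      linarith
    · simp only [map_add, map_sub, map_smul, smul_eq_mul, divDegree_principal]
      have h5 := d.slope_eq 0
      have h6 := d.slope_zero
      have h7 := d.slope_last
      simp only [Fin.val_zero] at h5
      push_cast at h5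
      linarith
  have hGv := DFunLike.congr_fun hG v
  simp only [Finsupp.sub_apply, Finsupp.add_apply, Finsupp.smul_apply, principal_apply,
    smul_eq_mul, Finsupp.zero_apply] at hGv
  rw [mem_kostantBundle_stalk d.mem_F]
  constructor
  · intro hx
    rw [kostantMap, Fintype.linearCombination_apply, Finset.smul_sum]
    refine Submodule.sum_mem _ fun i _ => ?_
    rw [smul_smul]
    refine hs.kostantVector_smul_mem c d.mem_F (hvec v) i.2 ?_
    rw [mul_comm (r : K), v.leOrd_smul_iff, hr]
    exact (hx i).mono (by linarith)
  · intro hx i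
    have hi := i.2
    -- Pairing with the local section u P_{rev i}(s) w of E isolates the coordinate x_i, up to the
    -- factor r u l of known order.
    obtain ⟨u, hu⟩ := v.exists_ord_eq (d.divVec v - (Fin.rev i : ℕ) * d.divF v)
    have h1 := hs.kostantVector_smul_mem c d.mem_F (hvec v) (Fin.rev i).2
      ((v.leOrd_iff _ u).2 hu.ge)
    rw [← kostantMap_single] at h1
    have h2 := (A.perfect v _).1 hx _ h1
    rw [map_smul, map_smul, LinearMap.smul_apply, hq, antidiag_apply, Finset.sum_eq_single (Fin.rev i),
      Pi.single_eq_same, one_mul, Fin.rev_rev, d.mem_L] at h2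
    · have h3 : (r : K) • (u : K) • ((l : K) * x i) = x i * ((r * u * l : Kˣ) : K) := by
        simp only [smul_eq_mul, Units.val_mul]; ring
      rw [h3, v.leOrd_smul_iff, v.ord_mul, v.ord_mul, hr, hu] at h2
      refine h2.mono (le_of_eq ?_)
      have h4 : ((Fin.rev i : ℕ) : ℤ) = 2 * n + 1 - i := by
        rw [Fin.val_rev]; omega
      rw [h4]
      linear_combination hGv
    · intro j _ hj
      rw [Pi.single_eq_of_ne hj, zero_mul]
    · simp

theorem StratumData.exists_iso (h2 : (2 : k) ≠ 0) (d : StratumData A F) {s : W →ₗ[K] W}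
    (hs : IsGoodSection A F s) (c : Invariants n F) (hc : s.charpoly = invPoly c.1) :
    ∃ φ : (Fin (2 * n + 2) → K) ≃ₗ[K] W, IsGIso (kostantBundle n F) A φ ∧
      ∀ x, φ (kostantOp c.1 x) = s (φ x) := by
  have h2' : (2 : K) ≠ 0 := by
    rw [← map_ofNat (algebraMap k K), Ne, map_eq_zero]; exact h2
  have hcomp : ∀ x, kostantMap c.1 s d.vec (kostantOp c.1 x) = s (kostantMap c.1 s d.vec x) :=
    kostantMap_comp h2' c.1 s d.vec (by rw [← hc, LinearMap.aeval_self_charpoly]; rfl)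
  have hl := d.top_pairing_ne_zero hs.isSection hs.discr_ne_zero
  have hq := d.pairing_kostantMap hs.isSection hcomp
  have hinj : Function.Injective (kostantMap c.1 s d.vec) := by
    rw [injective_iff_map_eq_zero]
    intro x hx
    refine (kostantBundle n F).nondegenerate.1 x fun y => ?_
    have := hq x y
    rw [hx, map_zero, LinearMap.zero_apply] at this
    exact (mul_eq_zero.1 this.symm).resolve_left hl
  let φ := LinearMap.linearEquivOfInjective _ hinj (by rw [A.finrank_eq]; simp)
  refine ⟨φ, ⟨⟨_, hl, hq, d.eta_kostantMap hs.isSection hl hq⟩, fun v => ?_⟩, hcomp⟩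
  obtain ⟨r, hr⟩ := v.exists_ord_eq (d.divVec v - n * d.divF v)
  exact ⟨r, r.ne_zero, d.mem_stalk_iff hs.isSection c (l := Units.mk0 _ hl) rfl hq v hr⟩

end Section

/-! ### Automorphisms of pairs are scalar. -/

theorem commute_aeval {R A : Type*} [CommRing R] [Ring A] [Algebra R A] {g x : A}
    (h : Commute g x) (f : R[X]) : Commute g (aeval x f) := by
  induction f using Polynomial.induction_on' with
  | add f f' hf hf' => rw [map_add]; exact hf.add_right hf'
  | monomial j a =>
    rw [aeval_monomial]
    exact (Algebra.commute_algebraMap_right a g).mul_right (h.pow_right j)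

section Automorphisms

variable {k K : Type u} [Field k] [Field K] [Algebra k K] [hC : Fact (IsCurveFunctionField k K)]
  {n : ℕ} {F : LineBundle k K}

theorem kostantBundle_single_mem {D : Place k K →₀ ℤ}
    (hD : ∀ v x, x ∈ F.stalk v ↔ v.LeOrd (D v) x) (v : Place k K) (i : Fin (2 * n + 2)) {a : K}
    (ha : v.LeOrd (((n : ℤ) - (i : ℕ)) * D v) a) :
    Pi.single i a ∈ (kostantBundle n F).E.stalk v := by
  rw [mem_kostantBundle_stalk hD]
  intro j
  rcases eq_or_ne j i with rfl | h
  · rwa [Pi.single_eq_same]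
  · rw [Pi.single_eq_of_ne h]
    exact v.leOrd_zero _

/-- The local automorphism a φ multiplies the pairing by a² c. The first and last local basis
vectors pair to a generator of L, and their preimages pair into L, so a² c has no zero at v. -/
theorem kostantBundle_ord_le {φ : (Fin (2 * n + 2) → K) ≃ₗ[K] (Fin (2 * n + 2) → K)}
    {c a : Kˣ} (hc : ∀ x y, (kostantBundle n F).q (φ x) (φ y) = c * (kostantBundle n F).q x y)
    {v : Place k K}
    (ha : ∀ x, x ∈ (kostantBundle n F).E.stalk v ↔ (a : K) • φ x ∈ (kostantBundle n F).E.stalk v)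
    {D : Place k K →₀ ℤ} (hD : ∀ v x, x ∈ F.stalk v ↔ v.LeOrd (D v) x) :
    2 * v.ord a + v.ord c ≤ 0 := by
  have hL : ∀ x, x ∈ (kostantBundle n F).L.stalk v ↔ v.LeOrd (-1 * D v) x :=
    fun x => mem_powStalk_iff_leOrd hD (-1) v x
  have hinv : ∀ y ∈ (kostantBundle n F).E.stalk v, ∃ x ∈ (kostantBundle n F).E.stalk v,
      (a : K) • φ x = y := fun y hy => by
    have h1 : (a : K) • φ (φ.symm ((a : K)⁻¹ • y)) = y := by
      rw [φ.apply_symm_apply, smul_inv_smul₀ a.ne_zero]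
    exact ⟨_, (ha _).2 (by rwa [h1]), h1⟩
  obtain ⟨t, ht⟩ := v.exists_ord_eq (n * D v)
  obtain ⟨u, hu⟩ := v.exists_ord_eq (-(n + 1) * D v)
  obtain ⟨x, hx, hxt⟩ := hinv _ (kostantBundle_single_mem hD v 0 (a := t)
    ((v.leOrd_iff _ t).2 (by simp [ht])))
  obtain ⟨y, hy, hyu⟩ := hinv _ (kostantBundle_single_mem hD v (Fin.last _) (a := u)
    ((v.leOrd_iff _ u).2 (by rw [hu, Fin.val_last]; push_cast; linarith)))
  have h1 := ((kostantBundle n F).perfect v y).1 hy x hx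
  have h2 : (kostantBundle n F).q ((a : K) • φ x) ((a : K) • φ y) = t * u := by
    rw [hxt, hyu]
    change Matrix.toBilin' (antidiag K (2 * n + 2)) _ _ = _
    rw [antidiag_apply, Finset.sum_eq_single 0]
    · simp
    · intro i _ hi
      rw [Pi.single_eq_of_ne hi, zero_mul]
    · simp
  rw [map_smul, map_smul, LinearMap.smul_apply, hc] at h2
  have h3 : (kostantBundle n F).q x y = ((t * u * (a * a * c)⁻¹ : Kˣ) : K) := by
    rw [Units.val_mul, Units.val_mul, ← h2, Units.val_inv_eq_inv_val, Units.val_mul, Units.val_mul]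
    have := a.ne_zero
    have := c.ne_zero
    simp only [smul_eq_mul]
    field_simp
  rw [h3, hL, v.leOrd_iff, v.ord_mul, v.ord_mul, v.ord_inv, v.ord_mul, v.ord_mul, ht, hu] at h1
  linarith

theorem kostantBundle_automorphism {D : Place k K →₀ ℤ}
    (hD : ∀ v x, x ∈ F.stalk v ↔ v.LeOrd (D v) x) (hdeg : divDegree D < 0)
    {φ : (Fin (2 * n + 2) → K) ≃ₗ[K] (Fin (2 * n + 2) → K)}
    (h : IsGIso (kostantBundle n F) (kostantBundle n F) φ) {c : Fin (2 * n + 1) → K}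
    (hcomm : ∀ x, φ (kostantOp c x) = kostantOp c (φ x)) : ∃ a : K, ∀ x, φ x = a • x := by
  obtain ⟨⟨e, he0, he, -⟩, hstalk⟩ := h
  lift e to Kˣ using isUnit_iff_ne_zero.2 he0
  have hα : ∀ j : Fin (2 * n + 2), j ≠ 0 → φ (Pi.single 0 1) j = 0 := by
    intro j hj
    by_contra h0
    set α := Units.mk0 _ h0 with hα
    -- The local scalars a come from a twist and need not be a global function. Doubling the
    -- inequality ord α + ord a + j D ≥ 0 allows a² to be replaced by e⁻¹, which is global. For j >
    -- 0 the degree 2 j deg D is negative, a contradiction.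
    have h1 : 0 ≤ (2 : ℤ) • principal α - principal e + (2 * (j : ℕ) : ℤ) • D := by
      intro v
      obtain ⟨a, ha0, ha⟩ := hstalk v
      lift a to Kˣ using isUnit_iff_ne_zero.2 ha0
      have h2 := kostantBundle_ord_le he ha hD
      obtain ⟨t, ht⟩ := v.exists_ord_eq (n * D v)
      have h3 := (ha _).1 (kostantBundle_single_mem hD v 0 (a := t)
        ((v.leOrd_iff _ t).2 (by simp [ht])))
      have h4 := (mem_kostantBundle_stalk hD v _).1 h3 j
      have h5 : ((a : K) • φ (Pi.single 0 (t : K))) j = ((a * (t * α) : Kˣ) : K) := by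
        have : (Pi.single 0 (t : K) : Fin (2 * n + 2) → K) = (t : K) • Pi.single 0 1 := by
          rw [← Pi.single_smul, smul_eq_mul, mul_one]
        rw [this, map_smul]
        rfl
      rw [h5, v.leOrd_iff, v.ord_mul, v.ord_mul, ht] at h4
      simp only [Finsupp.add_apply, Finsupp.sub_apply, Finsupp.smul_apply, principal_apply,
        smul_eq_mul, Finsupp.zero_apply]
      linarith
    have h2 := divDegree_mono h1
    simp only [map_zero, map_add, map_sub, map_smul, divDegree_principal, smul_eq_mul, mul_zero,
      sub_zero, zero_add] at h2
    have h3 : 0 < ((j : ℕ) : ℤ) := by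
      have : (j : ℕ) ≠ 0 := fun h => hj (Fin.ext h)
      omega
    nlinarith
  refine ⟨φ (Pi.single 0 1) 0, fun x => ?_⟩
  -- As e_0 is cyclic and φ commutes with polynomials in κ₁(c), the scalar at e_0 is the scalar
  -- everywhere.
  obtain ⟨f, -, rfl⟩ := exists_aeval_kostantOp c x
  have h1 : φ (Pi.single 0 1) = φ (Pi.single 0 1) 0 • Pi.single 0 1 := by
    ext j
    rcases eq_or_ne j 0 with rfl | hj
    · simp
    · rw [hα j hj, Pi.smul_apply, Pi.single_eq_of_ne hj, smul_zero]
  have h2 : ∀ y, φ (aeval (kostantOp c) f y) = aeval (kostantOp c) f (φ y) := by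
    have : Commute (φ : (Fin (2 * n + 2) → K) →ₗ[K] _) (kostantOp c) := LinearMap.ext hcomm
    intro y
    exact LinearMap.congr_fun (commute_aeval this f) y
  rw [h2]
  conv_lhs => rw [h1]
  rw [map_smul]

theorem StratumPair.exists_kostant (hn : 1 ≤ n) (h2 : (2 : k) ≠ 0) (P : StratumPair n F) :
    ∃ c : Invariants n F, P.s.charpoly = invPoly c.1 ∧
      ∃ φ : (Fin (2 * n + 2) → K) ≃ₗ[K] (Fin (2 * n + 2) → K), IsGIso (kostantBundle n F) P.A φ ∧
        ∀ x, φ (kostantOp c.1 x) = P.s (φ x) := by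
  obtain ⟨d⟩ := P.inStratum.exists_data hn
  obtain ⟨c, hc⟩ := P.good.exists_invariants
  exact ⟨c, hc, d.exists_iso h2 P.good c hc⟩

theorem StratumPair.automorphism (hn : 1 ≤ n) (h2 : (2 : k) ≠ 0) (P : StratumPair n F)
    {φ : (Fin (2 * n + 2) → K) ≃ₗ[K] (Fin (2 * n + 2) → K)} (hφ : IsGIso P.A P.A φ)
    (hs : ∀ x, φ (P.s x) = P.s (φ x)) : ∃ a : K, ∀ x, φ x = a • x := by
  obtain ⟨d⟩ := P.inStratum.exists_data hn
  obtain ⟨c, -, ψ, hψ, hcomp⟩ := P.exists_kostant hn h2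
  obtain ⟨a, ha⟩ := kostantBundle_automorphism d.mem_F d.degree_neg
    ((hψ.trans hφ).trans hψ.symm) (c := c.1) fun x => by
      simp only [LinearEquiv.trans_apply]
      rw [hcomp, hs, LinearEquiv.symm_apply_eq, hcomp, LinearEquiv.apply_symm_apply]
  refine ⟨a, fun x => ?_⟩
  have h1 := ha (ψ.symm x)
  simp only [LinearEquiv.trans_apply, LinearEquiv.apply_symm_apply] at h1
  rw [LinearEquiv.symm_apply_eq, map_smul, LinearEquiv.apply_symm_apply] at h1
  exact h1

end Automorphisms

/-! ### Regularity and rescaling of the Kostant section. -/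

section Regularity

/-- Idempotents correspond to clopen subsets of the spectrum, which is finite. -/
theorem finite_isIdempotentElem (R : Type*) [CommRing R] [IsArtinianRing R] :
    {e : R | IsIdempotentElem e}.Finite := by
  have : Finite (TopologicalSpace.Clopens (PrimeSpectrum R)) :=
    Finite.of_injective (fun U => (U : Set (PrimeSpectrum R))) SetLike.coe_injective
  have : Finite {e : R | IsIdempotentElem e} :=
    Finite.of_equiv _ (PrimeSpectrum.isIdempotentElemEquivClopens (R := R)).toEquiv.symm
  exact Set.toFinite _

/-- When 2 is invertible, involutions are 2 e - 1 with e idempotent, here in a finite commutative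
algebra. -/
theorem finite_involutions {Ω A : Type*} [Field Ω] [Ring A] [Algebra Ω A] [Module.Finite Ω A]
    (h2 : (2 : Ω) ≠ 0) (T : A) : {g : A | g ∈ Algebra.adjoin Ω {T} ∧ g * g = 1}.Finite := by
  have : IsMulCommutative (Algebra.adjoin Ω {T}) := Algebra.isMulCommutative_adjoin Ω (by
    rintro _ rfl _ rfl; rfl)
  have : Module.Finite Ω (Algebra.adjoin Ω {T}) :=
    inferInstanceAs (Module.Finite Ω (Subalgebra.toSubmodule (Algebra.adjoin Ω {T})))
  have : IsArtinianRing (Algebra.adjoin Ω {T}) := IsArtinianRing.of_finite Ω _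
  refine ((finite_isIdempotentElem (Algebra.adjoin Ω {T})).image
    fun e : Algebra.adjoin Ω {T} => (2 : Ω) • (e : A) - 1).subset ?_
  rintro g ⟨hg, hgg⟩
  refine ⟨(2⁻¹ : Ω) • (1 + ⟨g, hg⟩), ?_, ?_⟩
  · refine Subtype.ext ?_
    change ((2⁻¹ : Ω) • (1 + g)) * ((2⁻¹ : Ω) • (1 + g)) = (2⁻¹ : Ω) • (1 + g)
    have h1 : (1 + g) * (1 + g) = (2 : Ω) • (1 + g) := by
      rw [mul_add, mul_one, add_mul, hgg, one_mul, two_smul]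
      abel
    rw [smul_mul_smul_comm, h1, smul_smul, mul_assoc, inv_mul_cancel₀ h2, mul_one]
  · change (2 : Ω) • ((2⁻¹ : Ω) • (1 + g)) - 1 = g
    rw [smul_inv_smul₀ h2, add_sub_cancel_left]

variable {K : Type u} [Field K] {n : ℕ}

/-- An operator commuting with κ₁(c) is determined by the image f(κ₁(c)) e_0 of the cyclic vector,
so it equals f(κ₁(c)). -/
theorem mem_adjoin_of_commute (c : Fin (2 * n + 1) → K)
    {g : Matrix (Fin (2 * n + 2)) (Fin (2 * n + 2)) K} (h : g * kostant c = kostant c * g) :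
    g ∈ Algebra.adjoin K {kostant c} := by
  obtain ⟨f, -, hf⟩ := exists_aeval_kostantOp c (Matrix.toLin' g (Pi.single 0 1))
  have hcomm : Commute (Matrix.toLin' g) (kostantOp c) := by
    change Matrix.toLin' g ∘ₗ Matrix.toLin' _ = Matrix.toLin' _ ∘ₗ Matrix.toLin' g
    rw [← Matrix.toLin'_mul, ← Matrix.toLin'_mul, h]
  have h1 : Matrix.toLin' g = aeval (kostantOp c) f := by
    refine LinearMap.ext fun x => ?_
    obtain ⟨f', -, rfl⟩ := exists_aeval_kostantOp c x
    have h3 := LinearMap.congr_fun (commute_aeval hcomm f').eq (Pi.single 0 1)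
    rw [Module.End.mul_apply, Module.End.mul_apply, ← hf, ← Module.End.mul_apply (aeval _ f'),
      ← map_mul, mul_comm f' f, map_mul, Module.End.mul_apply] at h3
    exact h3
  have h2 : g = aeval (kostant c) f := by
    apply Matrix.toLinAlgEquiv'.injective
    rw [← AlgEquiv.coe_toAlgHom, ← aeval_algHom_apply]
    exact h1
  rw [h2]
  exact aeval_mem_adjoin_singleton K _

theorem antidiag_mul_self (m : ℕ) : antidiag K m * antidiag K m = 1 := by
  ext i j
  have h1 : ∀ l : Fin m, j = Fin.rev l ↔ l = Fin.rev j := fun l =>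
    ⟨fun h => by rw [h, Fin.rev_rev], fun h => by rw [h, Fin.rev_rev]⟩
  simp [Matrix.mul_apply, antidiag, Matrix.one_apply, h1, eq_comm]

theorem kostant_transpose_mul (c : Fin (2 * n + 1) → K) :
    (kostant c).transpose * antidiag K (2 * n + 2) = antidiag K (2 * n + 2) * kostant c := by
  ext i j
  have h1 : ∀ m : Fin (2 * n + 2), j = Fin.rev m ↔ m = Fin.rev j := fun m =>
    ⟨fun h => by rw [h, Fin.rev_rev], fun h => by rw [h, Fin.rev_rev]⟩
  simp only [Matrix.mul_apply, antidiag, Matrix.of_apply, Matrix.transpose_apply, h1, mul_ite,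
    mul_one, mul_zero, ite_mul, one_mul, zero_mul, Finset.sum_ite_eq', Finset.mem_univ, if_true]
  rw [← kostant_rev c (Fin.rev i) j, Fin.rev_rev]

/-- The centraliser consists of polynomials in κ₁(c), which are self-adjoint. An orthogonal
self-adjoint g satisfies g² = 1, and the algebra has finitely many such elements. -/
theorem isRegularMatrix_kostant (h2 : (2 : K) ≠ 0) (c : Fin (2 * n + 1) → K) :
    IsRegularMatrix (antidiag K (2 * n + 2)) (kostant c) := by
  refine (finite_involutions h2 (kostant c)).subset ?_
  rintro g ⟨h1, -, h3⟩
  have hg := mem_adjoin_of_commute c h3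
  refine ⟨hg, ?_⟩
  have h4 : g.transpose * antidiag K (2 * n + 2) = antidiag K (2 * n + 2) * g := by
    clear h1 h3
    induction hg using Algebra.adjoin_induction with
    | mem x hx => rw [hx]; exact kostant_transpose_mul c
    | algebraMap r =>
      rw [Algebra.algebraMap_eq_smul_one, Matrix.transpose_smul, Matrix.transpose_one]
      simp
    | add x y _ _ hx hy => rw [Matrix.transpose_add, add_mul, mul_add, hx, hy]
    | mul x y hx' hy' hx hy =>
      rw [Matrix.transpose_mul, mul_assoc, hx, ← mul_assoc, hy, mul_assoc]
      congr 1
      have : IsMulCommutative (Algebra.adjoin K {kostant c}) := Algebra.isMulCommutative_adjoin K (by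
        rintro _ rfl _ rfl; rfl)
      exact congrArg Subtype.val (mul_comm (⟨y, hy'⟩ : Algebra.adjoin K {kostant c}) ⟨x, hx'⟩)
  rw [h4, mul_assoc] at h1
  have h5 := congrArg (fun M => antidiag K (2 * n + 2) * M) h1
  simp only [← mul_assoc, antidiag_mul_self, one_mul] at h5
  exact h5

/-- Specialization of the Kostant section. -/
theorem map_kostant {R Ω : Type u} [CommRing R] [Field Ω] {f : R →+* K} (hf : Function.Injective f)
    (g : R →+* Ω) (h2 : (2 : K) ≠ 0) (h2' : (2 : Ω) ≠ 0) (d : Fin (2 * n + 1) → R)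
    {T : Matrix (Fin (2 * n + 2)) (Fin (2 * n + 2)) R}
    (hT : ∀ i j, f (T i j) = kostant (fun m => f (d m)) i j) :
    T.map g = kostant fun m => g (d m) := by
  have hcoef : ∀ m, ∃ r : R, f r = coef (fun m => f (d m)) m ∧ g r = coef (fun m => g (d m)) m := by
    intro m
    rw [coef, coef]
    by_cases h : 2 ≤ m ∧ m ≤ 2 * n + 2
    · exact ⟨d ⟨m - 2, by omega⟩, by rw [dif_pos h], by rw [dif_pos h]⟩
    · exact ⟨0, by rw [dif_neg h, map_zero], by rw [dif_neg h, map_zero]⟩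
  ext i j
  have h := hT i j
  rw [Matrix.map_apply]
  simp only [kostant, Matrix.of_apply] at h ⊢
  obtain ⟨r, hr, hr'⟩ := hcoef (j - i + 1)
  rw [← hr] at h
  rw [← hr']
  split_ifs at h ⊢
  · rw [hf (h.trans (map_one f).symm), map_one]
  · rw [hf (h.trans (map_neg f r).symm), map_neg]
  -- Doubling avoids division by 2 in R.
  · have h3 : f (2 * T i j) = f (-r) := by
      rw [map_mul, map_ofNat, h, map_neg]; field_simp
    have h4 := congrArg g (hf h3)
    rw [map_mul, map_ofNat, map_neg] at h4
    rw [← h4]; field_simp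
  · rw [hf (h.trans (map_zero f).symm), map_zero]
  · rw [hf (h.trans (map_zero f).symm), map_zero]

/-- Equivariance under the torus: conjugation by the diagonal matrix of the t^(n-i), together with
scaling by t, amounts to giving c_m weight m. -/
theorem kostant_scale (c : Fin (2 * n + 1) → K) {t : K} (ht : t ≠ 0) (i j : Fin (2 * n + 2)) :
    kostant c i j = t ^ ((j : ℤ) - (i : ℕ) + 1) *
      kostant (fun m : Fin (2 * n + 1) => c m * (t ^ ((m : ℤ) + 2))⁻¹) i j := by
  have hcoef : ∀ m : ℕ, coef c m = t ^ (m : ℤ) *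
      coef (fun m : Fin (2 * n + 1) => c m * (t ^ ((m : ℤ) + 2))⁻¹) m := by
    intro m
    rw [coef, coef]
    split_ifs with h
    · have h1 : (((m - 2 : ℕ) : ℤ) + 2) = m := by omega
      simp only [h1]
      have := zpow_ne_zero (m : ℤ) ht
      field_simp
    · rw [mul_zero]
  simp only [kostant, Matrix.of_apply]
  rw [hcoef]
  split_ifs with h1 h2 h3 h4
  · rw [h1]; push_cast; simp
  · rw [show (((j : ℕ) - (i : ℕ) + 1 : ℕ) : ℤ) = (j : ℤ) - (i : ℕ) + 1 by omega]; ring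
  · rw [show (((j : ℕ) - (i : ℕ) + 1 : ℕ) : ℤ) = (j : ℤ) - (i : ℕ) + 1 by omega]; ring
  · rw [mul_zero]
  · rw [mul_zero]

end Regularity

/-! ### The standard isotropic flag and its orientation. -/

section StandardFlag

variable {K : Type u} [Field K]

/-- The span of the first `i` standard basis vectors. -/
def standardFlag (K : Type u) [Field K] (N i : ℕ) : Submodule K (Fin N → K) :=
  LinearMap.ker (LinearMap.funLeft K K fun j : {j : Fin N // i ≤ (j : ℕ)} => (j : Fin N))

theorem mem_standardFlag {N i : ℕ} {x : Fin N → K} :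
    x ∈ standardFlag K N i ↔ ∀ j : Fin N, i ≤ (j : ℕ) → x j = 0 := by
  rw [standardFlag, LinearMap.mem_ker, funext_iff]
  exact ⟨fun h j hj => h ⟨j, hj⟩, fun h j => h j j.2⟩

theorem finrank_standardFlag {N i : ℕ} (hi : i ≤ N) : finrank K (standardFlag K N i) = i := by
  have h1 := LinearMap.finrank_range_add_finrank_ker
    (LinearMap.funLeft K K fun j : {j : Fin N // i ≤ (j : ℕ)} => (j : Fin N))
  rw [LinearMap.range_eq_top.2 (LinearMap.funLeft_surjective_of_injective K K _
    Subtype.val_injective), finrank_top, finrank_fintype_fun_eq_card, finrank_fintype_fun_eq_card,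
    Fintype.card_fin, Fintype.card_subtype] at h1
  have h2 : (Finset.univ.filter fun j : Fin N => i ≤ (j : ℕ)).card = N - i := by
    rw [show (Finset.univ.filter fun j : Fin N => i ≤ (j : ℕ)) =
      Finset.univ \ Finset.univ.filter fun j : Fin N => (j : ℕ) < i by ext; simp,
      Finset.card_sdiff_of_subset (Finset.filter_subset _ _), Finset.card_univ, Fintype.card_fin,
      Fin.card_filter_val_lt]
    omega
  rw [h2] at h1
  change N - i + finrank K (standardFlag K N i) = N at h1
  omega

variable {n : ℕ}

theorem antidiag_standardFlag {x y : Fin (2 * n + 2) → K}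
    (hx : x ∈ standardFlag K (2 * n + 2) (n + 1)) (hy : y ∈ standardFlag K (2 * n + 2) (n + 1)) :
    Matrix.toBilin' (antidiag K (2 * n + 2)) x y = 0 := by
  rw [antidiag_apply]
  refine Finset.sum_eq_zero fun i _ => ?_
  rcases Nat.lt_or_ge (i : ℕ) (n + 1) with h | h
  · rw [mem_standardFlag.1 hy (Fin.rev i) (by rw [Fin.val_rev]; omega), mul_zero]
  · rw [mem_standardFlag.1 hx i h, zero_mul]

/-- A hyperbolic basis whose first half lies in the standard Lagrangian has determinant `1`. -/
theorem det_of_hyperbolic {b : Fin (2 * n + 2) → Fin (2 * n + 2) → K}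
    (hb : ∀ i : Fin (2 * n + 2), (i : ℕ) < n + 1 → b i ∈ standardFlag K (2 * n + 2) (n + 1))
    (hq : ∀ i j, Matrix.toBilin' (antidiag K (2 * n + 2)) (b i) (b j) =
      if j = Fin.rev i then 1 else 0) : (Matrix.of b).det = 1 := by
  have hblock := Matrix.twoBlockTriangular_det (Matrix.of b) (fun i => ¬ (i : ℕ) < n + 1)
    fun i hi j hj => mem_standardFlag.1 (hb i (not_not.1 hi)) j (by omega)
  rw [hblock]
  let e : {i : Fin (2 * n + 2) // ¬ ¬ (i : ℕ) < n + 1} ≃ {i : Fin (2 * n + 2) // ¬ (i : ℕ) < n + 1} :=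
    Fin.revPerm.subtypeEquiv fun i => by
      have := i.2
      rw [Fin.revPerm_apply, Fin.val_rev]; omega
  set P := (Matrix.of b).toSquareBlockProp fun i => ¬ ¬ (i : ℕ) < n + 1 with hP
  set S := (Matrix.of b).toSquareBlockProp fun i => ¬ (i : ℕ) < n + 1 with hS
  -- The basis matrix is block triangular. The pairings between its two halves only see the diagonal
  -- blocks P and S, which are therefore mutually inverse up to reversal and transposition.
  have h1 : P * (S.submatrix e e).transpose = 1 := by
    ext i j
    have h2 := hq i (Fin.rev j)
    rw [antidiag_apply, ← Finset.sum_filter_of_ne (p := fun m : Fin (2 * n + 2) => ¬ ¬ (m : ℕ) < n + 1)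
      (fun m _ hm => ?_), Finset.sum_subtype _ (p := fun m : Fin (2 * n + 2) => ¬ ¬ (m : ℕ) < n + 1)
      (fun m => by simp)] at h2
    · refine h2.trans ?_
      simp only [Matrix.one_apply, Fin.rev_inj, Subtype.ext_iff, eq_comm]
    · intro h
      rw [mem_standardFlag.1 (hb i (not_not.1 i.2)) m (by omega), zero_mul] at hm
      exact hm rfl
  have h2 := congrArg Matrix.det h1
  rw [Matrix.det_mul, Matrix.det_transpose, Matrix.det_submatrix_equiv_self, Matrix.det_one] at h2
  rw [mul_comm, h2]

end StandardFlag

/-! ### The Kostant bundle lies in the stratum and κ₁(c) is a good section of it. -/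

section KostantPair

variable {k K : Type u} [Field k] [Field K] [Algebra k K] [hC : Fact (IsCurveFunctionField k K)]
  {n : ℕ} {F : LineBundle k K}

/-- The standard Borel reduction of the bundle that carries the Kostant section. -/
def kostantReduction (n : ℕ) (F : LineBundle k K) : BorelReduction (kostantBundle n F) where
  flag i := standardFlag K (2 * n + 2) i
  mono i j hij x hx := mem_standardFlag.2 fun m hm => mem_standardFlag.1 hx m
    (le_trans (by exact_mod_cast hij) hm)
  finrank_flag i := finrank_standardFlag (by omega)
  isotropic x hx y hy := antidiag_standardFlag hx hy
  oriented b hb hq := det_of_hyperbolic hb hq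

/-- The j-th coordinate identifies the j-th graded piece with F^(n-j). -/
theorem kostantReduction_slope {D : Place k K →₀ ℤ}
    (hD : ∀ v x, x ∈ F.stalk v ↔ v.LeOrd (D v) x) (j : Fin (n + 1)) :
    (kostantReduction n F).slope j = -(((n : ℤ) - (j : ℕ)) * divDegree D) := by
  have hj : (j : ℕ) < 2 * n + 2 := by omega
  have hdeg : divDegree (((n : ℤ) - (j : ℕ)) • D) = ((n : ℤ) - (j : ℕ)) * divDegree D := by
    rw [map_smul, smul_eq_mul]
  rw [← hdeg]
  refine (kostantReduction n F).slope_eq j (LinearMap.proj ⟨j, hj⟩)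
    (y := Pi.single ⟨j, hj⟩ 1) (fun x hx => mem_standardFlag.1 hx _ le_rfl)
    (mem_standardFlag.2 fun m hm => Pi.single_eq_of_ne (fun h => ?_) _) (by simp) fun v x => ?_
  · rw [h] at hm
    simp at hm
  · rw [mem_imageStalk, Finsupp.smul_apply, smul_eq_mul]
    constructor
    · rintro ⟨y, -, hy, rfl⟩
      exact (mem_kostantBundle_stalk hD v y).1 hy ⟨j, hj⟩
    · intro hx
      refine ⟨Pi.single ⟨j, hj⟩ x, mem_standardFlag.2 fun m hm => Pi.single_eq_of_ne (fun h => ?_) _,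
        kostantBundle_single_mem hD v _ hx, by simp⟩
      rw [h] at hm
      simp at hm

theorem kostantBundle_inStratum (hF : 0 < degree F.stalk) : InStratum (kostantBundle n F) F := by
  obtain ⟨D, hD, hdeg⟩ := LineBundle.exists_divisor F
  have hL : degree (kostantBundle n F).L.stalk = - degree F.stalk := by
    refine (degree_eq_neg_divDegree (LinearEquiv.refl K K) (kostantBundle n F).L.stalk
      ((-1 : ℤ) • D) fun v x => mem_powStalk_iff_leOrd hD (-1) v x).trans ?_
    rw [hdeg]
    simp
  refine ⟨kostantReduction n F, ⟨fun i => ?_, fun i hi => ?_⟩, fun i => ?_, ?_⟩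
  · rw [kostantReduction_slope hD, kostantReduction_slope hD, Fin.val_succ, Fin.val_castSucc]
    push_cast
    linarith
  · rw [kostantReduction_slope hD, kostantReduction_slope hD, Fin.val_succ, Fin.val_castSucc, hL,
      hdeg, hi, sub_self, show (n : ℤ) - (i : ℕ) = 1 by omega]
    linarith
  · rw [kostantReduction_slope hD, kostantReduction_slope hD, Fin.val_succ, Fin.val_castSucc, hdeg]
    push_cast
    ring
  · rw [kostantReduction_slope hD, hL, Fin.val_last]
    simp

theorem kostant_trace (c : Fin (2 * n + 1) → K) : (kostant c).trace = 0 := by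
  refine Finset.sum_eq_zero fun i _ => ?_
  rw [Matrix.diag_apply, kostant, Matrix.of_apply, if_neg (by omega), if_neg (by omega)]

theorem Place.LeOrd.sum {v : Place k K} {ι : Type*} {S : Finset ι} {m : ℤ} {x : ι → K}
    (h : ∀ i ∈ S, v.LeOrd m (x i)) : v.LeOrd m (∑ i ∈ S, x i) := by
  classical
  induction S using Finset.induction_on with
  | empty => rw [Finset.sum_empty]; exact v.leOrd_zero m
  | insert i S hi ih =>
    rw [Finset.sum_insert hi]
    exact (h i (Finset.mem_insert_self i S)).add (ih fun j hj => h j (Finset.mem_insert_of_mem hj))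

theorem Invariants.leOrd_kostant (c : Invariants n F) {D : Place k K →₀ ℤ}
    (hD : ∀ v x, x ∈ F.stalk v ↔ v.LeOrd (D v) x) (v : Place k K) (i j : Fin (2 * n + 2)) :
    v.LeOrd (((j : ℤ) - (i : ℕ) + 1) * D v) (kostant c.1 i j) := by
  rw [kostant, Matrix.of_apply]
  split_ifs with h1 h2 h3 h4
  · rw [h1]
    have := v.leOrd_const (1 : k)
    rw [map_one] at this
    exact this.mono (by push_cast; linarith)
  · have := (c.leOrd_coef hD v (j - i + 1)).neg
    rwa [show (((j : ℕ) - (i : ℕ) + 1 : ℕ) : ℤ) = (j : ℤ) - (i : ℕ) + 1 by omega] at this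
  · have := ((c.leOrd_coef hD v (j - i + 1)).neg).mul (v.leOrd_const (2⁻¹ : k))
    rwa [add_zero, map_inv₀, map_ofNat, ← div_eq_mul_inv,
      show (((j : ℕ) - (i : ℕ) + 1 : ℕ) : ℤ) = (j : ℤ) - (i : ℕ) + 1 by omega] at this
  · exact v.leOrd_zero _
  · exact v.leOrd_zero _

theorem kostantOp_isSection (c : Invariants n F) :
    IsSection (kostantBundle n F) F (kostantOp c.1) := by
  obtain ⟨D, hD, hdeg⟩ := LineBundle.exists_divisor F
  refine ⟨antidiag_kostantOp c.1, ?_, fun v x hx => ?_⟩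
  · rw [LinearMap.trace_eq_matrix_trace K (Pi.basisFun K _), LinearMap.toMatrix_eq_toMatrix',
      LinearMap.toMatrix'_toLin', kostant_trace]
  · obtain ⟨t, ht⟩ := v.exists_ord_eq (D v)
    refine Submodule.subset_span ⟨t, (hD v _).2 ((v.leOrd_iff _ t).2 ht.ge),
      ((t⁻¹ : Kˣ) : K) • kostantOp c.1 x, ?_, ?_⟩
    · rw [mem_kostantBundle_stalk hD] at hx ⊢
      intro i
      rw [Pi.smul_apply, smul_eq_mul, mul_comm ((t⁻¹ : Kˣ) : K), v.leOrd_smul_iff, v.ord_inv, ht,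
        Matrix.toLin'_apply, Matrix.mulVec, dotProduct]
      refine Place.LeOrd.sum fun j _ => ?_
      exact ((c.leOrd_kostant hD v i j).mul (hx j)).mono (by linarith)
    · rw [smul_smul, Units.mul_inv, one_smul]

/-- In the local basis t^(n-i) e_i, with t a generator of F, the section is t times κ₁ of the
integral tuple c_m / t^m and the Gram matrix is t⁻¹ times the antidiagonal one. Reduction therefore
gives a value of κ₁ over the residue field. -/
theorem kostantOp_isRegularAt (h2 : (2 : k) ≠ 0) (c : Invariants n F) (v : Place k K) :
    IsRegularAt (kostantBundle n F) F (kostantOp c.1) v := by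
  obtain ⟨t, ht0, ht⟩ := F.exists_generator v
  let β := (Pi.basisFun K (Fin (2 * n + 2))).isUnitSMul
      (fun i => isUnit_iff_ne_zero.2 (zpow_ne_zero ((n : ℤ) - (i : ℕ)) ht0))
  have hβ : ∀ i, β i = Pi.single i (t ^ ((n : ℤ) - (i : ℕ))) := fun i => by
    rw [Basis.isUnitSMul_apply, Pi.basisFun_apply, ← Pi.single_smul, smul_eq_mul, mul_one]
  have hli : LinearIndependent v.ring β := (LinearIndependent.iff_fractionRing v.ring K).2
    β.linearIndependent
  have hspan : Submodule.span v.ring (Set.range β) = (kostantBundle n F).E.stalk v := by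
    ext x
    rw [show (β : Fin (2 * n + 2) → Fin (2 * n + 2) → K) =
      fun i : Fin (2 * n + 2) => Pi.single i (t ^ ((n : ℤ) - (i : ℕ)))
      from funext hβ, mem_pi_span_iff v.ring _ (fun i => zpow_ne_zero _ ht0)]
    exact forall_congr' fun i => (mem_powStalk_iff F _ v ht0 ht).symm
  let b := (Basis.span hli).map (LinearEquiv.ofEq _ _ hspan)
  have hb : ∀ i, (b i : Fin (2 * n + 2) → K) = Pi.single i (t ^ ((n : ℤ) - (i : ℕ))) := fun i => by
    rw [← hβ]
    simp [b, Basis.span_apply]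
  have hsingle : ∀ (i : Fin (2 * n + 2)) (a : K),
      (Pi.single i a : Fin (2 * n + 2) → K) = a • Pi.single i 1 := fun i a => by
    rw [← Pi.single_smul, smul_eq_mul, mul_one]
  have hd : ∀ m : Fin (2 * n + 1), c.1 m * (t ^ ((m : ℤ) + 2))⁻¹ ∈ v.ring := fun m =>
    (mem_powStalk_iff F _ v ht0 ht).1 (c.2 m v)
  let d : Fin (2 * n + 1) → v.ring := fun m => ⟨_, hd m⟩
  have hT : ∀ i j, kostant (fun m => ((d m : v.ring) : K)) i j ∈ v.ring := by
    intro i j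
    have hcoef : ∀ m, coef (fun m => ((d m : v.ring) : K)) m ∈ v.ring := fun m => by
      rw [coef]
      split_ifs
      · exact (d _).2
      · exact v.ring.zero_mem
    have hhalf : (2 : K)⁻¹ ∈ v.ring := by
      have := v.const_mem (2⁻¹ : k)
      rwa [map_inv₀, map_ofNat] at this
    rw [kostant, Matrix.of_apply]
    split_ifs
    · exact v.ring.one_mem
    · exact v.ring.neg_mem _ (hcoef _)
    · rw [div_eq_mul_inv]
      exact v.ring.mul_mem _ _ (v.ring.neg_mem _ (hcoef _)) hhalf
    · exact v.ring.zero_mem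
    · exact v.ring.zero_mem
  let Ω := AlgebraicClosure (IsLocalRing.ResidueField v.ring)
  have h2K : (2 : K) ≠ 0 := by
    rw [← map_ofNat (algebraMap k K), Ne, map_eq_zero]; exact h2
  have h2Ω : (2 : Ω) ≠ 0 := by
    have : (2 : Ω) = algebraMap (IsLocalRing.ResidueField v.ring) Ω
      (algebraMap k (IsLocalRing.ResidueField v.ring) 2) := by
      rw [map_ofNat, map_ofNat]
    rw [this, Ne, map_eq_zero, map_eq_zero]
    exact h2
  refine ⟨b, t⁻¹, t, Matrix.of fun i j => if j = Fin.rev i then 1 else 0,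
    Matrix.of fun i j => ⟨_, hT i j⟩, ?_, ht, fun i j => ?_, fun j => ?_, ?_⟩
  · rw [← zpow_neg_one]
    exact powStalk_eq F (-1) v ht0 ht
  · rw [hb, hb]
    change Matrix.toBilin' (antidiag K (2 * n + 2)) _ _ = _
    rw [hsingle i (t ^ _), hsingle j (t ^ _), map_smul, map_smul, LinearMap.smul_apply, Matrix.toBilin'_single, antidiag,
      Matrix.of_apply, Matrix.of_apply]
    split_ifs with hij
    · rw [hij, Fin.val_rev, smul_eq_mul, smul_eq_mul, mul_one, ← zpow_add₀ ht0, ← zpow_neg_one]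
      change _ = t ^ (-1 : ℤ) * 1
      rw [mul_one]
      congr 1
      have := i.2
      omega
    · simp
  · simp only [hb]
    ext i
    rw [Finset.sum_apply, Finset.sum_eq_single i]
    · rw [hsingle, map_smul, Pi.smul_apply, Matrix.toLin'_apply, Matrix.mulVec_single_one,
        Matrix.col_apply, kostant_scale c.1 ht0 i j, Pi.smul_apply, Pi.single_eq_same, smul_eq_mul,
        smul_eq_mul, ← mul_assoc, ← zpow_add₀ ht0, mul_right_comm]
      change _ * _ = t * t ^ _ * _
      rw [← zpow_one_add₀ ht0]
      congr 2
      ring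
    · intro i' _ hi
      rw [Pi.smul_apply, Pi.single_eq_of_ne hi.symm, smul_zero]
    · simp
  · rw [map_kostant (f := algebraMap v.ring K) (IsFractionRing.injective v.ring K)
      (algebraMap v.ring Ω) h2K h2Ω d
      (T := Matrix.of fun i j => ⟨_, hT i j⟩) (fun i j => rfl)]
    convert isRegularMatrix_kostant h2Ω _
    ext i j
    simp only [Matrix.map_apply, Matrix.of_apply, antidiag]
    split_ifs <;> simp

theorem kostantOp_isGoodSection (h2 : (2 : k) ≠ 0) (c : Invariants n F)
    (hc : (invPoly c.1).discr ≠ 0) : IsGoodSection (kostantBundle n F) F (kostantOp c.1) := by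
  refine ⟨kostantOp_isSection c, kostantOp_isRegularAt h2 c, ?_⟩
  rwa [charpoly_kostantOp]
  rw [← map_ofNat (algebraMap k K), Ne, map_eq_zero]; exact h2

end KostantPair

/-! ### Inseparable translates of a polynomial. -/

section Discriminants

variable {K : Type u} [Field K]

/-- Only few constants make a given polynomial inseparable when added to it. -/
theorem card_discr_eq_zero_le {p : K[X]} (hp : p.Monic) (h0 : 0 < p.natDegree)
    (hd : derivative p ≠ 0) (S : Finset K) (hS : ∀ h ∈ S, (p + C h).discr = 0) :
    S.card ≤ p.natDegree - 1 := by
  classical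
  let Ω := AlgebraicClosure K
  let R := ((derivative p).map (algebraMap K Ω)).roots.toFinset
  have h1 : (S.image (algebraMap K Ω)) ⊆ R.image fun a => - aeval a p := by
    intro y hy
    obtain ⟨h, hh, rfl⟩ := Finset.mem_image.1 hy
    have hdeg : (C h).degree < p.degree := lt_of_le_of_lt degree_C_le (natDegree_pos_iff_degree_pos.1 h0)
    have hm : (p + C h).Monic := hp.add_of_left hdeg
    have h2 : ¬ (p + C h).Separable := fun hsep =>
      (separable_iff_discr hm (by rwa [natDegree_add_C])).1 hsep (hS h hh)
    rw [Separable, isCoprime_iff_aeval_ne_zero_of_isAlgClosed K Ω] at h2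
    push Not at h2
    -- A double root a of p + h is a root of p', and h = -p(a); so h is determined by one of the
    -- roots of p'.
    obtain ⟨a, ha, ha'⟩ := h2
    rw [derivative_add, derivative_C, add_zero] at ha'
    refine Finset.mem_image.2 ⟨a, ?_, ?_⟩
    · rw [Multiset.mem_toFinset, mem_roots (map_ne_zero hd), IsRoot.def, eval_map_algebraMap]
      exact ha'
    · rw [map_add, aeval_C] at ha
      exact neg_eq_of_add_eq_zero_right ha
  calc S.card = (S.image (algebraMap K Ω)).card :=
        (Finset.card_image_of_injective _ (algebraMap K Ω).injective).symm
    _ ≤ R.card := (Finset.card_le_card h1).trans Finset.card_image_le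
    _ ≤ _ := Multiset.toFinset_card_le _
    _ ≤ _ := card_roots' _
    _ ≤ (derivative p).natDegree := natDegree_map_le
    _ ≤ _ := natDegree_derivative_le p

end Discriminants

/-! ### Counting pairs, and the limit. -/

section Counting

variable {k K : Type u} [Field k] [Field K] [Algebra k K] [hC : Fact (IsCurveFunctionField k K)]
  {n : ℕ} {F : LineBundle k K}

theorem mem_sectionsPow_iff {D : Place k K →₀ ℤ} (hD : ∀ v x, x ∈ F.stalk v ↔ v.LeOrd (D v) x)
    (m : ℤ) (x : K) : x ∈ F.sectionsPow m ↔ x ∈ globalSections (-(m • D)) := by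
  rw [globalSections, mem_sectionSpace]
  simp only [VecBundle.sectionsPow, Set.mem_ofPred_eq, mem_powStalk_iff_leOrd hD, Set.mem_univ,
    forall_true_left, Finsupp.neg_apply, Finsupp.smul_apply, neg_neg, smul_eq_mul]

instance [Finite k] : Finite (Invariants n F) := by
  obtain ⟨D, hD, -⟩ := LineBundle.exists_divisor F
  have : ∀ j : Fin (2 * n + 1), Finite (globalSections (-((((j : ℕ) : ℤ) + 2) • D))) := fun j =>
    Module.finite_of_finite k
  refine Finite.of_injective (fun (c : Invariants n F) (j : Fin (2 * n + 1)) =>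
    (⟨c.1 j, (mem_sectionsPow_iff hD _ _).1 (c.2 j)⟩ : globalSections (-((((j : ℕ) : ℤ) + 2) • D))))
    fun c c' h => Subtype.ext (funext fun j => congrArg Subtype.val (congrFun h j))

/-- The pair given by a value of the Kostant section. -/
def kostantPair (h2 : (2 : k) ≠ 0) (hF : 0 < degree F.stalk)
    (c : {c : Invariants n F // (invPoly c.1).discr ≠ 0}) : StratumPair n F where
  A := kostantBundle n F
  s := kostantOp c.1.1
  inStratum := kostantBundle_inStratum hF
  good := kostantOp_isGoodSection h2 c.1 c.2

/-- Isomorphic pairs have the same characteristic polynomial, which determines c; surjectivity is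
the reduction of every pair to the Kostant section. -/
theorem kostantPair_bijective (hn : 1 ≤ n) (h2 : (2 : k) ≠ 0) (hF : 0 < degree F.stalk) :
    Function.Bijective fun c : {c : Invariants n F // (invPoly c.1).discr ≠ 0} =>
      (Quotient.mk (StratumPair.setoid n F) (kostantPair h2 hF c)) := by
  have h2' : (2 : K) ≠ 0 := by
    rw [← map_ofNat (algebraMap k K), Ne, map_eq_zero]; exact h2
  constructor
  · intro c c' h
    obtain ⟨φ, -, hφ⟩ := Quotient.exact h
    have h1 : kostantOp c'.1.1 = φ.conj (kostantOp c.1.1) := by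
      refine LinearMap.ext fun x => ?_
      rw [LinearEquiv.conj_apply_apply]
      have := hφ (φ.symm x)
      rw [LinearEquiv.apply_symm_apply] at this
      exact this.symm
    have h3 := congrArg LinearMap.charpoly h1
    rw [LinearEquiv.charpoly_conj, charpoly_kostantOp h2', charpoly_kostantOp h2'] at h3
    exact Subtype.ext (Subtype.ext (invPoly_injective h3.symm))
  · intro q
    obtain ⟨P, rfl⟩ := Quotient.exists_rep q
    obtain ⟨c, hc, φ, hφ, hs⟩ := P.exists_kostant hn h2
    refine ⟨⟨c, ?_⟩, Quotient.sound ⟨φ, hφ, hs⟩⟩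
    rw [← hc]
    exact P.good.discr_ne_zero

theorem card_stratumClasses [Finite k] (hn : 1 ≤ n) (h2 : (2 : k) ≠ 0) (hF : 0 < degree F.stalk) :
    Finite (StratumClasses n F) ∧ Nat.card (StratumClasses n F) =
      Nat.card {c : Invariants n F // (invPoly c.1).discr ≠ 0} := by
  have e := Equiv.ofBijective _ (kostantPair_bijective hn h2 hF)
  exact ⟨Finite.of_equiv _ e, (Nat.card_congr e).symm⟩

/-- Translation of the last invariant. -/
def Invariants.translate (c : Invariants n F) (h : F.sectionsPow (2 * n + 2)) : Invariants n F :=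
  ⟨Function.update c.1 (Fin.last (2 * n)) (c.1 (Fin.last (2 * n)) + h), fun j => by
    rcases eq_or_ne j (Fin.last (2 * n)) with rfl | hj
    · rw [Function.update_self]
      have h1 := h.2
      intro v
      refine Submodule.add_mem _ (c.2 _ v) ?_
      have := h1 v
      rw [Fin.val_last]; push_cast
      exact this
    · rw [Function.update_of_ne hj]
      exact c.2 j⟩

theorem Invariants.translate_val (c : Invariants n F) (h : F.sectionsPow (2 * n + 2)) :
    (c.translate h).1 =
      Function.update c.1 (Fin.last (2 * n)) (c.1 (Fin.last (2 * n)) + h) := rfl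

theorem invPoly_translate (c : Invariants n F) (h : F.sectionsPow (2 * n + 2)) :
    invPoly (c.translate h).1 = invPoly c.1 + C (h : K) := by
  rw [c.translate_val, invPoly, invPoly, Fin.sum_univ_castSucc, Fin.sum_univ_castSucc, add_assoc, add_assoc]
  congr 2
  · refine Finset.sum_congr rfl fun j _ => ?_
    rw [Function.update_of_ne (Fin.castSucc_lt_last j).ne]
  · rw [Function.update_self]
    simp

instance [Finite k] (m : ℤ) : Finite (F.sectionsPow m) := by
  obtain ⟨D, hD, -⟩ := LineBundle.exists_divisor F
  have : Finite (globalSections (-(m • D))) := Module.finite_of_finite k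
  exact Finite.of_injective (fun x : F.sectionsPow m =>
    (⟨x, (mem_sectionsPow_iff hD _ _).1 x.2⟩ : globalSections (-(m • D))))
    fun x y h => Subtype.ext (congrArg (fun z : globalSections (-(m • D)) => (z : K)) h)

theorem Invariants.translate_bijective [Finite k] (h : F.sectionsPow (2 * n + 2)) :
    Function.Bijective fun c : Invariants n F => c.translate h := by
  refine Finite.injective_iff_bijective.1 fun c c' hcc => Subtype.ext (funext fun j => ?_)
  have h1 := congrFun (congrArg Subtype.val hcc) j
  simp only [Invariants.translate_val] at h1
  rcases eq_or_ne j (Fin.last (2 * n)) with rfl | hj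
  · rw [Function.update_self, Function.update_self] at h1
    exact add_right_cancel h1
  · rwa [Function.update_of_ne hj, Function.update_of_ne hj] at h1

/-- Count the pairs (c, h) for which c translated by h has discriminant zero. Each translation
permutes the invariants, so every h contributes all bad c; each c contributes at most 2n+1 values of
h. -/
theorem card_discr_mul_le [Finite k] (hn : ((2 * n + 2 : ℕ) : k) ≠ 0) :
    Nat.card {c : Invariants n F // (invPoly c.1).discr = 0} *
      Nat.card (F.sectionsPow (2 * n + 2)) ≤ Nat.card (Invariants n F) * (2 * n + 1) := by
  classical
  let _ := Fintype.ofFinite (Invariants n F)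
  let _ := Fintype.ofFinite (F.sectionsPow (2 * n + 2))
  rw [Nat.card_eq_fintype_card, Nat.card_eq_fintype_card, Nat.card_eq_fintype_card,
    Fintype.card_subtype]
  have h1 : ∀ h : F.sectionsPow (2 * n + 2),
      (Finset.univ.filter fun c : Invariants n F => (invPoly c.1).discr = 0).card =
        (Finset.univ.filter fun c : Invariants n F => (invPoly (c.translate h).1).discr = 0).card :=
    fun h => (Finset.card_bijective _ (Invariants.translate_bijective h) (by simp)).symm
  have h2 : ∀ c : Invariants n F, (Finset.univ.filter fun h : F.sectionsPow (2 * n + 2) =>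
      (invPoly (c.translate h).1).discr = 0).card ≤ 2 * n + 1 := fun c => by
    -- The leading coefficient 2n+2 of the derivative is nonzero in k.
    have hd : derivative (invPoly c.1) ≠ 0 := fun h => by
      have h3 := congrArg (fun f => f.coeff (2 * n + 1)) h
      simp only [coeff_derivative, coeff_zero] at h3
      have h4 := (invPoly_monic c.1).coeff_natDegree
      rw [invPoly_natDegree] at h4
      rw [h4, one_mul] at h3
      apply hn
      rw [← map_eq_zero (algebraMap k K), map_natCast]
      rw [← h3]; push_cast; ring
    have h3 := card_discr_eq_zero_le (invPoly_monic c.1) (by rw [invPoly_natDegree]; omega) hd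
      ((Finset.univ.filter fun h : F.sectionsPow (2 * n + 2) =>
        (invPoly (c.translate h).1).discr = 0).image Subtype.val) (by
        intro x hx
        obtain ⟨h, hh, rfl⟩ := Finset.mem_image.1 hx
        rw [← invPoly_translate]
        exact (Finset.mem_filter.1 hh).2)
    rw [Finset.card_image_of_injective _ Subtype.val_injective, invPoly_natDegree] at h3
    omega
  calc _ = ∑ h : F.sectionsPow (2 * n + 2),
        (Finset.univ.filter fun c : Invariants n F => (invPoly c.1).discr = 0).card := by
          rw [Finset.sum_const, Finset.card_univ, smul_eq_mul, mul_comm]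
    _ = ∑ h : F.sectionsPow (2 * n + 2), ∑ c : Invariants n F,
        if (invPoly (c.translate h).1).discr = 0 then 1 else 0 :=
          Finset.sum_congr rfl fun h _ => by rw [h1 h, Finset.card_filter]
    _ = ∑ c : Invariants n F, ∑ h : F.sectionsPow (2 * n + 2),
        if (invPoly (c.translate h).1).discr = 0 then 1 else 0 := Finset.sum_comm
    _ ≤ ∑ c : Invariants n F, (2 * n + 1) := Finset.sum_le_sum fun c _ => by
          rw [← Finset.card_filter]; exact h2 c
    _ = _ := by rw [Finset.sum_const, Finset.card_univ, smul_eq_mul]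

theorem one_sub_div_le {b g N h H r : ℝ} (hN : 0 < N) (hh : 0 < h) (hH : h ≤ H) (hb : 0 ≤ b)
    (hs : b + g = N) (hm : b * H ≤ N * r) : 1 - r / h ≤ g / N := by
  have h1 : b / N ≤ r / h := by
    rw [div_le_div_iff₀ hN hh, mul_comm r]
    exact (mul_le_mul_of_nonneg_left hH hb).trans hm
  have h2 : b / N + g / N = 1 := by rw [← add_div, hs, div_self hN.ne']
  linarith

/-- The number of sections grows with the degree. -/
theorem exists_le_card_sectionsPow (k K : Type u) [Field k] [Field K] [Algebra k K]
    [Fact (IsCurveFunctionField k K)] [Finite k] : ∃ g : ℤ, ∀ (F : LineBundle k K) (m : ℤ),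
    m * degree F.stalk - g ≤ Nat.card (F.sectionsPow m) := by
  obtain ⟨g, hg⟩ := exists_riemann (k := k) (K := K)
  refine ⟨g, fun F m => ?_⟩
  obtain ⟨D, hD, hdeg⟩ := LineBundle.exists_divisor F
  have h1 : Nat.card (F.sectionsPow m) = Nat.card (globalSections (-(m • D))) :=
    Nat.card_congr (Equiv.subtypeEquivRight fun x => mem_sectionsPow_iff hD m x)
  rw [h1, Module.natCard_eq_pow_finrank (K := k)]
  have h2 := hg (-(m • D))
  rw [map_neg, map_smul, smul_eq_mul, ← mul_neg, ← hdeg] at h2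
  -- A lower bound linear in the degree suffices, so the dimension itself serves as a bound for the
  -- cardinality.
  have h3 : finrank k (globalSections (-(m • D))) <
      Nat.card k ^ finrank k (globalSections (-(m • D))) :=
    Nat.lt_pow_self Finite.one_lt_card
  have h4 : (finrank k (globalSections (-(m • D))) : ℤ) ≤
      ((Nat.card k ^ finrank k (globalSections (-(m • D))) : ℕ) : ℤ) := by exact_mod_cast h3.le
  linarith

theorem tendsto_card_ratio [Finite k] (hn : 1 ≤ n) (h2 : (2 : k) ≠ 0)
    (hn' : ((2 * n + 2 : ℕ) : k) ≠ 0) :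
    Tendsto (fun F : LineBundle k K =>
        (Nat.card (StratumClasses n F) : ℝ) / (Nat.card (Invariants n F) : ℝ))
      (comap (fun F : LineBundle k K => degree F.stalk) atTop) (𝓝 1) := by
  obtain ⟨g, hg⟩ := exists_le_card_sectionsPow k K
  have hlim : Tendsto (fun f : ℤ => (1 : ℝ) - (2 * n + 1) / ((((2 * n + 2) * f - g : ℤ)) : ℝ)) atTop
      (𝓝 1) := by
    have h1 : Tendsto (fun f : ℤ => ((((2 * n + 2) * f - g : ℤ)) : ℝ)) atTop atTop :=
      tendsto_intCast_atTop_atTop.comp (tendsto_atTop_add_const_right _ (-g)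
        (tendsto_id.const_mul_atTop' (by positivity)))
    simpa using (h1.const_div_atTop (2 * n + 1 : ℝ)).const_sub 1
  have hev : ∀ᶠ F : LineBundle k K in comap (fun F : LineBundle k K => degree F.stalk) atTop,
      -- Degree at least 1 gives access to the count of classes, and degree above g makes the lower
      -- bound (2n+2) f - g positive.
      max 1 (g + 1) ≤ degree F.stalk := tendsto_comap.eventually (eventually_ge_atTop _)
  refine tendsto_of_tendsto_of_tendsto_of_le_of_le' (hlim.comp tendsto_comap) tendsto_const_nhds
    ?_ ?_
  all_goals
    filter_upwards [hev] with F hF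
    obtain ⟨hF1, hFg⟩ := max_le_iff.1 hF
    rw [(card_stratumClasses hn h2 hF1).2]
    have : Nonempty (Invariants n F) := ⟨⟨0, fun j v => Submodule.zero_mem _⟩⟩
    have hpos : (0 : ℝ) < Nat.card (Invariants n F) := by exact_mod_cast Nat.card_pos
  · have hsum : Nat.card {c : Invariants n F // (invPoly c.1).discr = 0} +
        Nat.card {c : Invariants n F // (invPoly c.1).discr ≠ 0} = Nat.card (Invariants n F) := by
      classical
      rw [← Nat.card_sum]
      exact Nat.card_congr (Equiv.sumCompl _)
    have hH : 0 < (2 * n + 2) * degree F.stalk - g := by nlinarith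
    have hle := hg F (2 * n + 2)
    have hmul := card_discr_mul_le (F := F) hn'
    have hH' : (0 : ℝ) < (((2 * n + 2) * degree F.stalk - g : ℤ) : ℝ) := by exact_mod_cast hH
    have hle' : (((2 * n + 2) * degree F.stalk - g : ℤ) : ℝ) ≤
      Nat.card (F.sectionsPow (2 * n + 2)) := by exact_mod_cast hle
    have hmul' : (Nat.card {c : Invariants n F // (invPoly c.1).discr = 0} : ℝ) *
      Nat.card (F.sectionsPow (2 * n + 2)) ≤ Nat.card (Invariants n F) * (2 * n + 1) := by
      exact_mod_cast hmul
    have hsum' : (Nat.card {c : Invariants n F // (invPoly c.1).discr = 0} : ℝ) +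
        Nat.card {c : Invariants n F // (invPoly c.1).discr ≠ 0} = Nat.card (Invariants n F) := by
      exact_mod_cast hsum
    exact one_sub_div_le hpos hH' hle' (Nat.cast_nonneg _) hsum' hmul'
  · rw [div_le_one hpos]
    exact_mod_cast Nat.card_le_card_of_injective _ Subtype.val_injective

end Counting

end CurveBundle

end

theorem mainTheorem10 {k K : Type u} [Field k] [Finite k] [Field K] [Algebra k K]
    (hC : IsCurveFunctionField k K) (n : ℕ) (hn : 1 ≤ n) (hp : 4 * n < ringChar k) :
    -- every good section over a bundle in the stratum is conjugate to a value of `κ₁`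
    (∀ (F : LineBundle k K) (W : Type w) [AddCommGroup W] [Module K W] [Module.Finite K W]
      (A : GSOBundle k K n W), InStratum A F →
      ∀ s : W →ₗ[K] W, IsGoodSection A F s →
        ∃ c : Invariants n F, s.charpoly = invPoly c.1 ∧
          ∃ φ : (Fin (2 * n + 2) → K) ≃ₗ[K] W, IsGIso (kostantBundle n F) A φ ∧
            ∀ x, φ (Matrix.toLin' (kostant c.1) x) = s (φ x)) ∧
    -- the pairs `(E, s)` in the stratum have no nontrivial automorphisms
    (∀ (F : LineBundle k K) (P : StratumPair n F)
      (φ : (Fin (2 * n + 2) → K) ≃ₗ[K] (Fin (2 * n + 2) → K)),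
      IsGIso P.A P.A φ → (∀ x, φ (P.s x) = P.s (φ x)) → ∃ a : K, ∀ x, φ x = a • x) ∧
    -- their number is the number of tuples of invariants with nonzero discriminant
    (∀ F : LineBundle k K, 0 < degree F.stalk → Finite (StratumClasses n F) ∧
      Nat.card (StratumClasses n F) =
        Nat.card {c : Invariants n F // (invPoly c.1).discr ≠ 0}) ∧
    -- the contribution of the stratum to the average is `1`
    Tendsto (fun F : LineBundle k K =>
        (Nat.card (StratumClasses n F) : ℝ) / (Nat.card (Invariants n F) : ℝ))
      (comap (fun F : LineBundle k K => degree F.stalk) atTop) (𝓝 1) := by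
  have := Fact.mk hC
  have h2 : (2 : k) ≠ 0 := fun h => by
    have h1 := Nat.le_of_dvd two_pos ((ringChar.spec k 2).1 (by exact_mod_cast h))
    omega
  -- For n ≥ 1 one has 2n+2 ≤ 4n < p.
  have hN : ((2 * n + 2 : ℕ) : k) ≠ 0 := fun h => by
    have h1 := Nat.le_of_dvd (by omega) ((ringChar.spec k (2 * n + 2)).1 h)
    omega
  refine ⟨fun F W _ _ _ A hA s hs => ?_, fun F P φ hφ hs => P.automorphism hn h2 hφ hs,
    fun F hF => card_stratumClasses hn h2 hF, tendsto_card_ratio hn h2 hN⟩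
  obtain ⟨d⟩ := hA.exists_data hn
  obtain ⟨c, hc⟩ := hs.exists_invariants
  exact ⟨c, hc, d.exists_iso h2 hs c hc⟩
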